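/- Let $p_1\equiv p_2\equiv -q\equiv 1\pmod 4$ be distinct primes and let $k=\mathbb{Q}(\sqrt{p_1p_2q},\,i)$, where $i=\sqrt{-1}$. For a finite extension $L/k$, let $\kappa_L$ denote the capitulation kernel, that is, the kernel of the homomorphism $\mathrm{Cl}(k)\to\mathrm{Cl}(L)$ of ideal class groups induced by extension of ideals. Let $\mathrm{Am}_s(k/\mathbb{Q}(i))$ be the subgroup of $\mathrm{Cl}(k)$ generated by the strongly ambiguous classes of $k/\mathbb{Q}(i)$, i.e. the classes containing at least one nonzero ideal invariant under $\mathrm{Gal}(k/\mathbb{Q}(i))$. Let $k^{(*)}$ be the absolute genus field of $k$, i.e. the maximal unramified extension of $k$ that is the compositum of $k$ with an abelian extension of $\mathbb{Q}$. Let $K$ be any quadratic extension of $k$ that is unramified over $k$ and abelian over $\mathbb{Q}$. Then 1. $|\kappa_K|\in\{2,4,8\}$; 2. $\kappa_K\subseteq \mathrm{Am}_s(k/\mathbb{Q}(i))$; 3. $\mathrm{Am}_s(k/\mathbb{Q}(i))\subseteq \kappa_{k^{(*)}}$. -/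

import Mathlib

open NumberField nonZeroDivisors

noncomputable section

/-- The extension `L / k` is unramified at every prime of `k`, finite or infinite. -/
def IsUnramifiedExtension (k L : Type*) [Field k] [Field L] [Algebra k L] : Prop :=
  (∀ 𝔭 : Ideal (𝓞 k), 𝔭.IsPrime → Algebra.IsUnramifiedIn (𝓞 L) 𝔭) ∧
    IsUnramifiedAtInfinitePlaces k L

/-- The capitulation kernel of `L / k`: the kernel of the homomorphism `Cl(k) → Cl(L)` induced by
extension of ideals. -/
def capitulationKernel (k L : Type*) [Field k] [Field L] [Algebra k L] :
    Subgroup (ClassGroup (𝓞 k)) :=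
  (ClassGroup.extendedHom (𝓞 k) (𝓞 L)).ker

/-- An ideal class of `k` is strongly ambiguous for `k / F` if it contains a nonzero ideal that is
invariant under every element of `Gal(k / F)`. (Such a class is then itself invariant.) -/
def IsStronglyAmbiguous (F k : Type*) [Field F] [Field k] [NumberField k] [Algebra F k]
    (c : ClassGroup (𝓞 k)) : Prop :=
  ∃ I : (Ideal (𝓞 k))⁰,
    (∀ σ : Gal(k/F), (I : Ideal (𝓞 k)).map (RingOfIntegers.mapRingEquiv σ.toRingEquiv) = I) ∧
      ClassGroup.mk0 I = c

/-- The group `Am_s(k / F)` generated by the strongly ambiguous classes of `k / F`. -/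
def stronglyAmbiguousClasses (F k : Type*) [Field F] [Field k] [NumberField k] [Algebra F k] :
    Subgroup (ClassGroup (𝓞 k)) :=
  Subgroup.closure {c | IsStronglyAmbiguous F k c}

/-- The absolute genus field of a number field `k`: the largest unramified extension of `k` of the
form `k A` with `A` an abelian extension of `ℚ`, as the compositum of all of these inside an
algebraic closure of `k`. -/
def genusField (k : Type*) [Field k] [NumberField k] : IntermediateField k (AlgebraicClosure k) :=
  sSup {L | FiniteDimensional k L ∧ IsUnramifiedExtension k L ∧
    ∃ A : IntermediateField ℚ (AlgebraicClosure k), IsAbelianGalois ℚ A ∧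
      L = IntermediateField.adjoin k (A : Set (AlgebraicClosure k))}

/-- The field `ℚ(√d, i)`. -/
def biquadraticField (d : ℕ) : IntermediateField ℚ ℂ :=
  IntermediateField.adjoin ℚ {((Real.sqrt d : ℝ) : ℂ), Complex.I}

instance (d : ℕ) : NumberField (biquadraticField d) where
  to_charZero := inferInstance
  to_finiteDimensional := by
    refine IntermediateField.finiteDimensional_adjoin ?_
    rintro x (rfl | rfl)
    · refine IsIntegral.of_pow (n := 2) (by norm_num) ?_
      rw [← Complex.ofReal_pow, Real.sq_sqrt d.cast_nonneg, Complex.ofReal_natCast]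
      exact isIntegral_algebraMap (x := (d : ℚ))
    · refine IsIntegral.of_pow (n := 2) (by norm_num) ?_
      rw [Complex.I_sq]
      exact isIntegral_one.neg

/-- The element `i` of `ℚ(√d, i)`. -/
def imagUnit (d : ℕ) : biquadraticField d :=
  ⟨Complex.I, IntermediateField.subset_adjoin _ _ (by simp)⟩

/-- The subfield `ℚ(i)` of `ℚ(√d, i)`. -/
def gaussianField (d : ℕ) : IntermediateField ℚ (biquadraticField d) :=
  IntermediateField.adjoin ℚ {imagUnit d}

end

open scoped Pointwise

/-! ### Parity of valuations attached to units of norm one in quadratic fields -/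

/-! Write F = ℚ(i), d = p₁p₂q, let σ generate Gal(K/k) and τ generate Gal(k/F).

The order of the kernel is a matter of unit cohomology. If I capitulates in K with generator γ, then
γ/σγ is a unit of relative norm 1, and it determines the class of I modulo units w/σw. Squares of
units of norm 1 have this form, so the kernel is no larger than N/N², where N is the group of units
of relative norm 1. Unit ranks 1 and 3 give N/N² order 8 (`card_capitulationKernel_le`). Conversely,
K/k is unramified, so invariant ideals of K come from k; a trivial kernel would make every element
of N equal to some w/σw, and w ↦ wσ(w) would embed N/N² into a group of order 4
(`capitulationKernel_ne_bot`). The ideal norm shows that the kernel has exponent 2.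

For the second claim, K is first identified as ℚ(i, √m, √n) with mn = d and m ≡ 1 mod 4
(`exists_multiquadraticFrame`): inertia groups generate Gal(K/ℚ), so it has exponent 2, and
ramification restricts the available square roots. A capitulating class satisfies I² = (x) and I·τI
= (y), hence x·τI = y·I, where y/x has norm in {±1, ±i} over F. Norm ±1 yields an invariant ideal in
the class, by Hilbert 90. Norm ±i, up to changing y by a unit, produces from a generator of the
extension of I two units of K, of norm i over the fixed fields of τ and στ and with a common norm
over k. `false_of_unit_pair` rules these out unless k itself has a unit of norm ±i, which could have
been used to correct y. The contradiction rests on parity: the square class of a unit of norm 1 in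
ℚ(√m) is represented by an integer with even valuation at all unramified primes.

For the third claim, let I be invariant. Then I² is generated by some ν in ℤ[i], and unramified
primes occur in ν to even order, so ν is a unit times a square times ramified primes, all dividing
d. Each of these becomes a square up to a unit in k(√p₁, √p₂): for q this is clear, and for pᵢ it
follows from the unit of norm -1 in ℚ(√pᵢ) supplied by the negative Pell equation. That field lies
in the genus field, because k(√pᵢ)/k is unramified. -/

theorem even_padicValInt_of_mul_eq {ℓ : ℕ} (hℓ : ℓ.Prime) {x y m s : ℤ} (h : x * y = m * s ^ 2)
    (hx : x ≠ 0) (hm : ¬ (ℓ : ℤ) ∣ m) (hy : ¬ (ℓ : ℤ) ∣ y) : Even (padicValInt ℓ x) := by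
  have : Fact ℓ.Prime := ⟨hℓ⟩
  have hy0 : y ≠ 0 := by rintro rfl; simp at hy
  have hm0 : m ≠ 0 := by rintro rfl; simp at hm
  have hs0 : s ≠ 0 := by
    rintro rfl
    simp [hx, hy0] at h
  have h' := congrArg (padicValInt ℓ) h
  rw [padicValInt.mul hx hy0, padicValInt.mul hm0 (pow_ne_zero _ hs0), sq,
    padicValInt.mul hs0 hs0, padicValInt.eq_zero_of_not_dvd hy,
    padicValInt.eq_zero_of_not_dvd hm] at h'
  exact ⟨padicValInt ℓ s, by omega⟩

/-- If `(T + s √m) / 2` is a unit of norm one, then `T + 2` has even valuation at every prime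
which is unramified in `ℚ(√m)`. -/
theorem even_padicValInt_trace_add_two {ℓ : ℕ} (hℓ : ℓ.Prime) {m : ℕ} {T s : ℤ}
    (h : T ^ 2 - 4 = m * s ^ 2) (hT : T + 2 ≠ 0) (hm : ¬ ℓ ∣ m) (h2 : ℓ = 2 → m % 4 = 1) :
    Even (padicValInt ℓ (T + 2)) := by
  have : Fact ℓ.Prime := ⟨hℓ⟩
  have hm' : ¬ (ℓ : ℤ) ∣ m := by exact_mod_cast hm
  by_cases hdvd : (ℓ : ℤ) ∣ T + 2
  swap
  · rw [padicValInt.eq_zero_of_not_dvd hdvd]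
    exact Even.zero
  by_cases hℓ2 : ℓ = 2
  -- At 2 the factors T + 2 and T - 2 are both even, so powers of 2 are stripped first. As T is
  -- even, m ≡ 1 mod 4 makes s even, then T' odd and s' even, leaving the coprime factors of x(x -
  -- 1) = m s''².
  · subst hℓ2
    have hm4 := h2 rfl
    obtain ⟨T', hT'⟩ : ∃ T', T = 2 * T' := by
      obtain ⟨c, hc⟩ := hdvd
      exact ⟨c - 1, by push_cast at hc; linarith⟩
    obtain ⟨j, hj⟩ : ∃ j : ℤ, (m : ℤ) = 4 * j + 1 := ⟨m / 4, by omega⟩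
    obtain ⟨s', hs'⟩ : ∃ s', s = 2 * s' := by
      rcases Int.even_or_odd' s with ⟨c, hc | hc⟩
      · exact ⟨c, hc⟩
      · exfalso
        rw [hj, hc, hT'] at h
        ring_nf at h
        omega
    have h1 : T' ^ 2 - 1 = m * s' ^ 2 := by
      rw [hT', hs'] at h
      linarith
    obtain ⟨x, hx⟩ : ∃ x, T' = 2 * x - 1 := by
      rcases Int.even_or_odd' T' with ⟨c, hc | hc⟩
      · exfalso
        rcases Int.even_or_odd' s' with ⟨e, he | he⟩ <;>
        · rw [hj, hc, he] at h1
          ring_nf at h1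
          omega
      · exact ⟨c + 1, by rw [hc]; ring⟩
    obtain ⟨s'', hs''⟩ : ∃ s'', s' = 2 * s'' := by
      rcases Int.even_or_odd' s' with ⟨c, hc | hc⟩
      · exact ⟨c, hc⟩
      · exfalso
        rw [hj, hc, hx] at h1
        ring_nf at h1
        omega
    have h3 : x * (x - 1) = m * s'' ^ 2 := by
      rw [hx, hs''] at h1
      linarith
    have hx0 : x ≠ 0 := by
      rintro rfl
      omega
    have h4 : T + 2 = 2 * 2 * x := by rw [hT', hx]; ring
    have h22 : padicValInt 2 2 = 1 := by
      rw [padicValInt]; exact padicValNat_self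
    rw [h4, padicValInt.mul (by norm_num) hx0, padicValInt.mul (by norm_num) (by norm_num), h22]
    refine Even.add (by decide) ?_
    by_cases hx2 : (2 : ℤ) ∣ x
    · exact even_padicValInt_of_mul_eq hℓ h3 hx0 hm' (by push_cast; omega)
    · rw [padicValInt.eq_zero_of_not_dvd (by exact_mod_cast hx2)]
      exact Even.zero
  · refine even_padicValInt_of_mul_eq hℓ (y := T - 2) (by linarith) hT hm' ?_
    intro hd
    have h4 : (ℓ : ℤ) ∣ 4 := by
      have := dvd_sub hdvd hd
      ring_nf at this
      exact this
    have h4' : ℓ ∣ 2 ^ 2 := by exact_mod_cast h4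
    exact hℓ2 ((Nat.prime_dvd_prime_iff_eq hℓ Nat.prime_two).mp (hℓ.dvd_of_dvd_pow h4'))

/-- The square of the denominator of s would divide the squarefree m. This gives the integrality of
the coefficient of √m in the difference of a unit and its conjugate. -/
theorem exists_int_eq_of_squarefree_mul_sq {m : ℕ} (hm : Squarefree m) {s : ℚ} {N : ℤ}
    (h : (N : ℚ) = m * s ^ 2) : ∃ z : ℤ, s = z := by
  have hden : (s.den : ℚ) ≠ 0 := by exact_mod_cast s.den_nz
  have h1 : N * (s.den : ℤ) ^ 2 = m * s.num ^ 2 := by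
    have : s * s.den = s.num := Rat.mul_den_eq_num s
    have h2 : (N : ℚ) * (s.den : ℚ) ^ 2 = m * (s.num : ℚ) ^ 2 := by
      rw [← this, h]; ring
    exact_mod_cast h2
  have hcop : IsCoprime ((s.den : ℤ) ^ 2) (s.num ^ 2) :=
    IsCoprime.pow (Nat.isCoprime_iff_coprime.mpr s.reduced.symm |>.of_isCoprime_of_dvd_right
      (by rw [Int.dvd_natAbs]) )
  have h3 : (s.den : ℤ) ^ 2 ∣ m := hcop.dvd_of_dvd_mul_right ⟨N, by rw [← h1]; ring⟩
  have h4 : s.den * s.den ∣ m := by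
    rw [← sq]; exact_mod_cast h3
  have h5 : s.den = 1 := Nat.isUnit_iff.mp (hm _ h4)
  exact ⟨s.num, (Rat.den_eq_one_iff s).mp h5 |>.symm⟩

theorem isSquare_natAbs_of_even_padicValInt {t : ℤ}
    (h : ∀ ℓ : ℕ, ℓ.Prime → Even (padicValInt ℓ t)) : ∃ r : ℕ, t.natAbs = r ^ 2 := by
  rcases eq_or_ne t 0 with rfl | ht
  · exact ⟨0, rfl⟩
  obtain ⟨A, B, hAB, hA⟩ := Nat.sq_mul_squarefree t.natAbs
  have hne : t.natAbs ≠ 0 := Int.natAbs_ne_zero.mpr ht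
  have hA0 : A ≠ 0 := by rintro rfl; simp at hAB; omega
  have hB0 : B ≠ 0 := by rintro rfl; simp at hAB; omega
  have hA1 : A = 1 := by
    by_contra hA1
    obtain ⟨ℓ, hℓ, hℓA⟩ := Nat.exists_prime_and_dvd hA1
    have : Fact ℓ.Prime := ⟨hℓ⟩
    have h1 := h ℓ hℓ
    rw [padicValInt, ← hAB, padicValNat.mul (pow_ne_zero _ hB0) hA0, padicValNat.pow] at h1
    have h2 : padicValNat ℓ A = 1 := by
      have h3 := hA.natFactorization_le_one ℓ
      rw [Nat.factorization_def _ hℓ] at h3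
      have := one_le_padicValNat_of_dvd hA0 hℓA
      omega
    rw [h2, Nat.even_iff] at h1
    omega
  exact ⟨B, by rw [← hAB, hA1, mul_one]⟩

/-! ### Totally complex fields `ℚ(i, √m, √n)` -/

/-- A presentation of a field as `ℚ(i, √m, √n)`, with generators `σ`, `τ` and `c` of its
group of automorphisms: `σ` changes the signs of `√m` and `√n`, `τ` the sign of `√n`, and `c` that
of `i`. -/
structure MultiquadraticFrame (K : Type*) [Field K] (m n : ℕ) where
  i : K
  a : K
  b : K
  σ : K →+* K
  τ : K →+* K
  c : K →+* K
  i_sq : i ^ 2 = -1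
  a_sq : a ^ 2 = m
  b_sq : b ^ 2 = n
  σ_i : σ i = i
  σ_a : σ a = -a
  σ_b : σ b = -b
  τ_i : τ i = i
  τ_a : τ a = a
  τ_b : τ b = -b
  c_i : c i = -i
  c_a : c a = a
  c_b : c b = b
  σ_σ : ∀ x, σ (σ x) = x
  τ_τ : ∀ x, τ (τ x) = x
  c_c : ∀ x, c (c x) = x
  σ_τ : ∀ x, σ (τ x) = τ (σ x)
  σ_c : ∀ x, σ (c x) = c (σ x)
  τ_c : ∀ x, τ (c x) = c (τ x)
  fixed : ∀ x, σ x = x → τ x = x → c x = x → ∃ r : ℚ, x = r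

namespace MultiquadraticFrame

theorem eq_or_eq_neg_of_sq_fixed {K : Type*} [Field K] (g : K →+* K) {x : K}
    (h : g (x ^ 2) = x ^ 2) : g x = x ∨ g x = -x := by
  rw [map_pow] at h
  exact sq_eq_sq_iff_eq_or_eq_neg.mp h

/-- Explicit Hilbert 90: an element of norm 1 has the square class of its trace plus 2. -/
theorem one_add_sq {K : Type*} [Field K] {e e' : K} (h : e * e' = 1) :
    (1 + e) ^ 2 = e * (e + e' + 2) := by
  linear_combination (-1 : K) * h

variable {K : Type*} [Field K] [CharZero K] {m n : ℕ}

theorem i_ne_zero (f : MultiquadraticFrame K m n) : f.i ≠ 0 := by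
  intro h
  have := f.i_sq
  rw [h] at this
  norm_num at this

theorem a_ne_zero (f : MultiquadraticFrame K m n) (hm : m ≠ 0) : f.a ≠ 0 := by
  intro h
  have := f.a_sq
  rw [h] at this
  exact hm (by simpa using this.symm)

theorem b_ne_zero (f : MultiquadraticFrame K m n) (hn : n ≠ 0) : f.b ≠ 0 := by
  intro h
  have := f.b_sq
  rw [h] at this
  exact hn (by simpa using this.symm)

/-- A rational number which is a square in `ℚ(i, √m, √n)` is, up to rational squares, a product
of some of `-1`, `m` and `n`. -/
theorem exists_of_sq_eq_ratCast (f : MultiquadraticFrame K m n) (hm : m ≠ 0) (hn : n ≠ 0)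
    {x : K} {t : ℚ}
    (hx : x ^ 2 = t) :
    ∃ (ε α β : ℕ) (r : ℚ), t = (-1) ^ ε * (m : ℚ) ^ α * (n : ℚ) ^ β * r ^ 2 := by
  have key : ∀ ε α β : ℕ, f.σ x = (-1) ^ (α + β) * x → f.τ x = (-1) ^ β * x →
      f.c x = (-1) ^ ε * x →
      ∃ (ε α β : ℕ) (r : ℚ), t = (-1) ^ ε * (m : ℚ) ^ α * (n : ℚ) ^ β * r ^ 2 := by
    intro ε α β h1 h2 h3
    -- Kummer theory by hand: w is the monomial in i, √m, √n that picks up the same signs as x under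
    -- σ, τ and c, so x / w is fixed by all three and is rational.
    set w := f.i ^ ε * f.a ^ α * f.b ^ β with hw
    have hw0 : w ≠ 0 := mul_ne_zero (mul_ne_zero (pow_ne_zero _ f.i_ne_zero)
      (pow_ne_zero _ (f.a_ne_zero hm))) (pow_ne_zero _ (f.b_ne_zero hn))
    have hone : ∀ j : ℕ, ((-1 : K) ^ j) ≠ 0 := fun j ↦ pow_ne_zero _ (by norm_num)
    obtain ⟨r, hr⟩ := f.fixed (x / w)
      (by
        have : f.σ w = (-1) ^ (α + β) * w := by
          rw [hw]; simp only [map_mul, map_pow, f.σ_i, f.σ_a, f.σ_b, neg_pow f.a, neg_pow f.b]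
          ring
        rw [map_div₀, h1, this, mul_div_mul_left _ _ (hone _)])
      (by
        have : f.τ w = (-1) ^ β * w := by
          rw [hw]; simp only [map_mul, map_pow, f.τ_i, f.τ_a, f.τ_b, neg_pow f.b]
          ring
        rw [map_div₀, h2, this, mul_div_mul_left _ _ (hone _)])
      (by
        have : f.c w = (-1) ^ ε * w := by
          rw [hw]; simp only [map_mul, map_pow, f.c_i, f.c_a, f.c_b, neg_pow f.i]
          ring
        rw [map_div₀, h3, this, mul_div_mul_left _ _ (hone _)])
    refine ⟨ε, α, β, r, ?_⟩
    have hxw : x = r * w := by rw [← hr]; field_simp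
    have hww : w ^ 2 = (-1) ^ ε * (m : K) ^ α * (n : K) ^ β := by
      rw [hw, ← f.i_sq, ← f.a_sq, ← f.b_sq]; ring
    have : (t : K) = ((-1) ^ ε * (m : ℚ) ^ α * (n : ℚ) ^ β * r ^ 2 : ℚ) := by
      rw [← hx, hxw, mul_pow, hww]; push_cast; ring
    exact_mod_cast this
  have hfix : ∀ g : K →+* K, g x = x ∨ g x = -x := fun g ↦
    eq_or_eq_neg_of_sq_fixed g (by rw [hx, map_ratCast])
  rcases hfix f.σ with h1 | h1 <;> rcases hfix f.τ with h2 | h2 <;> rcases hfix f.c with h3 | h3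
  · exact key 0 0 0 (by simp [h1]) (by simp [h2]) (by simp [h3])
  · exact key 1 0 0 (by simp [h1]) (by simp [h2]) (by simp [h3])
  · exact key 0 1 1 (by simp [h1]) (by simp [h2]) (by simp [h3])
  · exact key 1 1 1 (by simp [h1]) (by simp [h2]) (by simp [h3])
  · exact key 0 1 0 (by simp [h1]) (by simp [h2]) (by simp [h3])
  · exact key 1 1 0 (by simp [h1]) (by simp [h2]) (by simp [h3])
  · exact key 0 0 1 (by simp [h1]) (by simp [h2]) (by simp [h3])
  · exact key 1 0 1 (by simp [h1]) (by simp [h2]) (by simp [h3])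

/-- The trace of an integral element of norm one in `ℚ(√m)` or `ℚ(√n)`, where `w` is `√m`
or `√n`. -/
theorem exists_trace (f : MultiquadraticFrame K m n) (g : K →+* K) {w : K} {N : ℕ}
    (hN : Squarefree N) (hw : w ^ 2 = N)
    (hσw : f.σ w = -w) (hgw : g w = w) (hgg : ∀ x, g (f.σ x) = f.σ (g x))
    (hfix : ∀ x, f.σ x = x → g x = x → f.c x = x → ∃ r : ℚ, x = r) (hcw : f.c w = w)
    {e : K} (he : IsIntegral ℤ e) (hge : g e = e) (hce : f.c e = e) (hnorm : e * f.σ e = 1) :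
    ∃ T s : ℤ, T ^ 2 - 4 = N * s ^ 2 ∧ e + f.σ e = T := by
  have hw0 : w ≠ 0 := by
    rintro rfl
    have : (N : K) = 0 := by rw [← hw]; ring
    exact hN.ne_zero (by exact_mod_cast this)
  have hcσ : f.c (f.σ e) = f.σ e := by rw [← f.σ_c, hce]
  obtain ⟨r, hr⟩ := hfix (e + f.σ e) (by rw [map_add, f.σ_σ, add_comm])
    (by rw [map_add, hgg, hge]) (by rw [map_add, hce, hcσ])
  obtain ⟨s, hs⟩ := hfix ((e - f.σ e) / w)
    (by rw [map_div₀, map_sub, f.σ_σ, hσw]; field_simp; ring)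
    (by rw [map_div₀, map_sub, hgg, hge, hgw]) (by rw [map_div₀, map_sub, hce, hcσ, hcw])
  have hint : IsIntegral ℤ (r : K) := by
    rw [← hr]
    exact he.add (he.map f.σ.toIntAlgHom)
  obtain ⟨T, hT⟩ : ∃ T : ℤ, (T : ℚ) = r := by
    have : IsIntegral ℤ r := (isIntegral_algebraMap_iff (algebraMap ℚ K).injective).mp
      (by simpa using hint)
    obtain ⟨T, hT⟩ := IsIntegrallyClosed.isIntegral_iff.mp this
    exact ⟨T, by simpa using hT⟩
  have h1 : ((T ^ 2 - 4 : ℤ) : ℚ) = N * s ^ 2 := by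
    have h2 : (e - f.σ e) ^ 2 = (s : K) ^ 2 * N := by
      rw [← hs, ← hw]; field_simp
    have h3 : (e + f.σ e) ^ 2 - 4 = (s : K) ^ 2 * N := by
      rw [← h2]; linear_combination (4 : K) * hnorm
    have h4 : (((T ^ 2 - 4 : ℤ) : ℚ) : K) = ((N * s ^ 2 : ℚ) : K) := by
      push_cast
      have : (T : K) = (r : K) := by rw [← hT]; simp
      rw [this, ← hr, h3]; ring
    exact_mod_cast h4
  obtain ⟨z, hz⟩ := exists_int_eq_of_squarefree_mul_sq hN h1
  refine ⟨T, z, ?_, ?_⟩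
  · rw [hz] at h1
    exact_mod_cast h1
  · rw [hr, ← hT]; simp

/-- The square class of an integral element of norm one in `ℚ(√m)` or `ℚ(√n)`: it is represented by
an integer with even valuations at the unramified primes. -/
theorem exists_int_mul_eq_sq (f : MultiquadraticFrame K m n) (g : K →+* K) {w : K} {N : ℕ}
    (hN : Squarefree N) (hw : w ^ 2 = N)
    (hσw : f.σ w = -w) (hgw : g w = w) (hgg : ∀ x, g (f.σ x) = f.σ (g x))
    (hfix : ∀ x, f.σ x = x → g x = x → f.c x = x → ∃ r : ℚ, x = r) (hcw : f.c w = w)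
    {e : K} (he : IsIntegral ℤ e) (hge : g e = e) (hce : f.c e = e) (hnorm : e * f.σ e = 1) :
    ∃ (t : ℤ) (s : K), t ≠ 0 ∧ s ≠ 0 ∧ g s = s ∧ f.c s = s ∧ (e * t = s ^ 2 ∨ e * t = -s ^ 2) ∧
      ∀ ℓ : ℕ, ℓ.Prime → ¬ ℓ ∣ N → (ℓ = 2 → N % 4 = 1) → Even (padicValInt ℓ t) := by
  -- Here T + 2 = 0 and the formula for the square class degenerates, but -1 is minus a square.
  -- Otherwise t = T + 2 and s = 1 + e.
  by_cases he1 : e = -1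
  · exact ⟨1, 1, one_ne_zero, one_ne_zero, map_one g, map_one f.c, Or.inr (by simp [he1]),
      fun ℓ _ _ _ ↦ by simp⟩
  · obtain ⟨T, s, hTs, hT⟩ := f.exists_trace g hN hw hσw hgw hgg hfix hcw he hge hce hnorm
    have hsq := one_add_sq hnorm
    rw [hT] at hsq
    have h1e : 1 + e ≠ 0 := fun h ↦ he1 (by linear_combination h)
    have hT0 : T + 2 ≠ 0 := by
      intro h
      have : ((T + 2 : ℤ) : K) = 0 := by rw [h]; simp
      push_cast at this
      rw [this, mul_zero] at hsq
      exact h1e (pow_eq_zero_iff two_ne_zero |>.mp hsq)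
    refine ⟨T + 2, 1 + e, hT0, h1e, by rw [map_add, map_one, hge], by rw [map_add, map_one, hce],
      Or.inl (by push_cast; exact hsq.symm), fun ℓ hℓ hℓN h2 ↦ ?_⟩
    exact even_padicValInt_trace_add_two hℓ hTs hT0 hℓN h2

theorem padicValRat_eq_one_of_dvd_squarefree_mul {ℓ : ℕ} (hℓ : ℓ.Prime) {m n : ℕ}
    (hsf : Squarefree (m * n)) (hd : ℓ ∣ m) :
    padicValRat ℓ (m : ℚ) = 1 ∧ padicValRat ℓ (n : ℚ) = 0 := by
  have : Fact ℓ.Prime := ⟨hℓ⟩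
  have hm0 : m ≠ 0 := fun h ↦ hsf.ne_zero (by simp [h])
  constructor
  · have h3 := (hsf.of_mul_left).natFactorization_le_one ℓ
    rw [Nat.factorization_def _ hℓ] at h3
    have := one_le_padicValNat_of_dvd hm0 hd
    rw [padicValRat.of_nat]
    exact_mod_cast le_antisymm h3 this
  · have : ¬ ℓ ∣ n := by
      intro h
      have h1 := hsf ℓ (mul_dvd_mul hd h)
      exact hℓ.one_lt.ne' (Nat.isUnit_iff.mp h1)
    rw [padicValRat.of_nat, padicValNat.eq_zero_of_not_dvd this]
    rfl

theorem στ_fixed {K : Type*} [Field K] (f : MultiquadraticFrame K m n) (x : K) (h1 : f.σ x = x)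
    (h2 : (f.σ.comp f.τ) x = x) (h3 : f.c x = x) : ∃ r : ℚ, x = r := by
  refine f.fixed x h1 ?_ h3
  rw [RingHom.comp_apply, f.σ_τ, h1] at h2
  exact h2

/-- A unit of norm one in `ℚ(√m)` and one in `ℚ(√n)` which agree up to squares of
`ℚ(i, √m, √n)` are squares up to sign. -/
theorem eq_sq_or_eq_neg_sq_of_mul_eq_sq (f : MultiquadraticFrame K m n)
    (hsf : Squarefree (m * n)) (hm : m % 4 = 1) {e e' x : K} (hx0 : x ≠ 0)
    (he : IsIntegral ℤ e) (hτe : f.τ e = e) (hce : f.c e = e) (hne : e * f.σ e = 1)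
    (he' : IsIntegral ℤ e') (hτe' : f.σ (f.τ e') = e') (hce' : f.c e' = e')
    (hne' : e' * f.σ e' = 1) (hx : e * e' = x ^ 2) :
    ∃ r : K, f.τ r = r ∧ f.c r = r ∧ r ≠ 0 ∧ (e = r ^ 2 ∨ e = -r ^ 2) := by
  have hm0 : m ≠ 0 := fun h ↦ hsf.ne_zero (by simp [h])
  have hn0 : n ≠ 0 := fun h ↦ hsf.ne_zero (by simp [h])
  obtain ⟨t, s, ht0, hs0, hτs, hcs, hts, hte⟩ := f.exists_int_mul_eq_sq f.τ hsf.of_mul_left f.a_sq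
    f.σ_a f.τ_a (fun x ↦ (f.σ_τ x).symm) f.fixed f.c_a he hτe hce hne
  obtain ⟨t', s', ht0', hs0', hτs', hcs', hts', hte'⟩ :=
    f.exists_int_mul_eq_sq (f.σ.comp f.τ) hsf.of_mul_right
    f.b_sq f.σ_b (by simp [f.τ_b, f.σ_b]) (fun x ↦ by simp [f.σ_τ]) f.στ_fixed f.c_b he' hτe' hce'
    hne'
  -- Since e and e' agree up to squares of K with ±t and ±t', the integer t t' is a square in K; i
  -- absorbs the sign.
  obtain ⟨y, hy⟩ : ∃ y : K, y ^ 2 = ((t * t' : ℚ) : K) := by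
    have h1 : (e * t) * (e' * t') = (s * s') ^ 2 ∨ (e * t) * (e' * t') = -(s * s') ^ 2 := by
      rcases hts with h | h <;> rcases hts' with h' | h' <;> rw [h, h']
      · left; ring
      · right; ring
      · right; ring
      · left; ring
    have h2 : (e * t) * (e' * t') = x ^ 2 * (t * t') := by rw [← hx]; ring
    rw [h2] at h1
    rcases h1 with h | h
    · refine ⟨s * s' / x, ?_⟩
      rw [div_pow, ← h]; push_cast; field_simp
    · refine ⟨f.i * (s * s') / x, ?_⟩
      have : (f.i * (s * s')) ^ 2 = x ^ 2 * (t * t') := by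
        rw [h, mul_pow, f.i_sq]; ring
      rw [div_pow, this]; push_cast; field_simp
  obtain ⟨ε, α, β, r, hr⟩ := f.exists_of_sq_eq_ratCast hm0 hn0 hy
  have hr0 : r ≠ 0 := by
    rintro rfl
    simp [ht0, ht0'] at hr
  -- Compare valuations in t t' = ± m^α n^β r². At ℓ ∣ m the prime does not divide n, so t' has even
  -- valuation and that of t has the parity of α. At ℓ ∤ m, including ℓ = 2 because m ≡ 1 mod 4, the
  -- valuation of t is even already.
  have hsq : ∀ ℓ : ℕ, ℓ.Prime → Even (padicValInt ℓ (t * (m : ℤ) ^ α)) := by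
    intro ℓ hℓ
    have : Fact ℓ.Prime := ⟨hℓ⟩
    have hmz : (m : ℤ) ≠ 0 := by exact_mod_cast hm0
    have hmq : (m : ℚ) ≠ 0 := by exact_mod_cast hm0
    have hnq : (n : ℚ) ≠ 0 := by exact_mod_cast hn0
    have key : (padicValInt ℓ (t * (m : ℤ) ^ α) : ℤ) =
        padicValInt ℓ t + α * padicValRat ℓ (m : ℚ) := by
      rw [padicValInt.mul ht0 (pow_ne_zero _ hmz), Nat.cast_add, ← padicValRat.of_int (z := m ^ α)]
      push_cast
      rw [padicValRat.pow]
    by_cases hd : ℓ ∣ m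
    · obtain ⟨h1, h2⟩ := padicValRat_eq_one_of_dvd_squarefree_mul hℓ hsf hd
      have h3 : ¬ ℓ ∣ n := by
        intro h
        exact hℓ.one_lt.ne' (Nat.isUnit_iff.mp (hsf ℓ (mul_dvd_mul hd h)))
      have h4 := hte' ℓ hℓ h3 (by rintro rfl; omega)
      have h5 := congrArg (padicValRat ℓ) hr
      have hone : padicValRat ℓ ((-1 : ℚ) ^ ε) = 0 := by
        rcases neg_one_pow_eq_or ℚ ε with h | h <;> simp [h]
      have htq : (t : ℚ) ≠ 0 := by exact_mod_cast ht0
      have htq' : (t' : ℚ) ≠ 0 := by exact_mod_cast ht0'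
      have hone0 : (-1 : ℚ) ^ ε ≠ 0 := pow_ne_zero _ (by norm_num)
      rw [padicValRat.mul htq htq', padicValRat.of_int, padicValRat.of_int,
        padicValRat.mul (mul_ne_zero (mul_ne_zero hone0 (pow_ne_zero _ hmq)) (pow_ne_zero _ hnq))
          (pow_ne_zero _ hr0), padicValRat.mul (mul_ne_zero hone0 (pow_ne_zero _ hmq))
          (pow_ne_zero _ hnq), padicValRat.mul hone0 (pow_ne_zero _ hmq), hone, padicValRat.pow,
        padicValRat.pow, padicValRat.pow, h1, h2] at h5
      rw [h1] at key
      rw [Nat.even_iff] at h4 ⊢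
      push_cast at h5
      omega
    · have h1 : padicValRat ℓ (m : ℚ) = 0 := by
        rw [padicValRat.of_nat, padicValNat.eq_zero_of_not_dvd hd]
        rfl
      have h2 := hte ℓ hℓ hd (fun _ ↦ hm)
      rw [h1, mul_zero, add_zero] at key
      rwa [Nat.cast_injective key]
  obtain ⟨R, hR⟩ := isSquare_natAbs_of_even_padicValInt hsq
  have hRt : ((t * (m : ℤ) ^ α : ℤ) : K) = (R : K) ^ 2 ∨
      ((t * (m : ℤ) ^ α : ℤ) : K) = -(R : K) ^ 2 := by
    rcases Int.natAbs_eq (t * (m : ℤ) ^ α) with h | h <;> rw [h, hR]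
    · left; push_cast; ring
    · right; push_cast; ring
  have hR0 : (R : K) ≠ 0 := by
    have : t * (m : ℤ) ^ α ≠ 0 := mul_ne_zero ht0 (pow_ne_zero _ (by exact_mod_cast hm0))
    have h0 : R ≠ 0 := by
      rintro rfl
      exact this (Int.natAbs_eq_zero.mp (by simpa using hR))
    exact_mod_cast h0
  refine ⟨s * f.a ^ α / R, by simp [hτs, f.τ_a], by simp [hcs, f.c_a],
    div_ne_zero (mul_ne_zero hs0 (pow_ne_zero _ (f.a_ne_zero hm0))) hR0, ?_⟩
  have h1 : (s * f.a ^ α) ^ 2 = s ^ 2 * (m : K) ^ α := by rw [← f.a_sq]; ring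
  push_cast at hRt
  rw [div_pow, h1]
  rcases hts with h | h <;> rcases hRt with h' | h'
  · left
    rw [← h, ← h', mul_assoc, mul_div_assoc, div_self (by rw [h']; exact pow_ne_zero _ hR0),
      mul_one]
  · right
    rw [← h, ← neg_eq_iff_eq_neg.mpr h', div_neg, neg_neg, mul_assoc, mul_div_assoc,
      div_self (by rw [h']; exact neg_ne_zero.mpr (pow_ne_zero _ hR0)), mul_one]
  · right
    rw [← neg_eq_iff_eq_neg.mpr h, ← h', neg_mul, neg_div, neg_neg, mul_assoc, mul_div_assoc,
      div_self (by rw [h']; exact pow_ne_zero _ hR0), mul_one]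
  · left
    rw [← neg_eq_iff_eq_neg.mpr h, ← neg_eq_iff_eq_neg.mpr h', neg_mul, neg_div_neg_eq, mul_assoc,
      mul_div_assoc, div_self (by rw [h']; exact neg_ne_zero.mpr (pow_ne_zero _ hR0)), mul_one]

/-- A unit on which `στ` acts as `-1` does not exist: `ℚ(i, √m, √n)` is ramified over
`ℚ(i, √n)`. -/
theorem σ_τ_ne_neg (f : MultiquadraticFrame K m n) (hsf : Squarefree (m * n)) (hm : m % 4 = 1)
    (hm1 : m ≠ 1) {g ν : K} (hg : IsIntegral ℤ g) (hν : ν ^ 2 = 1) (hgσ : g * f.σ g = ν)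
    (hcg : f.c g = g ∨ f.c g = -g) : f.σ (f.τ g) ≠ -g := by
  intro hgτ
  have hm0 : m ≠ 0 := fun h ↦ hsf.ne_zero (by simp [h])
  have hn0 : n ≠ 0 := fun h ↦ hsf.ne_zero (by simp [h])
  have hg0 : g ≠ 0 := by
    rintro rfl
    rw [zero_mul] at hgσ
    rw [← hgσ] at hν
    norm_num at hν
  wlog hc : f.c g = g generalizing g ν
  -- Multiplying g by i makes it fixed by c, changes the sign of ν, and does not affect the action
  -- of σ τ.
  · have hc' : f.c g = -g := hcg.resolve_left hc
    have hi : IsIntegral ℤ f.i := IsIntegral.of_pow (n := 2) two_pos (by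
      rw [f.i_sq]; exact isIntegral_one.neg)
    refine this (g := f.i * g) (ν := -ν) (hi.mul hg) (by rw [neg_sq, hν]) ?_ ?_ ?_
      (mul_ne_zero f.i_ne_zero hg0) ?_
    · rw [map_mul, f.σ_i, ← hgσ]; linear_combination (g * f.σ g) * f.i_sq
    · left; rw [map_mul, f.c_i, hc']; ring
    · rw [map_mul, map_mul, f.τ_i, f.σ_i, hgτ]; ring
    · rw [map_mul, f.c_i, hc']; ring
  -- The square g² lies in ℚ(√n) and has norm ν² = 1, so it is represented by an integer t with even
  -- valuation at primes dividing m.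
  obtain ⟨t, s, ht0, hs0, hτs, hcs, hts, hte⟩ :=
    f.exists_int_mul_eq_sq (f.σ.comp f.τ) hsf.of_mul_right
    f.b_sq f.σ_b (by simp [f.τ_b, f.σ_b]) (fun x ↦ by simp [f.σ_τ]) f.στ_fixed f.c_b
    (e := g ^ 2) (hg.pow 2) (by simp [hgτ]) (by simp [hc]) (by rw [map_pow, ← mul_pow, hgσ, hν])
  rw [RingHom.comp_apply] at hτs
  set y := s / g with hy
  have hy0 : y ≠ 0 := div_ne_zero hs0 hg0
  have hyt : y ^ 2 = ((t : ℚ) : K) ∨ y ^ 2 = ((-t : ℚ) : K) := by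
    rcases hts with h | h
    · left; rw [hy, div_pow, ← h]; push_cast; field_simp
    · right; rw [hy, div_pow, ← neg_eq_iff_eq_neg.mpr h]; push_cast; field_simp
  have hyτ : f.σ (f.τ y) = -y := by rw [hy, map_div₀, map_div₀, hτs, hgτ, div_neg]
  have hcy : f.c y = y := by rw [hy, map_div₀, hcs, hc]
  have hyσ : f.σ y = y ∨ f.σ y = -y := eq_or_eq_neg_of_sq_fixed f.σ (by
    rcases hyt with h | h <;> rw [h, map_ratCast])
  have ha0 := f.a_ne_zero hm0
  have hb0 := f.b_ne_zero hn0
  -- The signs of y under σ and τ make it a rational multiple of √m √n or of √m. Hence y² = ±t has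
  -- odd valuation at every prime dividing m.
  obtain ⟨r, β, hr⟩ : ∃ (r : ℚ) (β : ℕ), y ^ 2 = ((r ^ 2 * m * n ^ β : ℚ) : K) := by
    rcases hyσ with h | h
    · have hτ : f.τ y = -y := by rwa [f.σ_τ, h] at hyτ
      obtain ⟨r, hr⟩ := f.fixed (y / (f.a * f.b))
        (by rw [map_div₀, map_mul, f.σ_a, f.σ_b, h, neg_mul_neg])
        (by rw [map_div₀, map_mul, f.τ_a, f.τ_b, hτ, mul_neg, neg_div_neg_eq])
        (by rw [map_div₀, map_mul, f.c_a, f.c_b, hcy])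
      refine ⟨r, 1, ?_⟩
      push_cast
      rw [← hr, ← f.a_sq, ← f.b_sq]; field_simp
    · have hτ : f.τ y = y := by
        rw [f.σ_τ, h, map_neg] at hyτ
        exact neg_injective hyτ
      obtain ⟨r, hr⟩ := f.fixed (y / f.a)
        (by rw [map_div₀, f.σ_a, h, neg_div_neg_eq])
        (by rw [map_div₀, f.τ_a, hτ])
        (by rw [map_div₀, f.c_a, hcy])
      refine ⟨r, 0, ?_⟩
      push_cast
      rw [← hr, ← f.a_sq]; field_simp
  obtain ⟨ℓ, hℓ, hd⟩ := Nat.exists_prime_and_dvd hm1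
  have : Fact ℓ.Prime := ⟨hℓ⟩
  obtain ⟨h1, h2⟩ := padicValRat_eq_one_of_dvd_squarefree_mul hℓ hsf hd
  have h3 : ¬ ℓ ∣ n := by
    intro h
    exact hℓ.one_lt.ne' (Nat.isUnit_iff.mp (hsf ℓ (mul_dvd_mul hd h)))
  have h4 := hte ℓ hℓ h3 (by rintro rfl; omega)
  have hmq : (m : ℚ) ≠ 0 := by exact_mod_cast hm0
  have hnq : (n : ℚ) ≠ 0 := by exact_mod_cast hn0
  have hr0 : r ≠ 0 := by
    rintro rfl
    simp [hy0] at hr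
  have h5 : (padicValInt ℓ t : ℤ) = padicValRat ℓ (r ^ 2 * m * n ^ β : ℚ) := by
    rw [← padicValRat.of_int]
    rcases hyt with h | h
    · rw [Rat.cast_injective (h.symm.trans hr)]
    · rw [← Rat.cast_injective (h.symm.trans hr), padicValRat.neg]
  rw [padicValRat.mul (mul_ne_zero (pow_ne_zero _ hr0) hmq) (pow_ne_zero _ hnq),
    padicValRat.mul (pow_ne_zero _ hr0) hmq, padicValRat.pow, padicValRat.pow, h1, h2] at h5
  rw [Nat.even_iff] at h4
  push_cast at h5
  omega

theorem eq_of_pow_four_eq_one {K : Type*} [Field K] (f : MultiquadraticFrame K m n)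
    {ρ : K} (h : ρ ^ 4 = 1) :
    ρ ^ 2 = 1 ∨ ρ = f.i ∨ ρ = -f.i := by
  have : (ρ ^ 2 - 1) * ((ρ - f.i) * (ρ + f.i)) = 0 := by
    linear_combination h - (ρ ^ 2 - 1) * f.i_sq
  rcases mul_eq_zero.mp this with h | h
  · exact Or.inl (sub_eq_zero.mp h)
  · rcases mul_eq_zero.mp h with h | h
    · exact Or.inr (Or.inl (sub_eq_zero.mp h))
    · exact Or.inr (Or.inr (eq_neg_of_add_eq_zero_left h))

/-- Complex conjugation multiplies a unit of relative norm `i` by a primitive fourth root of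
unity, provided that it multiplies it by some fourth root of unity. -/
theorem c_eq_of_norm_eq_i (f : MultiquadraticFrame K m n) (g : K →+* K)
    (hgc : ∀ x, g (f.c x) = f.c (g x)) {u ρ : K} (hρ : ρ ^ 4 = 1) (hu : f.c u = ρ * u)
    (h : u * g u = f.i) : ρ = f.i ∨ ρ = -f.i := by
  rcases f.eq_of_pow_four_eq_one hρ with h1 | h1
  · exfalso
    have h2 := congrArg f.c h
    rw [map_mul, ← hgc, hu, map_mul, f.c_i] at h2
    have h3 : g ρ = ρ := by
      rcases sq_eq_one_iff.mp h1 with h | h <;> simp [h]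
    have h4 : f.i = -f.i := by
      rw [h3] at h2
      linear_combination h2 - ρ ^ 2 * h + (-f.i) * h1
    exact f.i_ne_zero (self_eq_neg.mp h4)
  · exact h1

/-- With v = uσ(u) = u'σ(u'), both u'² / v and u² / v are units of norm 1, one in ℚ(√m) and the
other in ℚ(√n), with product a square in K. The first is therefore ± a square r² of ℚ(√m), so θ =
u'/r is a square root of ±v. If θ lies in k, its norm is ±i, against `hk`; otherwise u/θ is a unit
negated by σ τ, against `σ_τ_ne_neg`. -/
theorem no_unit_pair (f : MultiquadraticFrame K m n) (hsf : Squarefree (m * n)) (hm : m % 4 = 1)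
    (hm1 : m ≠ 1) {u u' ρ ρ' : K} (hu : IsIntegral ℤ u) (hui : IsIntegral ℤ u⁻¹)
    (hu' : IsIntegral ℤ u') (hρ : ρ ^ 4 = 1)
    (hcu : f.c u = ρ * u) (hρ' : ρ' ^ 4 = 1) (hcu' : f.c u' = ρ' * u')
    (h1 : u * f.τ u = f.i) (h2 : u' * f.σ (f.τ u') = f.i) (h3 : u * f.σ u = u' * f.σ u')
    (hk : ∀ x, IsIntegral ℤ x → IsIntegral ℤ x⁻¹ → f.σ x = x →
      x * f.τ x ≠ f.i ∧ x * f.τ x ≠ -f.i) : False := by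
  have hi0 := f.i_ne_zero
  have hisq := f.i_sq
  have hu0 : u ≠ 0 := by
    rintro rfl
    rw [zero_mul] at h1
    exact hi0 h1.symm
  have hu0' : u' ≠ 0 := by
    rintro rfl
    rw [zero_mul] at h2
    exact hi0 h2.symm
  have hiint : IsIntegral ℤ f.i := IsIntegral.of_pow (n := 2) two_pos (by
      rw [f.i_sq]; exact isIntegral_one.neg)
  have hρi := f.c_eq_of_norm_eq_i f.τ f.τ_c hρ hcu h1
  have hρi' := f.c_eq_of_norm_eq_i (f.σ.comp f.τ)
    (fun x ↦ by simp [f.τ_c, f.σ_c]) hρ' hcu' h2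
  have hprop : ∀ ρ : K, ρ = f.i ∨ ρ = -f.i → f.σ ρ = ρ ∧ f.τ ρ = ρ ∧ ρ ^ 2 = -1 := by
    rintro ρ (rfl | rfl)
    · exact ⟨f.σ_i, f.τ_i, f.i_sq⟩
    · exact ⟨by rw [map_neg, f.σ_i], by rw [map_neg, f.τ_i], by rw [neg_sq, f.i_sq]⟩
  obtain ⟨hσρ, hτρ, hρ2⟩ := hprop ρ hρi
  obtain ⟨hσρ', hτρ', hρ2'⟩ := hprop ρ' hρi'
  have h1σ : f.σ u * f.σ (f.τ u) = f.i := by rw [← map_mul, h1, f.σ_i]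
  have h2τ : f.τ u' * f.σ u' = f.i := by
    have := congrArg f.τ h2
    rwa [map_mul, ← f.σ_τ, f.τ_τ, f.τ_i] at this
  set v := u * f.σ u with hv
  have hσu0 : f.σ u ≠ 0 := (map_ne_zero f.σ).mpr hu0
  have hv0 : v ≠ 0 := mul_ne_zero hu0 hσu0
  have hσv : f.σ v = v := by rw [hv, map_mul, f.σ_σ, mul_comm]
  have hvint : IsIntegral ℤ v := hu.mul (hu.map f.σ.toIntAlgHom)
  have hvint' : IsIntegral ℤ v⁻¹ := by
    rw [hv, mul_inv, ← map_inv₀]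
    exact hui.mul (hui.map f.σ.toIntAlgHom)
  -- The factor -i makes e fixed by c: c multiplies u' and its conjugate by ρ' each, with ρ'² = -1,
  -- and negates i. The same works for e' with ρ.
  set e := -f.i * (u' * f.τ u') with he
  set e' := -f.i * (u * f.σ (f.τ u)) with he'
  have hev : e * v = u' ^ 2 := by
    rw [he, h3]; linear_combination (-f.i * u' ^ 2) * h2τ - u' ^ 2 * hisq
  have hev' : e' * v = u ^ 2 := by
    rw [he', hv]; linear_combination (-f.i * u ^ 2) * h1σ - u ^ 2 * hisq
  have hne : e * f.σ e = 1 := by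
    rw [he]
    simp only [map_mul, map_neg, f.σ_i]
    linear_combination (f.i ^ 2 * f.τ u' * f.σ u') * h2 + (f.i ^ 3) * h2τ + (f.i ^ 2 - 1) * hisq
  have hne' : e' * f.σ e' = 1 := by
    rw [he']
    simp only [map_mul, map_neg, f.σ_i, f.σ_σ]
    linear_combination (f.i ^ 2 * f.σ u * f.σ (f.τ u)) * h1 + (f.i ^ 3) * h1σ +
      (f.i ^ 2 - 1) * hisq
  obtain ⟨r, hτr, hcr, hr0, her⟩ := f.eq_sq_or_eq_neg_sq_of_mul_eq_sq hsf hm (e := e) (e' := e')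
    (x := u * u' / v) (div_ne_zero (mul_ne_zero hu0 hu0') hv0)
    (hiint.neg.mul (hu'.mul (hu'.map f.τ.toIntAlgHom)))
    (by rw [he]; simp only [map_mul, map_neg, f.τ_i, f.τ_τ]; ring)
    (by
      rw [he]
      simp only [map_mul, map_neg, f.c_i, ← f.τ_c, hcu', hτρ']
      linear_combination (f.i * u' * f.τ u') * hρ2')
    hne
    (hiint.neg.mul (hu.mul ((hu.map f.τ.toIntAlgHom).map f.σ.toIntAlgHom)))
    (by rw [he']; simp only [map_mul, map_neg, f.τ_i, f.σ_i, ← f.σ_τ, f.σ_σ, f.τ_τ]; ring)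
    (by
      rw [he']
      simp only [map_mul, map_neg, f.c_i, ← f.τ_c, ← f.σ_c, hcu, hτρ, hσρ]
      linear_combination (f.i * u * f.σ (f.τ u)) * hρ2)
    hne'
    (by rw [div_pow, mul_pow, ← hev, ← hev']; field_simp)
  set ν := r * f.σ r with hνdef
  have hν : ν ^ 2 = 1 := by
    rw [← hne, hνdef]
    rcases her with h | h <;> rw [h] <;> simp only [map_pow, map_neg] <;> ring
  set θ := u' / r with hθ
  have hθ0 : θ ≠ 0 := div_ne_zero hu0' hr0
  have hθv : θ ^ 2 = v ∨ θ ^ 2 = -v := by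
    rw [hθ, div_pow, ← hev]
    rcases her with h | h <;> rw [h]
    · left; field_simp
    · right; field_simp
  have hθint : IsIntegral ℤ θ := IsIntegral.of_pow (n := 2) two_pos (by
    rcases hθv with h | h <;> rw [h]
    exacts [hvint, hvint.neg])
  have hθint' : IsIntegral ℤ θ⁻¹ := IsIntegral.of_pow (n := 2) two_pos (by
    rw [inv_pow]
    rcases hθv with h | h <;> rw [h]
    · exact hvint'
    · rw [inv_neg]; exact hvint'.neg)
  rcases eq_or_eq_neg_of_sq_fixed f.σ (x := θ)
    (by rcases hθv with h | h <;> rw [h] <;> simp [hσv]) with hσθ | hσθ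
  · obtain ⟨hk1, hk2⟩ := hk θ hθint hθint' hσθ
    -- The norm of v over ℚ(i) is i · i, so θ, whose square is ±v, has norm ±i.
    have hvv : v * f.τ v = -1 := by
      rw [hv, map_mul, ← f.σ_τ]
      linear_combination (f.σ u * f.σ (f.τ u)) * h1 + f.i * h1σ + hisq
    have : (θ * f.τ θ) ^ 2 = f.i ^ 2 := by
      rw [hisq, ← hvv, mul_pow, ← map_pow]
      rcases hθv with h | h <;> rw [h]
      rw [map_neg]; ring
    rcases sq_eq_sq_iff_eq_or_eq_neg.mp this with h | h
    exacts [hk1 h, hk2 h]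
  · have hν0 : ν ≠ 0 := by
      intro h
      rw [h] at hν
      norm_num at hν
    have hvθ : v = -(θ ^ 2 * ν) := by
      have : u' = θ * r := by rw [hθ]; field_simp
      rw [h3, this, map_mul, hσθ, hνdef]; ring
    have hστθ : f.σ (f.τ θ) = f.i / (ν * θ) := by
      rw [eq_div_iff (mul_ne_zero hν0 hθ0), hνdef, ← h2]
      have : u' = θ * r := by rw [hθ]; field_simp
      rw [this, map_mul, map_mul, hτr]; ring
    have hστu : f.σ (f.τ u) = f.i * u / v := by
      rw [eq_div_iff hv0, hv]; linear_combination u * h1σ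
    refine f.σ_τ_ne_neg hsf hm hm1 (g := u / θ) (ν := ν) ?_ hν ?_ ?_ ?_
    · rw [div_eq_mul_inv]; exact hu.mul hθint'
    · rw [map_div₀, hσθ, div_mul_div_comm, ← hv, hvθ]; field_simp
    · have hcθ : f.c θ = ρ' * θ := by rw [hθ, map_div₀, hcu', hcr, mul_div_assoc]
      have hρ0 : ρ' ≠ 0 := by
        rintro rfl
        norm_num at hρ2'
      rw [map_div₀, hcu, hcθ]
      have : ρ = ρ' ∨ ρ = -ρ' := sq_eq_sq_iff_eq_or_eq_neg.mp (by rw [hρ2, hρ2'])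
      rcases this with h | h <;> rw [h]
      · left; field_simp
      · right; field_simp
    · rw [map_div₀, map_div₀, hστu, hστθ, hvθ]
      field_simp

end MultiquadraticFrame

/-! ### Ideals in extensions of number fields -/

theorem Ideal.isRadical_of_squarefree {R : Type*} [CommRing R] [IsDedekindDomain R] {I : Ideal R}
    (h : Squarefree I) : I.IsRadical := by
  rw [Ideal.isRadical_iff_pow_one_lt 2 one_lt_two]
  intro r hr
  have h1 : I ∣ Ideal.span {r} ^ 2 := by
    rw [Ideal.dvd_iff_le, Ideal.span_singleton_pow, Ideal.span_singleton_le_iff_mem]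
    exact hr
  have h2 := (h.dvd_pow_iff_dvd two_ne_zero).mp h1
  rwa [Ideal.dvd_iff_le, Ideal.span_singleton_le_iff_mem] at h2

/-- A maximal ideal generates a radical ideal in an extension in which it is unramified. -/
theorem Ideal.isRadical_map_of_isUnramifiedIn {A B : Type*} [CommRing A] [CommRing B]
    [IsDedekindDomain B] [Algebra A B] [Algebra.EssFiniteType A B] {p : Ideal A} [p.IsMaximal]
    (hp : p.map (algebraMap A B) ≠ ⊥) (hunr : Algebra.IsUnramifiedIn B p) :
    (p.map (algebraMap A B)).IsRadical := by
  refine Ideal.isRadical_of_squarefree ?_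
  classical
  rw [UniqueFactorizationMonoid.squarefree_iff_nodup_normalizedFactors hp,
    Multiset.nodup_iff_count_le_one]
  intro Q
  by_cases hQ : Q ∈ UniqueFactorizationMonoid.normalizedFactors (p.map (algebraMap A B))
  swap
  · rw [Multiset.count_eq_zero_of_notMem hQ]
    exact zero_le_one
  have hQprime := UniqueFactorizationMonoid.prime_of_normalized_factor Q hQ
  have hQp : Q.IsPrime := Ideal.isPrime_of_prime hQprime
  have hle : p.map (algebraMap A B) ≤ Q :=
    Ideal.dvd_iff_le.mp (UniqueFactorizationMonoid.dvd_of_mem_normalizedFactors hQ)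
  have hover : Q.LiesOver p := ⟨(Ideal.IsMaximal.eq_of_le ‹p.IsMaximal›
    (Ideal.comap_ne_top _ hQp.ne_top) (Ideal.map_le_iff_le_comap.mp hle))⟩
  have := hunr Q hQp hover
  rw [← Ideal.IsDedekindDomain.ramificationIdx_eq_normalizedFactors_count p Q hp,
    Ideal.ramificationIdx_eq_one_of_isUnramifiedAt]

section Galois

section

variable {k K : Type*} [Field k] [Field K] [Algebra k K]

theorem Ideal.smul_eq_map_mapRingEquiv (σ : Gal(K/k)) (I : Ideal (𝓞 K)) :
    σ • I = I.map (RingOfIntegers.mapRingEquiv σ.toRingEquiv) :=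
  rfl

theorem smul_map_algebraMap (σ : Gal(K/k)) (I : Ideal (𝓞 k)) :
    σ • I.map (algebraMap (𝓞 k) (𝓞 K)) = I.map (algebraMap (𝓞 k) (𝓞 K)) := by
  rw [Ideal.pointwise_smul_def, Ideal.map_map]
  congr 1
  ext x
  exact σ.commutes _

end

variable {k K : Type*} [Field k] [NumberField k] [Field K] [NumberField K] [Algebra k K]

/-- A Galois invariant ideal of an unramified extension is extended from the base field. -/
theorem exists_eq_map_of_smul_eq [IsGalois k K]
    (hunr : ∀ 𝔭 : Ideal (𝓞 k), 𝔭.IsPrime → Algebra.IsUnramifiedIn (𝓞 K) 𝔭) (A : Ideal (𝓞 K))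
    (hA : A ≠ ⊥) (hinv : ∀ σ : Gal(K/k), σ • A = A) :
    ∃ I : Ideal (𝓞 k), A = I.map (algebraMap (𝓞 k) (𝓞 K)) := by
  induction A using IsWellFounded.induction (α := Ideal (𝓞 K)) (· > ·) with
  | _ A ih =>
  by_cases hAtop : A = ⊤
  · exact ⟨⊤, by rw [hAtop, Ideal.map_top]⟩
  obtain ⟨P, hP, hAP⟩ := Ideal.exists_le_maximal A hAtop
  have hPbot : P ≠ ⊥ := ne_bot_of_le_ne_bot hA hAP
  set p := P.under (𝓞 k) with hp
  have hpmax : p.IsMaximal := Ideal.isMaximal_comap_of_isIntegral_of_isMaximal P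
  have hpbot : p ≠ ⊥ := mt Ideal.eq_bot_of_comap_eq_bot hPbot
  have hpmap : p.map (algebraMap (𝓞 k) (𝓞 K)) ≠ ⊥ := Ideal.map_ne_bot_of_ne_bot hpbot
  have hover : P.LiesOver p := ⟨rfl⟩
  -- The primes above p are conjugate, so the invariant ideal A lies in all of them. Their
  -- intersection is the extension of p, which is radical because p is unramified; this factor can
  -- be split off and the Noetherian induction continues with B.
  have hle : A ≤ p.map (algebraMap (𝓞 k) (𝓞 K)) := by
    rw [← (Ideal.isRadical_map_of_isUnramifiedIn hpmap (hunr p hpmax.isPrime)).radical,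
      Ideal.radical_eq_sInf]
    refine le_sInf ?_
    rintro Q ⟨hQ, hQp⟩
    have hQover : Q.LiesOver p := ⟨(Ideal.IsMaximal.eq_of_le hpmax
      (Ideal.comap_ne_top _ hQp.ne_top) (Ideal.map_le_iff_le_comap.mp hQ))⟩
    obtain ⟨σ, hσ⟩ := Ideal.exists_smul_eq_of_isGaloisGroup p P Q Gal(K/k)
    rw [← hσ, ← hinv σ]
    exact Ideal.map_mono hAP
  obtain ⟨B, hB⟩ := Ideal.dvd_iff_le.mpr hle
  have hBbot : B ≠ ⊥ := by
    rintro rfl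
    exact hA (by rw [hB, Ideal.mul_bot])
  have hlt : B > A := by
    refine lt_of_le_of_ne (Ideal.dvd_iff_le.mp ⟨_, hB.trans (mul_comm _ _)⟩) ?_
    intro hAB
    rw [← hAB] at hB
    have h1 : p.map (algebraMap (𝓞 k) (𝓞 K)) = 1 := by
      have := mul_right_cancel₀ (b := A) hA ((one_mul A).trans hB)
      exact this.symm
    have h2 : p.map (algebraMap (𝓞 k) (𝓞 K)) ≤ P := Ideal.map_le_iff_le_comap.mpr le_rfl
    rw [h1, Ideal.one_eq_top] at h2
    exact hP.ne_top (top_le_iff.mp h2)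
  obtain ⟨I, hI⟩ := ih B hlt hBbot (fun σ ↦ by
    have h1 := hinv σ
    rw [hB, Ideal.pointwise_smul_def, Ideal.map_mul, ← Ideal.pointwise_smul_def,
      ← Ideal.pointwise_smul_def, smul_map_algebraMap] at h1
    exact mul_left_cancel₀ hpmap h1)
  exact ⟨p * I, by rw [hB, hI, Ideal.map_mul]⟩

theorem mk0_mem_capitulationKernel_iff (I : (Ideal (𝓞 k))⁰) :
    ClassGroup.mk0 I ∈ capitulationKernel k K ↔
      ∃ γ : 𝓞 K, γ ≠ 0 ∧ (I : Ideal (𝓞 k)).map (algebraMap (𝓞 k) (𝓞 K)) = Ideal.span {γ} := by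
  rw [capitulationKernel, MonoidHom.mem_ker, ClassGroup.extendedHom_mk0,
    ClassGroup.mk0_eq_one_iff]
  constructor
  · rintro ⟨γ, hγ⟩
    refine ⟨γ, ?_, hγ⟩
    rintro rfl
    have : (I : Ideal (𝓞 k)).map (algebraMap (𝓞 k) (𝓞 K)) ≠ ⊥ :=
      Ideal.map_ne_bot_of_ne_bot (mem_nonZeroDivisors_iff_ne_zero.mp I.2)
    apply this
    simpa using hγ
  · rintro ⟨γ, -, hγ⟩
    exact ⟨γ, hγ⟩

/-- A class which capitulates in an extension of degree `n` is killed by `n`. -/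
theorem pow_finrank_eq_one_of_mem_capitulationKernel {c : ClassGroup (𝓞 k)}
    (hc : c ∈ capitulationKernel k K) : c ^ Module.finrank k K = 1 := by
  obtain ⟨I, rfl⟩ := ClassGroup.mk0_surjective c
  obtain ⟨γ, -, hγ⟩ := (mk0_mem_capitulationKernel_iff I).mp hc
  have h1 := congrArg (Ideal.relNorm (𝓞 k)) hγ
  rw [Ideal.relNorm_algebraMap, Ideal.relNorm_singleton] at h1
  have h2 : Module.finrank (𝓞 k) (𝓞 K) = Module.finrank k K :=
    (IsFractionRing.finrank_eq (𝓞 k) k (𝓞 K) K).symm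
  rw [h2] at h1
  rw [← map_pow, ClassGroup.mk0_eq_one_iff]
  exact ⟨_, h1⟩

theorem eq_one_or_eq_of_finrank_eq_two [IsGalois k K] (h2 : Module.finrank k K = 2) {τ : Gal(K/k)}
    (hτ : τ ≠ 1) (g : Gal(K/k)) : g = 1 ∨ g = τ := by
  have hcard : Nat.card Gal(K/k) = 2 := by rw [IsGalois.card_aut_eq_finrank, h2]
  by_contra! h
  have h3 : 2 < Nat.card Gal(K/k) := by
    rw [Nat.card_eq_fintype_card, Fintype.two_lt_card_iff]
    exact ⟨1, τ, g, hτ.symm, h.1.symm, h.2.symm⟩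
  omega

theorem norm_eq_mul_of_finrank_eq_two [IsGalois k K] (h2 : Module.finrank k K = 2) {τ : Gal(K/k)}
    (hτ : τ ≠ 1) (x : K) : algebraMap k K (Algebra.norm k x) = x * τ x := by
  classical
  rw [Algebra.norm_eq_prod_automorphisms]
  have : (Finset.univ : Finset Gal(K/k)) = {1, τ} := by
    ext g
    simpa using eq_one_or_eq_of_finrank_eq_two h2 hτ g
  rw [this, Finset.prod_pair hτ.symm, AlgEquiv.one_apply]

/-- In a quadratic extension, the norm of an ideal is its product with its conjugate. -/
theorem map_relNorm_eq_mul_smul [IsGalois k K] (h2 : Module.finrank k K = 2) {τ : Gal(K/k)}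
    (hτ : τ ≠ 1) (I : Ideal (𝓞 K)) :
    (Ideal.relNorm (𝓞 k) I).map (algebraMap (𝓞 k) (𝓞 K)) = I * τ • I := by
  rcases eq_or_ne I ⊥ with rfl | hI
  · rw [Ideal.relNorm_bot, Ideal.map_bot, Ideal.bot_mul]
  have hle : (Ideal.relNorm (𝓞 k) I).map (algebraMap (𝓞 k) (𝓞 K)) ≤ I * τ • I := by
    rw [Ideal.relNorm_apply, Ideal.map_span, Ideal.span_le]
    rintro _ ⟨_, ⟨x, hx, rfl⟩, rfl⟩
    have : algebraMap (𝓞 k) (𝓞 K) (Algebra.intNorm (𝓞 k) (𝓞 K) x) = x * τ • x := by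
      apply RingOfIntegers.coe_injective
      rw [← IsScalarTower.algebraMap_apply, IsScalarTower.algebraMap_apply (𝓞 k) k K,
        Algebra.algebraMap_intNorm (L := K), norm_eq_mul_of_finrank_eq_two h2 hτ]
      rfl
    rw [this]
    exact Ideal.mul_mem_mul hx (Ideal.smul_mem_pointwise_smul τ x I hx)
  -- Both sides of the inclusion have relative norm N(I)², so the cofactor C has norm 1 and is
  -- trivial.
  obtain ⟨C, hC⟩ := Ideal.dvd_iff_le.mpr hle
  have h1 := congrArg (Ideal.relNorm (𝓞 k)) hC
  have hfr : Module.finrank (𝓞 k) (𝓞 K) = 2 := by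
    rw [← IsFractionRing.finrank_eq (𝓞 k) k (𝓞 K) K, h2]
  rw [Ideal.relNorm_algebraMap, hfr, map_mul, map_mul, Ideal.relNorm_smul, ← sq] at h1
  have hN : Ideal.relNorm (𝓞 k) I ^ 2 ≠ 0 :=
    pow_ne_zero _ (mt Ideal.relNorm_eq_bot_iff.mp hI)
  have hC1 : Ideal.relNorm (𝓞 k) C = 1 := by
    have := mul_left_cancel₀ hN ((mul_one _).trans h1)
    exact this.symm
  have hCtop : C = ⊤ := by
    have h3 := Ideal.relNorm_le_comap (𝓞 k) C
    rw [hC1, Ideal.one_eq_top, top_le_iff] at h3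
    exact Ideal.comap_eq_top_iff.mp h3
  rw [hC, hCtop, Ideal.mul_top]

open Polynomial in
/-- A prime is unramified if it does not contain the derivative, at an integral generator, of some
polynomial with this root. -/
theorem isUnramifiedAt_of_aeval_derivative_notMem {A B : Type*} (k K : Type*) [CommRing A]
    [IsDedekindDomain A] [CharZero A] [Field k] [CharZero k] [Algebra A k]
    [IsFractionRing A k] [CommRing B]
    [IsDedekindDomain B] [Field K] [Algebra B K] [IsFractionRing B K] [Algebra k K]
    [FiniteDimensional k K] [Algebra A B] [Algebra A K] [IsScalarTower A k K]
    [IsScalarTower A B K] [IsIntegralClosure B A K] [Module.IsTorsionFree A B] [Module.Finite A B]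
    {x : B} (hx : Algebra.adjoin k {algebraMap B K x} = ⊤) {f : A[X]} (hfx : aeval x f = 0)
    (P : Ideal B) [P.IsPrime] (hP : aeval x (derivative f) ∉ P) :
    Algebra.IsUnramifiedAt A P := by
  let := FractionRing.liftAlgebra A (FractionRing B)
  have : CharZero (FractionRing A) :=
    charZero_of_injective_algebraMap (IsFractionRing.injective A (FractionRing A))
  have hsep : Algebra.IsSeparable (FractionRing A) (FractionRing B) := inferInstance
  rw [← not_dvd_differentIdeal_iff]
  intro hdvd
  -- The derivative of the minimal polynomial at x lies in the different, and f'(x) is a multiple of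
  -- it; hence P does not divide the different.
  have h1 := aeval_derivative_mem_differentIdeal A k K x hx
  obtain ⟨g, hg⟩ := minpoly.isIntegrallyClosed_dvd (R := A)
    (IsIntegralClosure.isIntegral A K x) hfx
  apply hP
  rw [hg, derivative_mul, map_add, map_mul, map_mul, minpoly.aeval, zero_mul, add_zero]
  exact P.mul_mem_right _ (Ideal.dvd_iff_le.mp hdvd h1)

end Galois

/-! ### Finitely generated abelian groups modulo two -/

theorem AddSubgroup.index_range_nsmul_two_congr {M N : Type*} [AddCommGroup M] [AddCommGroup N]
    (e : M ≃+ N) : (nsmulAddMonoidHom (α := M) 2).range.index =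
      (nsmulAddMonoidHom (α := N) 2).range.index := by
  have : (nsmulAddMonoidHom (α := N) 2).range =
      (nsmulAddMonoidHom (α := M) 2).range.map e.toAddMonoidHom := by
    ext x
    constructor
    · rintro ⟨y, rfl⟩
      exact ⟨2 • e.symm y, ⟨e.symm y, rfl⟩, by simp⟩
    · rintro ⟨_, ⟨y, rfl⟩, rfl⟩
      exact ⟨e y, by simp⟩
  rw [this]
  exact (AddSubgroup.index_map_equiv _ e).symm

theorem AddSubgroup.index_range_nsmul_two_prod (M N : Type*) [AddCommGroup M] [AddCommGroup N] :
    (nsmulAddMonoidHom (α := M × N) 2).range.index =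
      (nsmulAddMonoidHom (α := M) 2).range.index * (nsmulAddMonoidHom (α := N) 2).range.index := by
  rw [← AddSubgroup.index_prod]
  congr 1
  ext x
  constructor
  · rintro ⟨y, rfl⟩
    exact ⟨⟨y.1, rfl⟩, ⟨y.2, rfl⟩⟩
  · rintro ⟨⟨y, hy⟩, ⟨z, hz⟩⟩
    exact ⟨(y, z), Prod.ext hy hz⟩

/-- An endomorphism of a finite group has kernel and cokernel of the same order. -/
theorem AddSubgroup.index_range_nsmul_two_of_finite (M : Type*) [AddCommGroup M] [Finite M] :
    (nsmulAddMonoidHom (α := M) 2).range.index = Nat.card (nsmulAddMonoidHom (α := M) 2).ker := by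
  have h1 := (nsmulAddMonoidHom (α := M) 2).range.card_mul_index
  have h2 := (nsmulAddMonoidHom (α := M) 2).ker.card_mul_index
  rw [AddSubgroup.index_ker] at h2
  have h3 : 0 < Nat.card (nsmulAddMonoidHom (α := M) 2).range := Nat.card_pos
  rw [← h2, mul_comm] at h1
  exact Nat.eq_of_mul_eq_mul_right h3 h1

theorem AddSubgroup.index_range_nsmul_two_finsupp (n : ℕ) :
    (nsmulAddMonoidHom (α := Fin n →₀ ℤ) 2).range.index = 2 ^ n := by
  let φ : (Fin n →₀ ℤ) →+ (Fin n → ZMod 2) :=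
    { toFun := fun x j ↦ (x j : ZMod 2)
      map_zero' := by ext; simp
      map_add' := fun x y ↦ by ext; simp }
  have hker : (nsmulAddMonoidHom (α := Fin n →₀ ℤ) 2).range = φ.ker := by
    ext x
    constructor
    · rintro ⟨y, rfl⟩
      rw [AddMonoidHom.mem_ker]
      ext j
      have : (2 : ZMod 2) = 0 := by decide
      simp [φ, this]
    · intro hx
      rw [AddMonoidHom.mem_ker] at hx
      have h2 : ∀ j, ∃ y : ℤ, x j = 2 * y := fun j ↦ by
        have := congrFun hx j
        exact (ZMod.intCast_zmod_eq_zero_iff_dvd _ 2).mp this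
      choose y hy using h2
      refine ⟨Finsupp.equivFunOnFinite.symm y, ?_⟩
      ext j
      simp [hy]
  have hsurj : Function.Surjective φ := by
    intro y
    refine ⟨Finsupp.equivFunOnFinite.symm (fun j ↦ ((y j).val : ℤ)), ?_⟩
    ext j
    simp [φ]
  rw [hker, AddSubgroup.index_ker, AddMonoidHom.range_eq_top.mpr hsurj, AddSubgroup.card_top]
  simp [Nat.card_eq_fintype_card]

theorem LinearMap.finrank_range_add_finrank_ker_int {M N : Type*} [AddCommGroup M] [AddCommGroup N]
    [Module.Finite ℤ M] (g : M →ₗ[ℤ] N) : Module.finrank ℤ (LinearMap.range g) +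
      Module.finrank ℤ (LinearMap.ker g) = Module.finrank ℤ M := by
  rw [← g.quotKerEquivRange.finrank_eq]
  exact Submodule.finrank_quotient_add_finrank _

theorem AddSubgroup.index_range_nsmul_two_of_equiv {M H : Type*} [AddCommGroup M] [AddCommGroup H]
    [Module.Finite ℤ M] [Finite H] {n : ℕ} (f : M ≃+ (Fin n →₀ ℤ) × H) :
    (nsmulAddMonoidHom (α := M) 2).range.index =
      2 ^ Module.finrank ℤ M * Nat.card (nsmulAddMonoidHom (α := M) 2).ker := by
  have hrank : Module.finrank ℤ M = n := by
    let g : M →ₗ[ℤ] (Fin n →₀ ℤ) := (LinearMap.fst ℤ _ _).comp f.toIntLinearEquiv.toLinearMap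
    have hg : Function.Surjective g := fun x ↦ ⟨f.symm (x, 0), by simp [g]⟩
    have hker : Module.finrank ℤ (LinearMap.ker g) = 0 := by
      rw [Module.finrank_eq_zero_iff_isTorsion]
      intro x
      refine ⟨⟨(Nat.card H : ℤ), mem_nonZeroDivisors_of_ne_zero
        (by exact_mod_cast Nat.card_pos.ne')⟩, ?_⟩
      rw [Submonoid.mk_smul, natCast_zsmul]
      apply Subtype.ext
      apply f.injective
      have h1 : (f (x : M)).1 = 0 := x.2
      rw [AddSubmonoidClass.coe_nsmul, map_nsmul, ZeroMemClass.coe_zero, map_zero]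
      refine Prod.ext ?_ ?_
      · rw [Prod.smul_fst, h1, smul_zero, Prod.fst_zero]
      · rw [Prod.smul_snd, card_nsmul_eq_zero', Prod.snd_zero]
    have h := LinearMap.finrank_range_add_finrank_ker_int g
    rw [hker, LinearMap.range_eq_top.mpr hg, finrank_top, add_zero, Module.finrank_finsupp_self,
      Fintype.card_fin] at h
    exact h.symm
  have hcard : Nat.card (nsmulAddMonoidHom (α := M) 2).ker =
      Nat.card (nsmulAddMonoidHom (α := H) 2).ker := by
    have h2 : ∀ x : M, 2 • x = 0 ↔ (f x).1 = 0 ∧ 2 • (f x).2 = 0 := fun x ↦ by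
      rw [← f.map_eq_zero_iff, map_nsmul, Prod.ext_iff, Prod.smul_fst, Prod.smul_snd,
        Prod.fst_zero, Prod.snd_zero, smul_eq_zero_iff_right two_ne_zero]
    refine Nat.card_eq_of_bijective (fun x ↦ ⟨(f x.1).2, ((h2 x.1).mp x.2).2⟩) ⟨?_, ?_⟩
    · intro x y hxy
      apply Subtype.ext
      apply f.injective
      exact Prod.ext (((h2 x.1).mp x.2).1.trans ((h2 y.1).mp y.2).1.symm) (Subtype.ext_iff.mp hxy)
    · intro y
      refine ⟨⟨f.symm (0, y.1), (h2 _).mpr ?_⟩, ?_⟩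
      · rw [AddEquiv.apply_symm_apply]
        exact ⟨rfl, y.2⟩
      · apply Subtype.ext
        simp
  rw [AddSubgroup.index_range_nsmul_two_congr f, AddSubgroup.index_range_nsmul_two_prod,
    AddSubgroup.index_range_nsmul_two_finsupp, AddSubgroup.index_range_nsmul_two_of_finite, hrank,
    hcard]

/-- The order of `M / 2M` for a finitely generated abelian group `M`. -/
theorem AddSubgroup.index_range_nsmul_two (M : Type*) [AddCommGroup M] [Module.Finite ℤ M] :
    (nsmulAddMonoidHom (α := M) 2).range.index =
      2 ^ Module.finrank ℤ M * Nat.card (nsmulAddMonoidHom (α := M) 2).ker := by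
  have : AddGroup.FG M := Module.Finite.iff_addGroup_fg.mp ‹_›
  obtain ⟨n, ι, _, p, hp, e, ⟨f⟩⟩ := AddCommGroup.equiv_free_prod_directSum_zmod M
  have (j : ι) : NeZero (p j ^ e j) := ⟨pow_ne_zero _ (hp j).ne_zero⟩
  classical
  have hfin : Finite (DirectSum ι fun j ↦ ZMod (p j ^ e j)) :=
    Finite.of_equiv _ (DirectSum.addEquivProd _).symm.toEquiv
  exact AddSubgroup.index_range_nsmul_two_of_equiv f

/-! ### Finitely generated abelian groups with an involution -/

section Involution

variable {M : Type*} [AddCommGroup M] [Module.Finite ℤ M]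

theorem Submodule.finrank_eq_of_two_nsmul_mem {N₁ N₂ : Submodule ℤ M} (h : N₁ ≤ N₂)
    (h2 : ∀ x ∈ N₂, 2 • x ∈ N₁) : Module.finrank ℤ N₁ = Module.finrank ℤ N₂ := by
  have h1 := Submodule.finrank_quotient_add_finrank (N₁.submoduleOf N₂)
  have h3 : Module.finrank ℤ (N₂ ⧸ N₁.submoduleOf N₂) = 0 := by
    rw [Module.finrank_eq_zero_iff_isTorsion]
    intro x
    obtain ⟨y, rfl⟩ := Submodule.Quotient.mk_surjective _ x
    refine ⟨⟨2, mem_nonZeroDivisors_of_ne_zero two_ne_zero⟩, ?_⟩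
    rw [Submonoid.mk_smul, ← Submodule.Quotient.mk_smul, Submodule.Quotient.mk_eq_zero]
    change ((2 : ℤ) • (y : M)) ∈ N₁
    have := h2 y y.2
    rw [two_nsmul] at this
    rw [two_smul]
    exact this
  rw [h3, zero_add, (Submodule.submoduleOfEquivOfLe h).finrank_eq] at h1
  exact h1

variable (s : M →ₗ[ℤ] M)

/-- The ranks of the fixed part and of the anti-fixed part of an involution add up. -/
theorem finrank_ker_id_sub_add_finrank_ker_id_add (hs : ∀ x, s (s x) = x) :
    Module.finrank ℤ (LinearMap.ker (LinearMap.id - s)) +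
      Module.finrank ℤ (LinearMap.ker (LinearMap.id + s)) = Module.finrank ℤ M := by
  have h := LinearMap.finrank_range_add_finrank_ker_int (LinearMap.id + s)
  rw [← h]
  congr 1
  -- The image of 1 + s lies in the fixed part and contains its double, since x + s x = 2x for fixed
  -- x.
  refine (Submodule.finrank_eq_of_two_nsmul_mem ?_ ?_).symm
  · rintro _ ⟨x, rfl⟩
    simp [hs, add_comm]
  · intro x hx
    have hx' : s x = x := by
      rw [LinearMap.mem_ker, LinearMap.sub_apply, LinearMap.id_apply, sub_eq_zero] at hx
      exact hx.symm
    exact ⟨x, by simp [hx', two_nsmul]⟩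

/-- If every anti-fixed element is of the form `x - s x`, then the anti-fixed part modulo two is
not larger than the fixed part modulo two. -/
theorem index_range_nsmul_two_ker_id_add_le {M : Type*} [AddCommGroup M] (s : M →ₗ[ℤ] M)
    (hs : ∀ x, s (s x) = x)
    (hsurj : ∀ y, y + s y = 0 → ∃ x, y = x - s x)
    (hfin : (nsmulAddMonoidHom (α := LinearMap.ker (LinearMap.id - s)) 2).range.index ≠ 0) :
    (nsmulAddMonoidHom (α := LinearMap.ker (LinearMap.id + s)) 2).range.index ≤
      (nsmulAddMonoidHom (α := LinearMap.ker (LinearMap.id - s)) 2).range.index := by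
  have hmem : ∀ y : LinearMap.ker (LinearMap.id + s), (y : M) + s y = 0 := fun y ↦ y.2
  choose x hx using fun y : LinearMap.ker (LinearMap.id + s) ↦ hsurj y (hmem y)
  have hN : ∀ z : M, z + s z ∈ LinearMap.ker (LinearMap.id - s) := fun z ↦ by
    simp [hs, add_comm]
  -- The map sends y = x - s x to x + s x modulo twice the fixed part, for chosen representatives
  -- and preimages. Only its injectivity is needed, so it need not be a homomorphism.
  let Φ : (LinearMap.ker (LinearMap.id + s)) ⧸ (nsmulAddMonoidHom (α := LinearMap.ker
      (LinearMap.id + s)) 2).range → (LinearMap.ker (LinearMap.id - s)) ⧸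
      (nsmulAddMonoidHom (α := LinearMap.ker (LinearMap.id - s)) 2).range :=
    fun q ↦ QuotientAddGroup.mk ⟨x q.out + s (x q.out), hN _⟩
  have : Finite ((LinearMap.ker (LinearMap.id - s)) ⧸
      (nsmulAddMonoidHom (α := LinearMap.ker (LinearMap.id - s)) 2).range) :=
    have : (nsmulAddMonoidHom (α := LinearMap.ker (LinearMap.id - s)) 2).range.FiniteIndex := ⟨hfin⟩
    AddSubgroup.finite_quotient_of_finiteIndex
  refine Nat.card_le_card_of_injective Φ ?_
  intro q q' hqq
  rw [QuotientAddGroup.eq] at hqq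
  obtain ⟨w, hw⟩ := hqq
  have hw' : 2 • (w : M) = -(x q.out + s (x q.out)) + (x q'.out + s (x q'.out)) :=
    congrArg Subtype.val hw
  have hws : s w = w := by
    have := w.2
    rw [LinearMap.mem_ker, LinearMap.sub_apply, LinearMap.id_apply, sub_eq_zero] at this
    exact this.symm
  rw [← q.out_eq', ← q'.out_eq', QuotientAddGroup.eq]
  -- If the images differ by 2w with w fixed, then z = x' - x - w is anti-fixed, and 2z = z - s z =
  -- y' - y.
  have hz : (x q'.out - x q.out - (w : M)) ∈ LinearMap.ker (LinearMap.id + s) := by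
    rw [LinearMap.mem_ker, LinearMap.add_apply, LinearMap.id_apply, map_sub, map_sub, hws]
    have : x q'.out - x q.out - (w : M) + (s (x q'.out) - s (x q.out) - w) =
      (-(x q.out + s (x q.out)) + (x q'.out + s (x q'.out))) - 2 • (w : M) := by
      rw [two_nsmul]; abel
    rw [this, hw', sub_self]
  refine ⟨⟨_, hz⟩, Subtype.ext ?_⟩
  change 2 • (x q'.out - x q.out - (w : M)) = -(q.out : M) + (q'.out : M)
  rw [hx q.out, hx q'.out, two_nsmul]
  have hz' : s (x q'.out - x q.out - (w : M)) = -(x q'.out - x q.out - (w : M)) := by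
    rw [LinearMap.mem_ker, LinearMap.add_apply, LinearMap.id_apply] at hz
    exact (neg_eq_of_add_eq_zero_right hz).symm
  rw [map_sub, map_sub, hws] at hz'
  have : s (x q'.out) = -(x q'.out - x q.out - (w : M)) + w + s (x q.out) := by
    rw [← hz']; abel
  rw [this]; abel

end Involution

/-! ### Units and capitulation in unramified quadratic extensions -/

section QuadraticUnits

variable {k K : Type*} [Field k] [NumberField k] [Field K] [NumberField K] [Algebra k K]

/-- The action of a Galois automorphism on the unit group, written additively. -/
noncomputable def unitsConj (σ : Gal(K/k)) : Additive (𝓞 K)ˣ →ₗ[ℤ] Additive (𝓞 K)ˣ :=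
  (MonoidHom.toAdditive (Units.map
    (MulSemiringAction.toRingHom Gal(K/k) (𝓞 K) σ).toMonoidHom)).toIntLinearMap

theorem coe_unitsConj (σ : Gal(K/k)) (u : Additive (𝓞 K)ˣ) :
    (((unitsConj σ u).toMul : (𝓞 K)ˣ) : 𝓞 K) = σ • ((u.toMul : (𝓞 K)ˣ) : 𝓞 K) :=
  rfl

theorem sq_eq_one_of_finrank_eq_two [IsGalois k K] (h2 : Module.finrank k K = 2) (σ : Gal(K/k)) :
    σ * σ = 1 := by
  have hcard : Nat.card Gal(K/k) = 2 := by rw [IsGalois.card_aut_eq_finrank, h2]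
  rw [← sq, ← hcard, pow_card_eq_one']

theorem exists_nontrivial_gal [IsGalois k K] (h2 : Module.finrank k K = 2) :
    ∃ σ : Gal(K/k), σ ≠ 1 := by
  have hcard : Nat.card Gal(K/k) = 2 := by rw [IsGalois.card_aut_eq_finrank, h2]
  have : Nontrivial Gal(K/k) := Finite.one_lt_card_iff_nontrivial.mp (by omega)
  exact exists_ne 1

theorem mem_range_of_fixed [IsGalois k K] (h2 : Module.finrank k K = 2) {σ : Gal(K/k)}
    (hσ : σ ≠ 1) {x : K} (hx : σ x = x) : ∃ y : k, algebraMap k K y = x := by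
  refine (IsGalois.mem_range_algebraMap_iff_fixed x).mpr fun g ↦ ?_
  rcases eq_one_or_eq_of_finrank_eq_two h2 hσ g with rfl | rfl
  · rfl
  · exact hx

theorem mem_range_integers_of_fixed [IsGalois k K] (h2 : Module.finrank k K = 2) {σ : Gal(K/k)}
    (hσ : σ ≠ 1) {x : 𝓞 K} (hx : σ • x = x) : ∃ y : 𝓞 k, algebraMap (𝓞 k) (𝓞 K) y = x := by
  obtain ⟨y, hy⟩ := mem_range_of_fixed h2 hσ (x := (x : K)) (congrArg RingOfIntegers.val hx)
  have hint : IsIntegral ℤ y := by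
    refine (isIntegral_algebraMap_iff (algebraMap k K).injective).mp ?_
    rw [hy]
    exact RingOfIntegers.isIntegral_coe x
  exact ⟨⟨y, hint⟩, RingOfIntegers.coe_injective hy⟩

theorem unitsConj_unitsConj [IsGalois k K] (h2 : Module.finrank k K = 2) (σ : Gal(K/k))
    (u : Additive (𝓞 K)ˣ) : unitsConj σ (unitsConj σ u) = u := by
  apply Additive.toMul.injective
  apply Units.ext
  rw [coe_unitsConj, coe_unitsConj, smul_smul, sq_eq_one_of_finrank_eq_two h2, one_smul]

theorem finrank_ker_id_sub_unitsConj [IsGalois k K] (h2 : Module.finrank k K = 2) {σ : Gal(K/k)}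
    (hσ : σ ≠ 1) : Module.finrank ℤ (LinearMap.ker (LinearMap.id - unitsConj σ)) =
      Module.finrank ℤ (Additive (𝓞 k)ˣ) := by
  let e : Additive (𝓞 k)ˣ →ₗ[ℤ] Additive (𝓞 K)ˣ :=
    (MonoidHom.toAdditive (Units.map (algebraMap (𝓞 k) (𝓞 K)).toMonoidHom)).toIntLinearMap
  have hinj : Function.Injective e := by
    intro x y hxy
    have h1 : algebraMap (𝓞 k) (𝓞 K) ((x.toMul : (𝓞 k)ˣ) : 𝓞 k) =
        algebraMap (𝓞 k) (𝓞 K) ((y.toMul : (𝓞 k)ˣ) : 𝓞 k) :=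
      congrArg (fun z : Additive (𝓞 K)ˣ ↦ ((z.toMul : (𝓞 K)ˣ) : 𝓞 K)) hxy
    exact Additive.toMul.injective (Units.ext (FaithfulSMul.algebraMap_injective _ _ h1))
  have hrange : LinearMap.range e = LinearMap.ker (LinearMap.id - unitsConj σ) := by
    ext u
    rw [LinearMap.mem_ker, LinearMap.sub_apply, LinearMap.id_apply, sub_eq_zero]
    constructor
    · rintro ⟨x, rfl⟩
      apply Additive.toMul.injective
      apply Units.ext
      rw [coe_unitsConj]
      apply RingOfIntegers.coe_injective
      exact (σ.commutes _).symm
    · intro hu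
      have hfix : ∀ v : Additive (𝓞 K)ˣ, v = unitsConj σ v →
          ∃ y : 𝓞 k, algebraMap (𝓞 k) (𝓞 K) y = ((v.toMul : (𝓞 K)ˣ) : 𝓞 K) := fun v hv ↦
        mem_range_integers_of_fixed h2 hσ
          (congrArg (fun z : Additive (𝓞 K)ˣ ↦ ((z.toMul : (𝓞 K)ˣ) : 𝓞 K)) hv.symm)
      obtain ⟨y, hy⟩ := hfix u hu
      obtain ⟨z, hz⟩ := hfix (-u) (by rw [map_neg, ← hu])
      have hyz : y * z = 1 := by
        apply FaithfulSMul.algebraMap_injective (𝓞 k) (𝓞 K)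
        rw [map_mul, hy, hz, map_one, toMul_neg, Units.mul_inv]
      refine ⟨Additive.ofMul (Units.mkOfMulEqOne y z hyz), ?_⟩
      apply Additive.toMul.injective
      apply Units.ext
      exact hy
  rw [← hrange]
  exact (LinearEquiv.ofInjective e hinj).finrank_eq.symm

/-- The only square roots of 1 in a field are ±1. This is the torsion contribution to the order of N
modulo squares. -/
theorem card_ker_nsmul_two_of_neg_one_mem (N : Submodule ℤ (Additive (𝓞 K)ˣ))
    (hN : Additive.ofMul (-1 : (𝓞 K)ˣ) ∈ N) :
    Nat.card (nsmulAddMonoidHom (α := N) 2).ker = 2 := by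
  have hne : Additive.ofMul (-1 : (𝓞 K)ˣ) ≠ 0 := by
    intro h
    have h1 : (-1 : (𝓞 K)ˣ) = 1 := Additive.ofMul.injective h
    have h3 : (-1 : 𝓞 K) = 1 := congrArg Units.val h1
    have : (2 : 𝓞 K) = 0 := by linear_combination -h3
    exact two_ne_zero this
  have h0 : (⟨_, hN⟩ : N) ∈ (nsmulAddMonoidHom (α := N) 2).ker := by
    rw [AddMonoidHom.mem_ker]
    apply Subtype.ext
    change (2 : ℕ) • Additive.ofMul (-1 : (𝓞 K)ˣ) = 0
    rw [← ofMul_pow]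
    simp
  rw [Nat.card_eq_two_iff]
  refine ⟨0, ⟨_, h0⟩, ?_, ?_⟩
  · intro h
    have h3 : (0 : Additive (𝓞 K)ˣ) = Additive.ofMul (-1 : (𝓞 K)ˣ) :=
      congrArg (fun z : (nsmulAddMonoidHom (α := N) 2).ker ↦ ((z : N) : Additive (𝓞 K)ˣ)) h
    exact hne h3.symm
  · rw [Set.eq_univ_iff_forall]
    rintro ⟨⟨x, hxN⟩, hx⟩
    have h1 : (x.toMul : (𝓞 K)ˣ) ^ 2 = 1 := by
      have := congrArg (fun z : N ↦ (z : Additive (𝓞 K)ˣ).toMul) (AddMonoidHom.mem_ker.mp hx)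
      exact this
    have h3 : ((x.toMul : (𝓞 K)ˣ) : 𝓞 K) ^ 2 = 1 := by
      rw [← Units.val_pow_eq_pow_val, h1, Units.val_one]
    rcases mul_self_eq_one_iff.mp ((sq _).symm.trans h3) with h | h
    · left
      apply Subtype.ext; apply Subtype.ext; apply Additive.toMul.injective; exact Units.ext h
    · right
      apply Subtype.ext; apply Subtype.ext; apply Additive.toMul.injective; exact Units.ext h

theorem index_range_nsmul_two_ker_id_sub_unitsConj [IsGalois k K] (h2 : Module.finrank k K = 2)
    {σ : Gal(K/k)} (hσ : σ ≠ 1) :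
    (nsmulAddMonoidHom (α := LinearMap.ker (LinearMap.id - unitsConj σ)) 2).range.index =
      2 ^ Units.rank k * 2 := by
  rw [AddSubgroup.index_range_nsmul_two, finrank_ker_id_sub_unitsConj h2 hσ,
    card_ker_nsmul_two_of_neg_one_mem, NumberField.Units.finrank_eq]
  rw [LinearMap.mem_ker, LinearMap.sub_apply, LinearMap.id_apply, sub_eq_zero]
  apply Additive.toMul.injective
  apply Units.ext
  rw [coe_unitsConj]
  simp

theorem index_range_nsmul_two_ker_id_add_unitsConj [IsGalois k K] (h2 : Module.finrank k K = 2)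
    {σ : Gal(K/k)} (hσ : σ ≠ 1) :
    (nsmulAddMonoidHom (α := LinearMap.ker (LinearMap.id + unitsConj σ)) 2).range.index =
      2 ^ (Units.rank K - Units.rank k) * 2 := by
  have h := finrank_ker_id_sub_add_finrank_ker_id_add (unitsConj σ) (unitsConj_unitsConj h2 σ)
  rw [finrank_ker_id_sub_unitsConj h2 hσ, NumberField.Units.finrank_eq,
    NumberField.Units.finrank_eq] at h
  rw [AddSubgroup.index_range_nsmul_two, card_ker_nsmul_two_of_neg_one_mem]
  · congr 2
    omega
  rw [LinearMap.mem_ker, LinearMap.add_apply, LinearMap.id_apply]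
  apply Additive.toMul.injective
  apply Units.ext
  rw [toMul_add, Units.val_mul, coe_unitsConj]
  simp

theorem associated_smul_of_map_eq_span (σ : Gal(K/k)) {I : Ideal (𝓞 k)} {γ : 𝓞 K}
    (h : I.map (algebraMap (𝓞 k) (𝓞 K)) = Ideal.span {γ}) : Associated (σ • γ) γ := by
  rw [← Ideal.span_singleton_eq_span_singleton, ← h, ← smul_map_algebraMap σ I, h,
    Ideal.pointwise_smul_def, Ideal.map_span, Set.image_singleton]
  rfl

/-- Two generators with the same ratio of conjugates come from ideals in the same class. -/
theorem mk0_eq_mk0_of_mul_smul_eq [IsGalois k K] (h2 : Module.finrank k K = 2) {σ : Gal(K/k)}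
    (hσ : σ ≠ 1) {I I' : (Ideal (𝓞 k))⁰} {γ γ' : 𝓞 K} (hγ' : γ' ≠ 0)
    (h : (I : Ideal (𝓞 k)).map (algebraMap (𝓞 k) (𝓞 K)) = Ideal.span {γ})
    (h' : (I' : Ideal (𝓞 k)).map (algebraMap (𝓞 k) (𝓞 K)) = Ideal.span {γ'})
    (hγ0 : γ ≠ 0) (hfix : γ * σ • γ' = γ' * σ • γ) : ClassGroup.mk0 I = ClassGroup.mk0 I' := by
  -- the product `γ * σ γ'` and the norm of `γ'` come from `k`
  obtain ⟨y, hy⟩ := mem_range_integers_of_fixed h2 hσ (x := γ * σ • γ') (by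
    rw [smul_mul', smul_smul, sq_eq_one_of_finrank_eq_two h2, one_smul, hfix, mul_comm])
  obtain ⟨z, hz⟩ := mem_range_integers_of_fixed h2 hσ (x := γ' * σ • γ') (by
    rw [smul_mul', smul_smul, sq_eq_one_of_finrank_eq_two h2, one_smul, mul_comm])
  have hσγ' : σ • γ' ≠ 0 := (smul_ne_zero_iff_ne σ).mpr hγ'
  have hz0 : z ≠ 0 := by
    rintro rfl
    rw [map_zero] at hz
    exact mul_ne_zero hγ' hσγ' hz.symm
  have hy0 : y ≠ 0 := by
    rintro rfl
    rw [map_zero] at hy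
    exact mul_ne_zero hγ0 hσγ' hy.symm
  rw [ClassGroup.mk0_eq_mk0_iff]
  refine ⟨z, y, hz0, hy0, ?_⟩
  have hinj : Function.Injective (Ideal.map (algebraMap (𝓞 k) (𝓞 K))) :=
    Ideal.map_injective_of_faithfullyFlat
  apply hinj
  rw [Ideal.map_mul, Ideal.map_mul, Ideal.map_span, Ideal.map_span, Set.image_singleton,
    Set.image_singleton, h, h', hy, hz, Ideal.span_singleton_mul_span_singleton,
    Ideal.span_singleton_mul_span_singleton]
  congr 2
  ring

/-- Attach to a class the unit u = γ/σγ, where γ generates the extended ideal. If two such units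
differ by the square of ω with ω σ(ω) = 1, then ω² = ω/σω, so the second generator can be rescaled
by a unit to have the same ratio as the first. The quotient of the generators then lies in k and the
classes agree. -/
theorem card_capitulationKernel_le [IsGalois k K] (h2 : Module.finrank k K = 2) :
    Nat.card (capitulationKernel k K) ≤ 2 ^ (Units.rank K - Units.rank k) * 2 := by
  obtain ⟨σ, hσ⟩ := exists_nontrivial_gal h2
  have key : ∀ c : capitulationKernel k K, ∃ (I : (Ideal (𝓞 k))⁰) (γ : 𝓞 K) (u : (𝓞 K)ˣ),
      ClassGroup.mk0 I = (c : ClassGroup (𝓞 k)) ∧ γ ≠ 0 ∧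
      (I : Ideal (𝓞 k)).map (algebraMap (𝓞 k) (𝓞 K)) = Ideal.span {γ} ∧ σ • γ * u = γ := by
    rintro ⟨c, hc⟩
    obtain ⟨I, rfl⟩ := ClassGroup.mk0_surjective c
    obtain ⟨γ, hγ0, hγ⟩ := (mk0_mem_capitulationKernel_iff I).mp hc
    obtain ⟨u, hu⟩ := associated_smul_of_map_eq_span σ hγ
    exact ⟨I, γ, u, rfl, hγ0, hγ, hu⟩
  choose I γ u hI hγ0 hγ hu using key
  have hmem : ∀ c, Additive.ofMul (u c) ∈ LinearMap.ker (LinearMap.id + unitsConj σ) := by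
    intro c
    rw [LinearMap.mem_ker, LinearMap.add_apply, LinearMap.id_apply]
    apply Additive.toMul.injective
    apply Units.ext
    rw [toMul_add, Units.val_mul, coe_unitsConj]
    change ((u c : (𝓞 K)ˣ) : 𝓞 K) * σ • ((u c : (𝓞 K)ˣ) : 𝓞 K) = 1
    have h1 := congrArg (σ • ·) (hu c)
    simp only [smul_mul', smul_smul, sq_eq_one_of_finrank_eq_two h2, one_smul] at h1
    apply mul_left_cancel₀ (hγ0 c)
    linear_combination (u c : 𝓞 K) * h1 + hu c
  set N := LinearMap.ker (LinearMap.id + unitsConj σ)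
  let Φ : capitulationKernel k K → N ⧸ (nsmulAddMonoidHom (α := N) 2).range :=
    fun c ↦ QuotientAddGroup.mk ⟨Additive.ofMul (u c), hmem c⟩
  have hΦ : Function.Injective Φ := by
    intro c c' hcc
    obtain ⟨⟨w, hw⟩, hww⟩ := QuotientAddGroup.eq.mp hcc
    have h1 : (w.toMul : (𝓞 K)ˣ) ^ 2 = (u c)⁻¹ * u c' :=
      congrArg (fun z : N ↦ (z : Additive (𝓞 K)ˣ).toMul) hww
    have h3 : (u c' : 𝓞 K) = u c * ((w.toMul : (𝓞 K)ˣ) : 𝓞 K) ^ 2 := by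
      rw [← Units.val_pow_eq_pow_val, h1, ← Units.val_mul, mul_inv_cancel_left]
    have h4 : ((w.toMul : (𝓞 K)ˣ) : 𝓞 K) * σ • ((w.toMul : (𝓞 K)ˣ) : 𝓞 K) = 1 :=
      congrArg (fun z : Additive (𝓞 K)ˣ ↦ ((z.toMul : (𝓞 K)ˣ) : 𝓞 K)) (LinearMap.mem_ker.mp hw)
    set ω := ((w.toMul : (𝓞 K)ˣ) : 𝓞 K) with hω
    have hωu : IsUnit ω := ⟨_, hω.symm⟩
    apply Subtype.ext
    rw [← hI c, ← hI c']
    refine mk0_eq_mk0_of_mul_smul_eq h2 hσ (γ' := γ c' * σ • ω) (γ := γ c)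
      (mul_ne_zero (hγ0 c') ((smul_ne_zero_iff_ne σ).mpr hωu.ne_zero)) (hγ c) ?_ (hγ0 c) ?_
    · rw [hγ c', Ideal.span_singleton_mul_right_unit]
      exact IsUnit.of_mul_eq_one_right _ h4
    · rw [smul_mul', smul_smul, sq_eq_one_of_finrank_eq_two h2, one_smul]
      have e1 := hu c
      have e2 := hu c'
      rw [h3] at e2
      -- `γ c * σ γ' * ω = γ' * σ ω * σ γ`
      calc γ c * (σ • γ c' * ω) = (σ • γ c * u c) * (σ • γ c' * ω) := by rw [e1]
        _ = (σ • γ c' * (u c * ω ^ 2)) * σ • γ c * (σ • ω) := by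
          linear_combination (-(σ • γ c * u c * σ • γ c' * ω)) * h4
        _ = γ c' * σ • ω * σ • γ c := by rw [e2]; ring
  have hidx := index_range_nsmul_two_ker_id_add_unitsConj h2 hσ
  have hne : (nsmulAddMonoidHom (α := N) 2).range.index ≠ 0 := by rw [hidx]; positivity
  have : (nsmulAddMonoidHom (α := N) 2).range.FiniteIndex := ⟨hne⟩
  have hfin : Finite (N ⧸ (nsmulAddMonoidHom (α := N) 2).range) := inferInstance
  rw [← hidx]
  exact Nat.card_le_card_of_injective Φ hΦ

/-- If nothing capitulated, every unit η with η σ(η) = 1 would be a quotient ω/σω of units.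
Comparing the units of relative norm 1 with those of k, both modulo squares, would then bound the
rank of K by twice that of k. -/
theorem capitulationKernel_ne_bot [IsGalois k K] (h2 : Module.finrank k K = 2)
    (hunr : ∀ 𝔭 : Ideal (𝓞 k), 𝔭.IsPrime → Algebra.IsUnramifiedIn (𝓞 K) 𝔭)
    (hrank : 2 * Units.rank k < Units.rank K) : capitulationKernel k K ≠ ⊥ := by
  obtain ⟨σ, hσ⟩ := exists_nontrivial_gal h2
  intro hbot
  have hle := index_range_nsmul_two_ker_id_add_le (unitsConj σ) (unitsConj_unitsConj h2 σ) ?_ (by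
    rw [index_range_nsmul_two_ker_id_sub_unitsConj h2 hσ]; positivity)
  · rw [index_range_nsmul_two_ker_id_sub_unitsConj h2 hσ,
      index_range_nsmul_two_ker_id_add_unitsConj h2 hσ] at hle
    have := Nat.le_of_mul_le_mul_right hle two_pos
    have := (Nat.pow_le_pow_iff_right one_lt_two).mp this
    omega
  intro v hv
  set η := ((v.toMul : (𝓞 K)ˣ) : 𝓞 K) with hη
  have hη1 : η * σ • η = 1 :=
    congrArg (fun z : Additive (𝓞 K)ˣ ↦ ((z.toMul : (𝓞 K)ˣ) : 𝓞 K)) hv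
  have hσσ : ∀ x : 𝓞 K, σ • σ • x = x := fun x ↦ by
    rw [smul_smul, sq_eq_one_of_finrank_eq_two h2, one_smul]
  -- Hilbert 90 with an integral solution: γ = 1 + η, or any nonzero x - σx when η = -1.
  obtain ⟨γ, hγ0, hγ⟩ : ∃ γ : 𝓞 K, γ ≠ 0 ∧ γ = η * σ • γ := by
    by_cases hη0 : 1 + η = 0
    · obtain ⟨x, hx⟩ : ∃ x : 𝓞 K, σ • x ≠ x := by
        by_contra! hall
        apply hσ
        ext y
        obtain ⟨a, b, hb, rfl⟩ := IsFractionRing.div_surjective (A := 𝓞 K) y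
        rw [map_div₀, AlgEquiv.one_apply]
        congr 1
        · exact congrArg RingOfIntegers.val (hall a)
        · exact congrArg RingOfIntegers.val (hall b)
      refine ⟨x - σ • x, sub_ne_zero.mpr hx.symm, ?_⟩
      rw [smul_sub, hσσ]
      linear_combination (x - σ • x) * hη0
    · refine ⟨1 + η, hη0, ?_⟩
      rw [smul_add, smul_one]
      linear_combination -hη1
  have hinv : ∀ g : Gal(K/k), g • Ideal.span {γ} = Ideal.span {γ} := by
    intro g
    rcases eq_one_or_eq_of_finrank_eq_two h2 hσ g with rfl | rfl
    · rw [one_smul]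
    · rw [Ideal.pointwise_smul_def, Ideal.map_span, Set.image_singleton,
        Ideal.span_singleton_eq_span_singleton]
      refine ⟨v.toMul, ?_⟩
      rw [← hη, mul_comm]
      exact hγ.symm
  have hspan0 : Ideal.span {γ} ≠ ⊥ := by rwa [Ne, Ideal.span_singleton_eq_bot]
  obtain ⟨I, hI⟩ := exists_eq_map_of_smul_eq hunr (Ideal.span {γ}) hspan0 hinv
  have hI0 : I ≠ ⊥ := by
    rintro rfl
    exact hspan0 (by rw [hI, Ideal.map_bot])
  let I₀ : (Ideal (𝓞 k))⁰ := ⟨I, mem_nonZeroDivisors_of_ne_zero hI0⟩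
  have hmem : ClassGroup.mk0 I₀ ∈ capitulationKernel k K :=
    (mk0_mem_capitulationKernel_iff I₀).mpr ⟨γ, hγ0, hI.symm⟩
  -- The invariant ideal (γ) comes from an ideal of k, principal by assumption. A generator y in k
  -- gives γ = y ω with ω a unit, and y cancels in γ/σγ.
  rw [hbot, Subgroup.mem_bot, ClassGroup.mk0_eq_one_iff] at hmem
  obtain ⟨y, hy⟩ := hmem
  change I = Ideal.span {y} at hy
  rw [hy, Ideal.map_span, Set.image_singleton, Ideal.span_singleton_eq_span_singleton] at hI
  obtain ⟨ω, hω⟩ := hI.symm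
  refine ⟨Additive.ofMul ω, ?_⟩
  rw [eq_sub_iff_add_eq]
  apply Additive.toMul.injective
  apply Units.ext
  rw [toMul_add, Units.val_mul, coe_unitsConj, ← hη]
  change η * σ • (ω : 𝓞 K) = ω
  have hy0 : algebraMap (𝓞 k) (𝓞 K) y ≠ 0 := by
    intro h0
    rw [h0, zero_mul] at hω
    exact hγ0 hω.symm
  have hfixy : σ • algebraMap (𝓞 k) (𝓞 K) y = algebraMap (𝓞 k) (𝓞 K) y :=
    RingOfIntegers.coe_injective (σ.commutes _)
  rw [← hω, smul_mul', hfixy] at hγ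
  apply mul_left_cancel₀ hy0
  rw [hγ]
  ring

/-- The number of classes capitulating in an unramified quadratic extension of totally complex
fields with unit ranks `1` and `3`. -/
theorem card_capitulationKernel_of_rank [IsGalois k K] (h2 : Module.finrank k K = 2)
    (hunr : ∀ 𝔭 : Ideal (𝓞 k), 𝔭.IsPrime → Algebra.IsUnramifiedIn (𝓞 K) 𝔭)
    (hk : Units.rank k = 1) (hK : Units.rank K = 3) :
    Nat.card (capitulationKernel k K) = 2 ∨ Nat.card (capitulationKernel k K) = 4 ∨
      Nat.card (capitulationKernel k K) = 8 := by
  have hle := card_capitulationKernel_le (k := k) (K := K) h2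
  have hne := capitulationKernel_ne_bot h2 hunr (by omega)
  rw [hk, hK] at hle
  have hp : IsPGroup 2 (capitulationKernel k K) := fun c ↦ ⟨1, by
    apply Subtype.ext
    have := pow_finrank_eq_one_of_mem_capitulationKernel c.2
    rw [h2] at this
    simpa using this⟩
  have : Fact (Nat.Prime 2) := ⟨Nat.prime_two⟩
  obtain ⟨n, hn⟩ := IsPGroup.iff_card.mp hp
  have hn3 : n ≤ 3 := by
    rw [hn] at hle
    exact (Nat.pow_le_pow_iff_right one_lt_two).mp (hle.trans (by norm_num))
  have hn0 : n ≠ 0 := by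
    rintro rfl
    exact hne (Subgroup.eq_bot_of_card_eq _ (by simpa using hn))
  interval_cases n <;> simp_all

end QuadraticUnits

/-! ### Inertia groups -/

section Inertia

theorem finrank_rat_eq_one_iff_eq_bot {K : Type*} [Field K] [NumberField K]
    (M : IntermediateField ℚ K) : Module.finrank ℚ M = 1 ↔ M = ⊥ :=
  IntermediateField.finrank_eq_one_iff

/-- The Galois group of a number field is generated by the inertia groups. -/
theorem eq_top_of_forall_inertia_le {K : Type*} [Field K] [NumberField K] [IsGalois ℚ K]
    (T : Subgroup Gal(K/ℚ))
    (hT : ∀ P : Ideal (𝓞 K), P.IsMaximal → P.inertia Gal(K/ℚ) ≤ T) : T = ⊤ := by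
  let M := IntermediateField.fixedField T
  suffices hM : M = ⊥ by
    rw [← IntermediateField.fixingSubgroup_fixedField T]
    change M.fixingSubgroup = ⊤
    rw [hM, IntermediateField.fixingSubgroup_bot]
  rw [← finrank_rat_eq_one_iff_eq_bot]
  by_contra hne
  -- By Minkowski's theorem, the fixed field M of T has a ramified prime unless M = ℚ.
  obtain ⟨P, hP, hram⟩ := NumberField.exists_not_isUnramifiedAt_int (𝒪 := 𝓞 M) hne
  apply hram
  obtain ⟨Q, hQ, hQP⟩ := Ideal.exists_maximal_ideal_liesOver_of_isIntegral (S := 𝓞 K) P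
  have hPbot : P ≠ ⊥ := Ideal.IsMaximal.ne_bot_of_isIntegral_int P
  have hpbot : P.under ℤ ≠ ⊥ := mt Ideal.eq_bot_of_comap_eq_bot hPbot
  have hpmax : (P.under ℤ).IsMaximal := Ideal.isMaximal_comap_of_isIntegral_of_isMaximal P
  have hfinp : Finite (ℤ ⧸ P.under ℤ) := Ring.HasFiniteQuotients.finiteQuotient hpbot
  have hfinP : Finite (𝓞 M ⧸ P) := Ring.HasFiniteQuotients.finiteQuotient hPbot
  have hQp : Q.LiesOver (P.under ℤ) := Ideal.LiesOver.trans Q P (P.under ℤ)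
  have h1 := Ideal.card_inertia_eq_ramificationIdxIn (G := Gal(K/ℚ)) (P.under ℤ) Q
  have h2 := Ideal.card_inertia_eq_ramificationIdxIn (G := Gal(K/M)) P Q
  rw [Ideal.ramificationIdxIn_eq_ramificationIdx _ Q Gal(K/ℚ)] at h1
  rw [Ideal.ramificationIdxIn_eq_ramificationIdx _ Q Gal(K/M)] at h2
  -- The inertia group of Q over ℚ is contained in T, hence fixes M and equals the inertia group
  -- over M. Multiplicativity of ramification indices then makes P unramified over ℚ.
  have h3 : Nat.card (Q.inertia Gal(K/M)) = Nat.card (Q.inertia Gal(K/ℚ)) :=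
    Nat.card_congr
      { toFun := fun g ↦ ⟨AlgEquiv.restrictScalars ℚ g.1, g.2⟩
        invFun := fun g ↦ ⟨AlgEquiv.ofRingEquiv (f := g.1.toRingEquiv)
          fun x ↦ x.2 ⟨g.1, hT Q hQ g.2⟩, g.2⟩
        left_inv := fun _ ↦ rfl
        right_inv := fun _ ↦ rfl }
  have h4 := Ideal.ramificationIdx_tower (R := ℤ) P Q
  rw [← h1, ← h2, h3] at h4
  have h5 : 0 < Nat.card (Q.inertia Gal(K/ℚ)) := Nat.card_pos
  rw [← Ideal.ramificationIdx_eq_one_iff]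
  exact (Nat.eq_of_mul_eq_mul_right h5 ((one_mul _).trans h4)).symm

variable {k K : Type*} [Field k] [NumberField k] [Field K] [NumberField K] [Algebra k K]

theorem eq_one_of_mem_inertia [IsGalois k K]
    (hunr : ∀ 𝔭 : Ideal (𝓞 k), 𝔭.IsPrime → Algebra.IsUnramifiedIn (𝓞 K) 𝔭) (P : Ideal (𝓞 K))
    [P.IsMaximal] {g : Gal(K/k)} (hg : g ∈ P.inertia Gal(K/k)) : g = 1 := by
  have hPbot : P ≠ ⊥ := Ideal.IsMaximal.ne_bot_of_isIntegral_int P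
  have hpbot : P.under (𝓞 k) ≠ ⊥ := mt Ideal.eq_bot_of_comap_eq_bot hPbot
  have hpmax : (P.under (𝓞 k)).IsMaximal := Ideal.isMaximal_comap_of_isIntegral_of_isMaximal P
  have hfin : Finite (𝓞 k ⧸ P.under (𝓞 k)) := Ring.HasFiniteQuotients.finiteQuotient hpbot
  have hu : Algebra.IsUnramifiedAt (𝓞 k) P := hunr (P.under (𝓞 k)) hpmax.isPrime P
    inferInstance ⟨rfl⟩
  have h1 := Ideal.card_inertia_eq_ramificationIdxIn (G := Gal(K/k)) (P.under (𝓞 k)) P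
  rw [Ideal.ramificationIdxIn_eq_ramificationIdx _ P Gal(K/k),
    Ideal.ramificationIdx_eq_one_iff.mpr hu] at h1
  have := Subgroup.eq_bot_of_card_eq _ h1
  rw [this] at hg
  exact Subgroup.mem_bot.mp hg

/-- If `K / ℚ` is abelian, `K / k` is unramified and `Gal(k / ℚ)` has exponent two, then so has
`Gal(K / ℚ)`. -/
theorem apply_apply_eq_of_isUnramified [IsAbelianGalois ℚ K] [IsGalois k K]
    (hunr : ∀ 𝔭 : Ideal (𝓞 k), 𝔭.IsPrime → Algebra.IsUnramifiedIn (𝓞 K) 𝔭)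
    (hk : ∀ (g : Gal(K/ℚ)) (x : k), g (g (algebraMap k K x)) = algebraMap k K x)
    (g : Gal(K/ℚ)) (x : K) : g (g x) = x := by
  let T : Subgroup Gal(K/ℚ) :=
    { carrier := {g | g * g = 1}
      one_mem' := one_mul 1
      mul_mem' := fun {a b} (ha : a * a = 1) (hb : b * b = 1) ↦ by
        have hcomm : a * b = b * a := mul_comm' a b
        change a * b * (a * b) = 1
        rw [mul_assoc, ← mul_assoc b a b, ← hcomm, mul_assoc, hb, mul_one, ha]
      inv_mem' := fun {a} (ha : a * a = 1) ↦ by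
        change a⁻¹ * a⁻¹ = 1
        rw [← mul_inv_rev, ha, inv_one] }
  -- For g in an inertia group, g² is trivial on k and still inert, so it lies in an inertia group
  -- of K/k, which is trivial. Commutativity makes the elements with trivial square a subgroup.
  have hT : T = ⊤ := by
    refine eq_top_of_forall_inertia_le T fun P hP g hg ↦ ?_
    change g * g = 1
    let g' : Gal(K/k) := AlgEquiv.ofRingEquiv (f := (g * g).toRingEquiv) (hk g)
    have hg' : g' ∈ P.inertia Gal(K/k) := by
      have := mul_mem hg hg
      exact this
    have h1 := eq_one_of_mem_inertia hunr P hg'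
    ext y
    exact DFunLike.congr_fun h1 y
  have hg : g * g = 1 := (hT ▸ Subgroup.mem_top g : g ∈ T)
  exact DFunLike.congr_fun hg x

end Inertia

/-! ### Unramified primes in `ℚ(√d, i)` -/

theorem adjoin_singleton_eq_top_of_finrank_eq_two {k K : Type*} [Field k] [Field K] [Algebra k K]
    (h2 : Module.finrank k K = 2) {x : K} (hx : ∀ y : k, algebraMap k K y ≠ x) :
    Algebra.adjoin k {x} = ⊤ := by
  have := Subalgebra.isSimpleOrder_of_finrank h2
  refine (eq_bot_or_eq_top (Algebra.adjoin k {x})).resolve_left fun h ↦ ?_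
  have hmem : x ∈ (⊥ : Subalgebra k K) := h ▸ Algebra.self_mem_adjoin_singleton k x
  obtain ⟨y, hy⟩ := Algebra.mem_bot.mp hmem
  exact hx y hy

section Gaussian

variable {F : Type*} [Field F] [NumberField F]

theorem not_rat_of_sq_eq_neg_one {i : F} (hi : i ^ 2 = -1) (r : ℚ) : algebraMap ℚ F r ≠ i := by
  rintro rfl
  have h1 : r ^ 2 = -1 := by
    apply (algebraMap ℚ F).injective
    rw [map_pow, hi, map_neg, map_one]
  nlinarith [sq_nonneg r]

open Polynomial in
theorem isUnramifiedAt_int_of_two_notMem (hF : Module.finrank ℚ F = 2) {i : F} (hi : i ^ 2 = -1)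
    (P : Ideal (𝓞 F)) [P.IsPrime] (hP : (2 : 𝓞 F) ∉ P) : Algebra.IsUnramifiedAt ℤ P := by
  have hint : IsIntegral ℤ i :=
    IsIntegral.of_pow (n := 2) two_pos (by rw [hi]; exact isIntegral_one.neg)
  let x : 𝓞 F := ⟨i, hint⟩
  have hx : x ^ 2 = -1 := RingOfIntegers.coe_injective hi
  refine isUnramifiedAt_of_aeval_derivative_notMem ℚ F (x := x) (f := X ^ 2 + 1)
    (adjoin_singleton_eq_top_of_finrank_eq_two hF (not_rat_of_sq_eq_neg_one hi)) ?_ P ?_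
  · simp [hx]
  · intro hmem
    apply hP
    have h1 := P.mul_mem_right (-x) hmem
    have h3 : aeval x (derivative (X ^ 2 + 1 : ℤ[X])) * -x = 2 := by
      have h4 : (aeval x (2 : ℤ[X]) : 𝓞 F) = 2 := map_ofNat _ 2
      simp
      rw [h4]
      linear_combination -2 * hx
    rwa [h3] at h1

/-- An automorphism of `ℚ(i)` of order two sends `i` to `-i`. -/
theorem exists_gal_apply_eq_neg [IsGalois ℚ F] (hF : Module.finrank ℚ F = 2) {i : F}
    (hi : i ^ 2 = -1) : ∃ c : Gal(F/ℚ), c ≠ 1 ∧ c i = -i := by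
  obtain ⟨c, hc⟩ := exists_nontrivial_gal hF
  refine ⟨c, hc, ?_⟩
  have h1 : c i ^ 2 = i ^ 2 := by rw [← map_pow, hi, map_neg, map_one]
  refine (sq_eq_sq_iff_eq_or_eq_neg.mp h1).resolve_left fun h ↦ ?_
  obtain ⟨y, hy⟩ := mem_range_of_fixed hF hc h
  exact not_rat_of_sq_eq_neg_one hi y hy

/-- A square root of d in ℚ(i) would be rational, or i times it would be. The first is excluded
because d ≠ 1 is squarefree, the second because d > 0. -/
theorem not_gaussian_of_sq_eq [IsGalois ℚ F] (hF : Module.finrank ℚ F = 2) {i : F}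
    (hi : i ^ 2 = -1) {d : ℕ} (hd : Squarefree d) (hd1 : d ≠ 1) (x : F) : x ^ 2 ≠ d := by
  intro hx
  obtain ⟨c, hc, hci⟩ := exists_gal_apply_eq_neg hF hi
  have h1 : c x ^ 2 = x ^ 2 := by rw [← map_pow, hx, map_natCast]
  have hdpos : (0 : ℚ) < d := by exact_mod_cast Nat.pos_of_ne_zero hd.ne_zero
  rcases sq_eq_sq_iff_eq_or_eq_neg.mp h1 with h | h
  · obtain ⟨r, rfl⟩ := mem_range_of_fixed hF hc h
    have h3 : r ^ 2 = (d : ℚ) := by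
      apply (algebraMap ℚ F).injective
      rw [map_pow, hx, map_natCast]
    have h4 : IsSquare (d : ℚ) := ⟨r, by rw [← h3, sq]⟩
    rw [Rat.isSquare_natCast_iff] at h4
    obtain ⟨e, he⟩ := h4
    have := Nat.isUnit_iff.mp (hd e ⟨1, by rw [he, mul_one]⟩)
    subst this
    exact hd1 (by simpa using he)
  · obtain ⟨r, hr⟩ := mem_range_of_fixed hF hc (x := x * i) (by rw [map_mul, h, hci]; ring)
    have h3 : r ^ 2 = -(d : ℚ) := by
      apply (algebraMap ℚ F).injective
      rw [map_pow, hr, map_neg, map_natCast, mul_pow, hx, hi]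
      ring
    nlinarith [sq_nonneg r]

end Gaussian

section Biquadratic

variable {F k : Type*} [Field F] [NumberField F] [Field k] [NumberField k] [Algebra F k]

open Polynomial in
-- Over ℚ(i) the field is also generated by √(-d), and -d ≡ 1 mod 4. Thus (1 + √(-d))/2 is an
-- integral generator, and the derivative of its polynomial has square -d there.
theorem isUnramifiedAt_of_natCast_notMem [IsGalois ℚ F] (hF : Module.finrank ℚ F = 2)
    (hk : Module.finrank F k = 2) {i : F} (hi : i ^ 2 = -1) {d : ℕ} (hd : Squarefree d)
    (hd4 : d % 4 = 3) {s : k} (hs : s ^ 2 = d) (P : Ideal (𝓞 k)) [P.IsPrime]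
    (hP : (d : 𝓞 k) ∉ P) : Algebra.IsUnramifiedAt (𝓞 F) P := by
  set j := algebraMap F k i with hj
  have hj2 : j ^ 2 = -1 := by rw [hj, ← map_pow, hi, map_neg, map_one]
  obtain ⟨e, he⟩ : ∃ e : ℕ, d + 1 = 4 * e := ⟨(d + 1) / 4, by omega⟩
  have he' : (d : k) + 1 = 4 * e := by exact_mod_cast he
  have hj0 : j ≠ 0 := by
    intro h
    rw [h] at hj2
    norm_num at hj2
  have hroot : ((1 + j * s) / 2) ^ 2 - (1 + j * s) / 2 + e = 0 := by
    field_simp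
    linear_combination (s ^ 2) * hj2 - hs - he'
  have hint : IsIntegral ℤ ((1 + j * s) / 2) := by
    refine ⟨X ^ 2 - X + C (e : ℤ), ?_, ?_⟩
    · rw [sub_add]
      apply monic_X_pow_sub
      compute_degree!
    · simpa using hroot
  let x : 𝓞 k := ⟨(1 + j * s) / 2, hint⟩
  have hxj : (x : k) = (1 + j * s) / 2 := rfl
  have hx : x ^ 2 - x + e = 0 := by
    apply RingOfIntegers.coe_injective
    push_cast
    exact hroot
  refine isUnramifiedAt_of_aeval_derivative_notMem F k (x := x) (f := X ^ 2 - X + C (e : 𝓞 F))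
    (adjoin_singleton_eq_top_of_finrank_eq_two hk fun y hy ↦ ?_) ?_ P ?_
  · refine not_gaussian_of_sq_eq hF hi hd (by omega) ((2 * y - 1) * -i) ?_
    apply (algebraMap F k).injective
    have hy' : algebraMap F k y = (1 + j * s) / 2 := hy
    rw [map_pow, map_mul, map_neg, map_sub, map_mul, hy', map_natCast, map_one, ← hj, map_ofNat]
    field_simp
    linear_combination (s ^ 2 * (j ^ 2 - 1)) * hj2 + hs
  · simpa using hx
  · intro hmem
    apply hP
    have h1 := P.mul_mem_right (-aeval x (derivative (X ^ 2 - X + C (e : 𝓞 F)))) hmem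
    convert h1 using 1
    have he'' : (d : 𝓞 k) + 1 = 4 * e := by exact_mod_cast he
    simp
    linear_combination he'' + 4 * hx

variable {K : Type*} [Field K] [Algebra k K] [Algebra F K] [IsScalarTower F k K]

theorem isUnramifiedAt_top_of_natCast_notMem [IsGalois ℚ F] (hF : Module.finrank ℚ F = 2)
    (hk : Module.finrank F k = 2) {i : F} (hi : i ^ 2 = -1) {d : ℕ} (hd : Squarefree d)
    (hd4 : d % 4 = 3) {s : k} (hs : s ^ 2 = d)
    (hunr : ∀ 𝔭 : Ideal (𝓞 k), 𝔭.IsPrime → Algebra.IsUnramifiedIn (𝓞 K) 𝔭)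
    (P : Ideal (𝓞 K)) [hPp : P.IsPrime]
    (hP : (d : 𝓞 K) ∉ P) : Algebra.IsUnramifiedAt (𝓞 F) P := by
  have h1 : Algebra.IsUnramifiedAt (𝓞 k) P := hunr (P.under (𝓞 k)) inferInstance P hPp ⟨rfl⟩
  have h2 : Algebra.IsUnramifiedAt (𝓞 F) (P.under (𝓞 k)) :=
    isUnramifiedAt_of_natCast_notMem hF hk hi hd hd4 hs _ (by
      rwa [Ideal.under_def, Ideal.mem_comap, map_natCast])
  exact Algebra.IsUnramifiedAt.comp (P.under (𝓞 k)) P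

theorem isRadical_span_natCast_of_prime [NumberField K] [IsGalois ℚ F] (hF : Module.finrank ℚ F = 2)
    (hk : Module.finrank F k = 2) {i : F} (hi : i ^ 2 = -1) {d : ℕ} (hd : Squarefree d)
    (hd4 : d % 4 = 3) {s : k} (hs : s ^ 2 = d)
    (hunr : ∀ 𝔭 : Ideal (𝓞 k), 𝔭.IsPrime → Algebra.IsUnramifiedIn (𝓞 K) 𝔭)
    {l : ℕ} (hl : l.Prime) (hl2 : l ≠ 2) (hld : ¬ l ∣ d) :
    (Ideal.span {(l : 𝓞 K)}).IsRadical := by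
  have hlp : Prime (l : ℤ) := Nat.prime_iff_prime_int.mp hl
  have hmax : (Ideal.span {(l : ℤ)}).IsMaximal :=
    PrincipalIdealRing.isMaximal_of_irreducible hlp.irreducible
  have hmap : (Ideal.span {(l : ℤ)}).map (algebraMap ℤ (𝓞 K)) = Ideal.span {(l : 𝓞 K)} := by
    rw [Ideal.map_span, Set.image_singleton, map_natCast]
  rw [← hmap]
  refine Ideal.isRadical_map_of_isUnramifiedIn ?_ ?_
  · rw [hmap, Ne, Ideal.span_singleton_eq_bot]
    exact_mod_cast hl.ne_zero
  intro P hPp hover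
  have hmem : ∀ a : ℤ, (a : 𝓞 K) ∈ P → (l : ℤ) ∣ a := by
    intro a ha
    rw [← Ideal.mem_span_singleton, hover.over, Ideal.mem_comap]
    simpa using ha
  have hd' : (d : 𝓞 K) ∉ P := fun h ↦ hld (by
    have := hmem d (by simpa using h)
    exact_mod_cast this)
  have h2' : (2 : 𝓞 K) ∉ P := fun h ↦ hl2 (by
    have := hmem 2 (by simpa using h)
    exact (Nat.prime_dvd_prime_iff_eq hl Nat.prime_two).mp (by exact_mod_cast this))
  have h1 := isUnramifiedAt_top_of_natCast_notMem hF hk hi hd hd4 hs hunr P hd'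
  have h2 : Algebra.IsUnramifiedAt ℤ (P.under (𝓞 F)) :=
    isUnramifiedAt_int_of_two_notMem hF hi _ (by
      rwa [Ideal.under_def, Ideal.mem_comap, map_ofNat])
  exact Algebra.IsUnramifiedAt.comp (P.under (𝓞 F)) P

end Biquadratic

/-! ### Unramified quadratic extensions of `ℚ(√d, i)` which are abelian over `ℚ` -/

/-- A commuting family of involutions has a common eigenvector on which a given nontrivial one of
them acts as `-1`. -/
theorem exists_eigenvector {K : Type*} [Field K] [NumberField K] [IsAbelianGalois ℚ K]
    (hinv : ∀ (g : Gal(K/ℚ)) (x : K), g (g x) = x) {σ : Gal(K/ℚ)} (hσ : σ ≠ 1) :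
    ∃ y : K, y ≠ 0 ∧ σ y = -y ∧ ∀ g : Gal(K/ℚ), g y = y ∨ g y = -y := by
  classical
  have hcomm : ∀ (g h : Gal(K/ℚ)) (x : K), g (h x) = h (g x) := fun g h x ↦
    DFunLike.congr_fun (mul_comm' g h) x
  suffices H : ∀ S : Finset Gal(K/ℚ),
      ∃ y : K, y ≠ 0 ∧ σ y = -y ∧ ∀ g ∈ S, g y = y ∨ g y = -y by
    obtain ⟨y, h0, h1, h2⟩ := H Finset.univ
    exact ⟨y, h0, h1, fun g ↦ h2 g (Finset.mem_univ g)⟩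
  intro S
  induction S using Finset.induction_on with
  | empty =>
    obtain ⟨x, hx⟩ : ∃ x, σ x ≠ x := by
      by_contra! h
      exact hσ (AlgEquiv.ext h)
    -- Start in the -1 part of σ and project successively: for each further g, keep y + g y if it is
    -- nonzero, and otherwise g y = -y already.
    exact ⟨x - σ x, sub_ne_zero.mpr hx.symm, by rw [map_sub, hinv]; ring, by simp⟩
  | insert g S _ ih =>
    obtain ⟨y, hy0, hyσ, hyS⟩ := ih
    by_cases hg : y + g y = 0
    · refine ⟨y, hy0, hyσ, fun h hh ↦ ?_⟩
      rcases Finset.mem_insert.mp hh with rfl | hh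
      · right
        linear_combination hg
      · exact hyS h hh
    · refine ⟨y + g y, hg, by rw [map_add, hcomm, hyσ, map_neg]; ring, fun h hh ↦ ?_⟩
      rcases Finset.mem_insert.mp hh with rfl | hh
      · left
        rw [map_add, hinv, add_comm]
      · rw [map_add, hcomm h g]
        rcases hyS h hh with h1 | h1
        · left
          rw [h1]
        · right
          rw [h1, map_neg]
          ring

theorem Rat.exists_sq_mul_eq_squarefree {t : ℚ} (ht : t ≠ 0) :
    ∃ (r : ℚ) (u : ℤ), r ≠ 0 ∧ Squarefree u ∧ r ^ 2 * t = u := by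
  have hN : t.num * t.den ≠ 0 := mul_ne_zero (Rat.num_ne_zero.mpr ht) (by exact_mod_cast t.den_nz)
  obtain ⟨a, b, hab, ha⟩ := Nat.sq_mul_squarefree (t.num * t.den).natAbs
  have hb : b ≠ 0 := by
    rintro rfl
    rw [zero_pow two_ne_zero, zero_mul] at hab
    exact hN (Int.natAbs_eq_zero.mp hab.symm)
  have hb' : (b : ℚ) ≠ 0 := by exact_mod_cast hb
  have hden : (t.den : ℚ) ≠ 0 := by exact_mod_cast t.den_nz
  have ht' : t * t.den = t.num := Rat.mul_den_eq_num t
  rcases Int.natAbs_eq (t.num * t.den) with h | h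
  · refine ⟨t.den / b, a, by positivity, Int.squarefree_natCast.mpr ha, ?_⟩
    rw [← hab] at h
    have h' : (t.num : ℚ) * t.den = b ^ 2 * a := by exact_mod_cast h
    field_simp
    push_cast
    linear_combination (t.den : ℚ) * ht' + h'
  · refine ⟨t.den / b, -a, by positivity, ?_, ?_⟩
    · rw [← Int.squarefree_natAbs, Int.natAbs_neg, Int.natAbs_natCast]
      exact ha
    rw [← hab] at h
    have h' : (t.num : ℚ) * t.den = -(b ^ 2 * a) := by exact_mod_cast h
    field_simp
    push_cast
    linear_combination (t.den : ℚ) * ht' + h'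

theorem natCast_dvd_intCast_of_isIntegral {K : Type*} [Field K] [CharZero K] {l : ℕ} (hl : l ≠ 0)
    {a : ℤ} (h : IsIntegral ℤ ((a : K) / l)) : (l : ℤ) ∣ a := by
  have h1 : IsIntegral ℤ ((a : ℚ) / l) := by
    refine (isIntegral_algebraMap_iff (algebraMap ℚ K).injective).mp ?_
    simpa using h
  obtain ⟨z, hz⟩ := IsIntegrallyClosed.isIntegral_iff.mp h1
  refine ⟨z, ?_⟩
  have hl' : (l : ℚ) ≠ 0 := by exact_mod_cast hl
  have h3 : (a : ℚ) = l * z := by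
    have : (z : ℚ) = a / l := hz
    rw [this]
    field_simp
  exact_mod_cast h3

section

variable {K : Type*} [Field K] [NumberField K]

/-- If l divides y² = t and (l) is radical, then l divides y, so l² divides t, contradicting
squarefreeness. -/
theorem not_dvd_of_isRadical {l : ℕ} (hl : l.Prime) (hrad : (Ideal.span {(l : 𝓞 K)}).IsRadical)
    {y : K} {t : ℤ} (ht : Squarefree t) (hy : y ^ 2 = t) : ¬ (l : ℤ) ∣ t := by
  rintro ⟨u, rfl⟩
  have hint : IsIntegral ℤ y := IsIntegral.of_pow (n := 2) two_pos (by
    rw [hy]; exact isIntegral_algebraMap (x := (l * u : ℤ)))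
  let Y : 𝓞 K := ⟨y, hint⟩
  have hYy : (Y : K) = y := rfl
  have hY : Y ^ 2 = l * u := by
    apply RingOfIntegers.coe_injective
    change y ^ 2 = _
    rw [hy]
    simp
  have hmem : Y ∈ Ideal.span {(l : 𝓞 K)} := by
    apply hrad
    refine ⟨2, ?_⟩
    rw [hY]
    exact Ideal.mul_mem_right _ _ (Ideal.mem_span_singleton_self _)
  obtain ⟨Z, hZ⟩ := Ideal.mem_span_singleton.mp hmem
  have hl0 : (l : K) ≠ 0 := by exact_mod_cast hl.ne_zero
  have h1 : ((Z : K)) ^ 2 = (u : K) / l := by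
    have h3 : (Y : K) = l * Z := by
      rw [hZ]; push_cast; rfl
    have h4 : (Y : K) ^ 2 = l * u := by
      rw [hYy, hy]
      simp
    rw [h3] at h4
    field_simp
    apply mul_left_cancel₀ hl0
    linear_combination h4
  have h5 : (l : ℤ) ∣ u := natCast_dvd_intCast_of_isIntegral (K := K) hl.ne_zero (by
    rw [← h1]; exact (RingOfIntegers.isIntegral_coe Z).pow 2)
  have h6 := ht l (mul_dvd_mul_left _ h5)
  exact (Nat.prime_iff_prime_int.mp hl).not_isUnit h6

/-- Suppose t = 2u with u odd. Dividing √t by 1 + i gives Z with Z² = -iu. Since (Z - 1)² is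
divisible by 1 + i, radicality gives Z = 1 + (1 + i)W; squaring shows that E = (1 - iu)/2 is
integral. Then so is E(1 - E) = (1 + u²)/4, although 1 + u² ≡ 2 mod 4. -/
theorem two_not_dvd_of_isRadical {i : 𝓞 K} (hi : i ^ 2 = -1)
    (hrad : (Ideal.span {1 + i}).IsRadical)
    {y : K} {t : ℤ} (ht : Squarefree t) (hy : y ^ 2 = t) : ¬ (2 : ℤ) ∣ t := by
  rintro ⟨u, rfl⟩
  have hodd : ¬ (2 : ℤ) ∣ u := by
    intro h
    exact (Int.prime_two).not_isUnit (ht 2 (mul_dvd_mul_left _ h))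
  obtain ⟨v, hv⟩ : ∃ v : ℤ, u = 2 * v + 1 := ⟨u / 2, by omega⟩
  have hiK : (i : K) ^ 2 = -1 := congrArg RingOfIntegers.val hi
  have hi0 : (1 + (i : K)) ≠ 0 := by
    intro h
    have h1 : (i : K) = -1 := by linear_combination h
    rw [h1] at hiK
    norm_num at hiK
  set z := y / (1 + (i : K)) with hz
  have hz2 : z ^ 2 = -i * u := by
    rw [hz, div_pow, hy]
    push_cast
    rw [div_eq_iff (pow_ne_zero 2 hi0)]
    linear_combination (i * u + 2 * u) * hiK
  have hint : IsIntegral ℤ z := IsIntegral.of_pow (n := 2) two_pos (by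
    rw [hz2]
    exact (RingOfIntegers.isIntegral_coe i).neg.mul (isIntegral_algebraMap (x := u)))
  let Z : 𝓞 K := ⟨z, hint⟩
  have hZ : Z ^ 2 = -i * u := RingOfIntegers.coe_injective (by push_cast; exact hz2)
  have h2 : (1 + i) * (1 - i) = 2 := by linear_combination -hi
  have hmem : Z - 1 ∈ Ideal.span {1 + i} := by
    apply hrad
    refine ⟨2, ?_⟩
    rw [Ideal.mem_span_singleton]
    refine ⟨1 - (1 - i) * (Z + i * (v + 1)), ?_⟩
    have huv : (u : 𝓞 K) = 2 * v + 1 := by exact_mod_cast hv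
    rw [huv] at hZ
    linear_combination hZ + (Z + i * (v + 1)) * h2
  obtain ⟨W, hW⟩ := Ideal.mem_span_singleton.mp hmem
  -- the element `(1 - i u) / 2` is integral
  have h3 : 1 - i * u = 2 * (i * W ^ 2 + Z) := by
    linear_combination (Z - 1 + (1 + i) * W) * hW - hZ + W ^ 2 * hi
  set E := i * W ^ 2 + Z with hE
  have h4 : ((1 + u ^ 2 : ℤ) : K) / (4 : ℕ) = (E * (1 - E) : 𝓞 K) := by
    have h5 : (4 : 𝓞 K) * (E * (1 - E)) = 1 + u ^ 2 := by
      linear_combination (2 * E - 1 - i * u) * h3 - u ^ 2 * hi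
    have e4 : ((4 : 𝓞 K) : K) = 4 := map_ofNat (algebraMap (𝓞 K) K) 4
    have h6 := congrArg (algebraMap (𝓞 K) K) h5
    push_cast at h6 ⊢
    rw [div_eq_iff (by norm_num)]
    simp only [map_intCast, e4] at h6 ⊢
    linear_combination -h6
  have h7 := natCast_dvd_intCast_of_isIntegral (K := K) (l := 4) (by norm_num)
    (a := 1 + u ^ 2) (by rw [h4]; exact RingOfIntegers.isIntegral_coe _)
  rw [hv] at h7
  have h8 : 1 + (2 * v + 1) ^ 2 = 4 * (v ^ 2 + v) + 2 := by ring
  rw [h8] at h7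
  have : (4 : ℤ) ∣ 2 := by
    have := (Int.dvd_add_right (dvd_mul_right 4 (v ^ 2 + v))).mp h7
    exact this
  omega

end

theorem Nat.dvd_or_div_dvd_of_dvd_mul_prime {u P q : ℕ} (hq : q.Prime) (h : u ∣ P * q) :
    u ∣ P ∨ P * q / u ∣ P := by
  by_cases hqu : q ∣ u
  · right
    obtain ⟨v, rfl⟩ := hqu
    obtain ⟨w, hw⟩ := h
    rcases Nat.eq_zero_or_pos (q * v) with h0 | h0
    · rw [h0, Nat.div_zero]
      rw [h0, zero_mul] at hw
      rw [(Nat.mul_eq_zero.mp hw).resolve_right hq.ne_zero]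
    rw [hw, Nat.mul_div_cancel_left _ h0]
    refine ⟨v, Nat.eq_of_mul_eq_mul_right hq.pos ?_⟩
    rw [hw]
    ring
  · left
    exact (Nat.Coprime.dvd_mul_right ((hq.coprime_iff_not_dvd.mpr hqu).symm)).mp h

theorem Nat.mod_four_eq_one_of_dvd_mul_prime {p₁ p₂ m : ℕ} (hp₁ : p₁.Prime) (hp₂ : p₂.Prime)
    (h₁ : p₁ % 4 = 1) (h₂ : p₂ % 4 = 1) (h : m ∣ p₁ * p₂) : m % 4 = 1 := by
  obtain ⟨a, b, ha, hb, rfl⟩ := (Nat.dvd_mul).mp h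
  have ha' : a % 4 = 1 := by rcases (Nat.dvd_prime hp₁).mp ha with rfl | rfl <;> simp [h₁]
  have hb' : b % 4 = 1 := by rcases (Nat.dvd_prime hp₂).mp hb with rfl | rfl <;> simp [h₂]
  rw [Nat.mul_mod, ha', hb']

section Tower

variable {F k K : Type*} [Field F] [NumberField F] [Field k] [NumberField k] [Algebra F k]
  [Field K] [NumberField K] [Algebra k K] [Algebra F K] [IsScalarTower F k K]

theorem isMaximal_span_one_add [IsGalois ℚ F] (hF : Module.finrank ℚ F = 2) {j : 𝓞 F}
    (hj : j ^ 2 = -1) : (Ideal.span {1 + j}).IsMaximal := by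
  have hj' : (j : F) ^ 2 = -1 := congrArg RingOfIntegers.val hj
  obtain ⟨c, hc, hcj⟩ := exists_gal_apply_eq_neg hF hj'
  have hnorm : Algebra.norm ℤ (1 + j) = 2 := by
    have h1 : algebraMap ℚ F (Algebra.norm ℤ (1 + j) : ℤ) = 2 := by
      rw [Algebra.coe_norm_int, norm_eq_mul_of_finrank_eq_two hF hc]
      have : ((1 + j : 𝓞 F) : F) = 1 + j := by push_cast; rfl
      rw [this, map_add, map_one, hcj]
      linear_combination -hj'
    have h2 : ((Algebra.norm ℤ (1 + j) : ℤ) : F) = ((2 : ℤ) : F) := by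
      simpa using h1
    exact_mod_cast h2
  have hirr : Irreducible (Ideal.absNorm (Ideal.span {1 + j})) := by
    rw [Ideal.absNorm_span_singleton, hnorm]
    exact Nat.prime_two
  have hp := Ideal.isPrime_of_irreducible_absNorm hirr
  refine hp.isMaximal fun h0 ↦ ?_
  rw [h0, Ideal.absNorm_bot] at hirr
  exact hirr.ne_zero rfl

/-- The prime 2 ramifies already in ℚ(i), so the prime 1 + i has to be used in its place; it is
unramified above ℚ(i) because d is odd. -/
theorem isRadical_span_one_add [IsGalois ℚ F] (hF : Module.finrank ℚ F = 2)
    (hk : Module.finrank F k = 2) {i : F} (hi : i ^ 2 = -1) {d : ℕ} (hd : Squarefree d)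
    (hd4 : d % 4 = 3) {s : k} (hs : s ^ 2 = d)
    (hunr : ∀ 𝔭 : Ideal (𝓞 k), 𝔭.IsPrime → Algebra.IsUnramifiedIn (𝓞 K) 𝔭) :
    ∃ j : 𝓞 K, j ^ 2 = -1 ∧ (Ideal.span {1 + j}).IsRadical := by
  have hint : IsIntegral ℤ i :=
    IsIntegral.of_pow (n := 2) two_pos (by rw [hi]; exact isIntegral_one.neg)
  let j : 𝓞 F := ⟨i, hint⟩
  have hj : j ^ 2 = -1 := RingOfIntegers.coe_injective hi
  have hj' : algebraMap (𝓞 F) (𝓞 K) j ^ 2 = -1 := by rw [← map_pow, hj, map_neg, map_one]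
  refine ⟨algebraMap (𝓞 F) (𝓞 K) j, hj', ?_⟩
  have hmap : (Ideal.span {1 + j}).map (algebraMap (𝓞 F) (𝓞 K)) =
      Ideal.span {1 + algebraMap (𝓞 F) (𝓞 K) j} := by
    rw [Ideal.map_span, Set.image_singleton, map_add, map_one]
  rw [← hmap]
  have hmax := isMaximal_span_one_add hF hj
  refine Ideal.isRadical_map_of_isUnramifiedIn ?_ ?_
  · refine Ideal.map_ne_bot_of_ne_bot fun h0 ↦ ?_
    rw [Ideal.span_singleton_eq_bot] at h0
    have h1 : (2 : 𝓞 F) = 0 := by linear_combination (1 - j) * h0 + hj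
    exact two_ne_zero h1
  intro P hPp hover
  refine isUnramifiedAt_top_of_natCast_notMem hF hk hi hd hd4 hs hunr P fun hdP ↦ ?_
  have h1 : 1 + algebraMap (𝓞 F) (𝓞 K) j ∈ P := by
    have : 1 + j ∈ P.under (𝓞 F) := hover.over ▸ Ideal.mem_span_singleton_self _
    rw [Ideal.under_def, Ideal.mem_comap, map_add, map_one] at this
    exact this
  have h2 : (2 : 𝓞 K) ∈ P := by
    have h3 := P.mul_mem_right (1 - algebraMap (𝓞 F) (𝓞 K) j) h1
    have h4 : (1 + algebraMap (𝓞 F) (𝓞 K) j) * (1 - algebraMap (𝓞 F) (𝓞 K) j) = 2 := by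
      linear_combination -hj'
    rwa [h4] at h3
  obtain ⟨e, he⟩ : ∃ e : ℕ, d = 2 * e + 1 := ⟨d / 2, by omega⟩
  apply hPp.ne_top
  rw [Ideal.eq_top_iff_one]
  have h5 := P.sub_mem hdP (P.mul_mem_right (e : 𝓞 K) h2)
  rw [he] at h5
  push_cast at h5
  simpa using h5

/-- A quadratic extension contains a square root of a squarefree integer with prescribed prime
divisors. -/
theorem exists_sq_eq_intCast [IsAbelianGalois ℚ K] [IsGalois ℚ F] [IsGalois k K]
    (hF : Module.finrank ℚ F = 2) (hk : Module.finrank F k = 2)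
    {i : F} (hi : i ^ 2 = -1) {d : ℕ} (hd : Squarefree d) (hd4 : d % 4 = 3) {s : k}
    (hs : s ^ 2 = d)
    (hunr : ∀ 𝔭 : Ideal (𝓞 k), 𝔭.IsPrime → Algebra.IsUnramifiedIn (𝓞 K) 𝔭)
    (hinv : ∀ (g : Gal(K/ℚ)) (x : K), g (g x) = x) {σ : Gal(K/k)} (hσ : σ ≠ 1) :
    ∃ (y : K) (t : ℤ), y ^ 2 = t ∧ σ y = -y ∧ t.natAbs ∣ d := by
  have hσ' : AlgEquiv.restrictScalars ℚ σ ≠ 1 := by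
    intro h
    exact hσ (AlgEquiv.ext fun x ↦ DFunLike.congr_fun h x)
  obtain ⟨y, hy0, hyσ, hyg⟩ := exists_eigenvector hinv hσ'
  obtain ⟨t, ht⟩ : y ^ 2 ∈ Set.range (algebraMap ℚ K) := by
    refine (IsGalois.mem_range_algebraMap_iff_fixed (y ^ 2)).mpr fun g ↦ ?_
    rw [map_pow]
    rcases hyg g with h | h <;> rw [h]
    rw [neg_sq]
  have ht0 : t ≠ 0 := by
    rintro rfl
    rw [map_zero] at ht
    exact hy0 (pow_eq_zero_iff two_ne_zero |>.mp ht.symm)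
  obtain ⟨r, u, hr, hu, hru⟩ := Rat.exists_sq_mul_eq_squarefree ht0
  have hy2 : (algebraMap ℚ K r * y) ^ 2 = u := by
    rw [mul_pow, ← ht, ← map_pow, ← map_mul, hru, map_intCast]
  refine ⟨algebraMap ℚ K r * y, u, hy2, ?_, ?_⟩
  · have h1 : σ (algebraMap ℚ K r) = algebraMap ℚ K r :=
      (AlgEquiv.restrictScalars ℚ σ).commutes r
    have h2 : σ y = -y := hyσ
    rw [map_mul, h1, h2, mul_neg]
  have hsf : Squarefree u.natAbs := Int.squarefree_natAbs.mpr hu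
  rw [← Nat.prod_primeFactors_of_squarefree hsf, ← Nat.prod_primeFactors_of_squarefree hd]
  refine Finset.prod_dvd_prod_of_subset _ _ _ fun l hl ↦ ?_
  have hlp := Nat.prime_of_mem_primeFactors hl
  have hlu : (l : ℤ) ∣ u := Int.natCast_dvd.mpr (Nat.dvd_of_mem_primeFactors hl)
  by_contra hld
  have hld' : ¬ l ∣ d := fun h ↦ hld (Nat.mem_primeFactors.mpr ⟨hlp, h, hd.ne_zero⟩)
  -- A prime dividing u but not d would have to be ramified in K beyond what ℚ(i) accounts for.
  by_cases hl2 : l = 2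
  · subst hl2
    obtain ⟨j, hj, hrad⟩ := isRadical_span_one_add hF hk hi hd hd4 hs hunr
    exact two_not_dvd_of_isRadical hj hrad hu hy2 hlu
  · exact not_dvd_of_isRadical hlp
      (isRadical_span_natCast_of_prime hF hk hi hd hd4 hs hunr hlp hl2 hld') hu hy2 hlu

end Tower

section Frame

variable {F k K : Type*} [Field F] [NumberField F] [Field k] [Algebra F k]
  [Field K] [NumberField K] [Algebra k K] [Algebra F K] [IsScalarTower F k K]

/-- An automorphism of order two of `ℚ(√d, i)` over `ℚ(i)` sends `√d` to `-√d`. -/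
theorem gal_apply_eq_neg_of_sq_eq [NumberField k] [IsGalois ℚ F] [IsGalois F k]
    (hF : Module.finrank ℚ F = 2)
    (hk : Module.finrank F k = 2) {i : F} (hi : i ^ 2 = -1) {d : ℕ} (hd : Squarefree d)
    (hd1 : d ≠ 1) {s : k} (hs : s ^ 2 = d) {τ : Gal(k/F)} (hτ : τ ≠ 1) : τ s = -s := by
  have h1 : τ s ^ 2 = s ^ 2 := by rw [← map_pow, hs, map_natCast]
  refine (sq_eq_sq_iff_eq_or_eq_neg.mp h1).resolve_left fun h ↦ ?_
  obtain ⟨y, rfl⟩ := mem_range_of_fixed hk hτ h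
  refine not_gaussian_of_sq_eq hF hi hd hd1 y ((algebraMap F k).injective ?_)
  rw [map_pow, hs, map_natCast]

theorem gal_apply_apply_algebraMap [IsGalois ℚ F] [IsGalois F k] (hF : Module.finrank ℚ F = 2)
    (hk : Module.finrank F k = 2) {i : F} (hi : i ^ 2 = -1) {d : ℕ} (hd : Squarefree d)
    (hd1 : d ≠ 1) {s : k} (hs : s ^ 2 = d) (g : Gal(K/ℚ)) (x : k) :
    g (g (algebraMap k K x)) = algebraMap k K x := by
  have hsq : ∀ (y : K) (n : ℤ), y ^ 2 = n → g (g y) = y := by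
    intro y n hy
    have h1 : g y ^ 2 = y ^ 2 := by rw [← map_pow, hy, map_intCast]
    rcases sq_eq_sq_iff_eq_or_eq_neg.mp h1 with h | h
    · rw [h, h]
    · rw [h, map_neg, h, neg_neg]
  let g₂ : K →ₐ[ℚ] K := (g * g : Gal(K/ℚ))
  let f₁ : F →ₐ[ℚ] K := g₂.comp (Algebra.algHom ℚ F K)
  have hf₁ : f₁ = Algebra.algHom ℚ F K := by
    refine AlgHom.ext_of_adjoin_eq_top (s := {i})
      (adjoin_singleton_eq_top_of_finrank_eq_two hF (not_rat_of_sq_eq_neg_one hi)) ?_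
    rintro _ rfl
    refine hsq _ (-1) ?_
    change algebraMap F K _ ^ 2 = _
    rw [← map_pow, hi, map_neg, map_one]
    simp
  let g₃ : K →ₐ[F] K := { g₂ with commutes' := fun r ↦ DFunLike.congr_fun hf₁ r }
  have hf₂ : g₃.comp (Algebra.algHom F k K) = Algebra.algHom F k K := by
    refine AlgHom.ext_of_adjoin_eq_top (s := {s})
      (adjoin_singleton_eq_top_of_finrank_eq_two hk fun y hy ↦ ?_) ?_
    · refine not_gaussian_of_sq_eq hF hi hd hd1 y ((algebraMap F k).injective ?_)
      rw [map_pow, hy, hs, map_natCast]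
    · rintro _ rfl
      refine hsq _ d ?_
      change algebraMap k K _ ^ 2 = _
      rw [← map_pow, hs]
      simp
  exact DFunLike.congr_fun hf₂ x

/-- The multiquadratic structure of an unramified quadratic extension of `ℚ(√(p₁p₂q), i)` which is
abelian over `ℚ`. -/
theorem exists_multiquadraticFrame [NumberField k] [IsAbelianGalois ℚ K] [IsGalois ℚ F]
    [IsGalois F k]
    [IsGalois F K] [IsGalois k K] (hF : Module.finrank ℚ F = 2) (hk : Module.finrank F k = 2)
    (hK : Module.finrank k K = 2) {i : F} (hi : i ^ 2 = -1) {p₁ p₂ q : ℕ} (hp₁ : p₁.Prime)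
    (hp₂ : p₂.Prime) (hq : q.Prime) (h₁ : p₁ % 4 = 1) (h₂ : p₂ % 4 = 1) (h₃ : q % 4 = 3)
    (hd : Squarefree (p₁ * p₂ * q)) {s : k} (hs : s ^ 2 = (p₁ * p₂ * q : ℕ))
    (hunr : ∀ 𝔭 : Ideal (𝓞 k), 𝔭.IsPrime → Algebra.IsUnramifiedIn (𝓞 K) 𝔭)
    {σ : Gal(K/k)} (hσ : σ ≠ 1) {τ : Gal(k/F)} (hτ : τ ≠ 1) :
    ∃ m n : ℕ, m * n = p₁ * p₂ * q ∧ m % 4 = 1 ∧ m ≠ 1 ∧ ∃ f : MultiquadraticFrame K m n,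
      f.i = algebraMap F K i ∧ (∀ x, f.σ x = σ x) ∧
      (∀ x, f.τ (algebraMap k K x) = algebraMap k K (τ x)) := by
  set d := p₁ * p₂ * q with hdef
  have hd4 : d % 4 = 3 := by
    rw [hdef, Nat.mul_mod, Nat.mul_mod p₁, h₁, h₂, h₃]
  have hd1 : d ≠ 1 := by omega
  have hinv := apply_apply_eq_of_isUnramified hunr
    (gal_apply_apply_algebraMap (K := K) hF hk hi hd hd1 hs)
  have hcomm : ∀ (g h : Gal(K/ℚ)) (x : K), g (h x) = h (g x) := fun g h x ↦
    DFunLike.congr_fun (mul_comm' g h) x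
  have hi2 : algebraMap F K i ^ 2 = -1 := by rw [← map_pow, hi, map_neg, map_one]
  set s' := algebraMap k K s with hs'
  have hs2 : s' ^ 2 = d := by rw [hs', ← map_pow, hs, map_natCast]
  have hd0 : (d : K) ≠ 0 := by exact_mod_cast hd.ne_zero
  have hs0 : s' ≠ 0 := by
    intro h
    rw [h, zero_pow two_ne_zero] at hs2
    exact hd0 hs2.symm
  have hσi : σ (algebraMap F K i) = algebraMap F K i := by
    rw [IsScalarTower.algebraMap_apply F k K, σ.commutes]
  have hσs : σ s' = s' := σ.commutes s
  -- the square root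
  obtain ⟨a, m, hmd, ha, hσa⟩ : ∃ (a : K) (m : ℕ), m ∣ p₁ * p₂ ∧ a ^ 2 = m ∧ σ a = -a := by
    obtain ⟨y, t, hyt, hσy, htd⟩ := exists_sq_eq_intCast hF hk hi hd hd4 hs hunr hinv hσ
    -- Since i is fixed by σ, multiplying y by it changes the sign of t where necessary.
    obtain ⟨y, hyt, hσy⟩ : ∃ y : K, y ^ 2 = t.natAbs ∧ σ y = -y := by
      rcases Int.natAbs_eq t with h | h
      · refine ⟨y, ?_, hσy⟩
        rw [hyt, h]
        simp
      · refine ⟨algebraMap F K i * y, ?_, by rw [map_mul, hσi, hσy, mul_neg]⟩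
        rw [mul_pow, hi2, hyt, h]
        simp
    -- Dividing √d, which lies in k, by y trades |t| for d/|t|. One of the two is prime to q, hence
    -- divides p₁p₂ and is 1 mod 4.
    rcases Nat.dvd_or_div_dvd_of_dvd_mul_prime hq htd with h | h
    · exact ⟨y, _, h, hyt, hσy⟩
    · have hy0 : y ≠ 0 := by
        rintro rfl
        rw [zero_pow two_ne_zero] at hyt
        have : t.natAbs = 0 := by exact_mod_cast hyt.symm
        rw [this] at htd
        exact hd.ne_zero (zero_dvd_iff.mp htd)
      refine ⟨s' / y, _, h, ?_, by rw [map_div₀, hσs, hσy, div_neg]⟩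
      rw [div_pow, hs2, hyt, Nat.cast_div htd]
      rw [← hyt]
      exact pow_ne_zero 2 hy0
  have hm4 : m % 4 = 1 := Nat.mod_four_eq_one_of_dvd_mul_prime hp₁ hp₂ h₁ h₂ hmd
  have ha0 : a ≠ 0 := by
    rintro rfl
    rw [zero_pow two_ne_zero] at ha
    have : m = 0 := by exact_mod_cast ha.symm
    omega
  have hm1 : m ≠ 1 := by
    rintro rfl
    have h1 : a = 1 ∨ a = -1 := mul_self_eq_one_iff.mp (by rw [← sq, ha, Nat.cast_one])
    have h2 : σ a = a := by rcases h1 with rfl | rfl <;> simp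
    rw [hσa] at h2
    exact ha0 (self_eq_neg.mp h2.symm)
  obtain ⟨n, hn⟩ : m ∣ d := hmd.trans (dvd_mul_right _ _)
  have hmK : (m : K) ≠ 0 := by
    rw [← ha]
    exact pow_ne_zero 2 ha0
  set b := s' / a with hbdef
  have hab : a * b = s' := by rw [hbdef]; field_simp
  have hb : b ^ 2 = n := by
    rw [hbdef, div_pow, hs2, ha, hn]
    push_cast
    field_simp
  have hσb : σ b = -b := by rw [hbdef, map_div₀, hσs, hσa, div_neg]
  have hb0 : b ≠ 0 := by
    rw [hbdef]
    exact div_ne_zero hs0 ha0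
  -- lifts of automorphisms
  have hσi' : (AlgEquiv.restrictScalars ℚ σ) (algebraMap F K i) = algebraMap F K i := hσi
  have hτs := gal_apply_eq_neg_of_sq_eq hF hk hi hd hd1 hs hτ
  obtain ⟨t, htk, hta⟩ : ∃ t : Gal(K/F), (∀ x, t (algebraMap k K x) = algebraMap k K (τ x)) ∧
      t a = a := by
    obtain ⟨t, ht⟩ := AlgEquiv.restrictNormalHom_surjective (F := F) (K₁ := k) K τ
    have htk : ∀ x, t (algebraMap k K x) = algebraMap k K (τ x) := fun x ↦ by
      rw [← ht]
      exact (AlgEquiv.restrictNormal_commutes t k x).symm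
    have h1 : t a ^ 2 = a ^ 2 := by rw [← map_pow, ha, map_natCast]
    rcases sq_eq_sq_iff_eq_or_eq_neg.mp h1 with h | h
    · exact ⟨t, htk, h⟩
    -- Composing a lift with σ gives another lift of τ and flips the sign of a.
    · refine ⟨AlgEquiv.restrictScalars F σ * t, fun x ↦ ?_, ?_⟩
      · change σ (t (algebraMap k K x)) = _
        rw [htk, σ.commutes]
      · change σ (t a) = a
        rw [h, map_neg, hσa, neg_neg]
  have hts : t s' = -s' := by rw [hs', htk, hτs, map_neg]
  have htb : t b = -b := by rw [hbdef, map_div₀, hts, hta, neg_div]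
  obtain ⟨c₀, hc₀, hc₀i⟩ := exists_gal_apply_eq_neg hF hi
  obtain ⟨c, hcF, hca, hcb⟩ : ∃ c : Gal(K/ℚ),
      (∀ x, c (algebraMap F K x) = algebraMap F K (c₀ x)) ∧ c a = a ∧ c b = b := by
    obtain ⟨c, hc⟩ := AlgEquiv.restrictNormalHom_surjective (F := ℚ) (K₁ := F) K c₀
    have hcF : ∀ x, c (algebraMap F K x) = algebraMap F K (c₀ x) := fun x ↦ by
      rw [← hc]
      exact (AlgEquiv.restrictNormal_commutes c F x).symm
    have key : ∃ c : Gal(K/ℚ),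
        (∀ x, c (algebraMap F K x) = algebraMap F K (c₀ x)) ∧ c a = a := by
      have h1 : c a ^ 2 = a ^ 2 := by rw [← map_pow, ha, map_natCast]
      rcases sq_eq_sq_iff_eq_or_eq_neg.mp h1 with h | h
      · exact ⟨c, hcF, h⟩
      · refine ⟨AlgEquiv.restrictScalars ℚ σ * c, fun x ↦ ?_, ?_⟩
        · change σ (c (algebraMap F K x)) = _
          rw [hcF, IsScalarTower.algebraMap_apply F k K, σ.commutes]
        · change σ (c a) = a
          rw [h, map_neg, hσa, neg_neg]
    obtain ⟨c, hcF, hca⟩ := key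
    have h1 : c b ^ 2 = b ^ 2 := by rw [← map_pow, hb, map_natCast]
    rcases sq_eq_sq_iff_eq_or_eq_neg.mp h1 with h | h
    · exact ⟨c, hcF, hca, h⟩
    -- After σ has corrected the sign at a, the automorphism t corrects the sign at b, as it fixes
    -- both a and F.
    · refine ⟨AlgEquiv.restrictScalars ℚ t * c, fun x ↦ ?_, ?_, ?_⟩
      · change t (c (algebraMap F K x)) = _
        rw [hcF, t.commutes]
      · change t (c a) = a
        rw [hca, hta]
      · change t (c b) = b
        rw [h, map_neg, htb, neg_neg]
  let f : MultiquadraticFrame K m n :=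
    { i := algebraMap F K i
      a := a
      b := b
      σ := (σ : K →+* K)
      τ := (t : K →+* K)
      c := (c : K →+* K)
      i_sq := hi2
      a_sq := ha
      b_sq := hb
      σ_i := hσi
      σ_a := hσa
      σ_b := hσb
      τ_i := t.commutes i
      τ_a := hta
      τ_b := htb
      c_i := by
        change c (algebraMap F K i) = _
        rw [hcF, hc₀i, map_neg]
      c_a := hca
      c_b := hcb
      σ_σ := hinv (AlgEquiv.restrictScalars ℚ σ)
      τ_τ := hinv (AlgEquiv.restrictScalars ℚ t)
      c_c := hinv c
      σ_τ := hcomm (AlgEquiv.restrictScalars ℚ σ) (AlgEquiv.restrictScalars ℚ t)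
      σ_c := hcomm (AlgEquiv.restrictScalars ℚ σ) c
      τ_c := hcomm (AlgEquiv.restrictScalars ℚ t) c
      fixed := by
        intro x h1 h2 h3
        obtain ⟨y, rfl⟩ := mem_range_of_fixed hK hσ h1
        have h2' : t (algebraMap k K y) = algebraMap k K y := h2
        rw [htk] at h2'
        obtain ⟨z, rfl⟩ := mem_range_of_fixed hk hτ ((algebraMap k K).injective h2')
        have h3' : c (algebraMap k K (algebraMap F k z)) = algebraMap k K (algebraMap F k z) := h3
        rw [← IsScalarTower.algebraMap_apply, hcF] at h3'
        obtain ⟨r, rfl⟩ := mem_range_of_fixed hF hc₀ ((algebraMap F K).injective h3')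
        exact ⟨r, by simp⟩ }
  refine ⟨m, n, hn.symm, hm4, hm1, f, rfl, fun _ ↦ rfl, htk⟩

end Frame

/-! ### Complex conjugation and roots of unity in multiquadratic fields -/

namespace MultiquadraticFrame

variable {K : Type*} [Field K] {m n : ℕ}

/-- A multiquadratic field is generated by its three square roots. -/
theorem eq_top_of_mem [CharZero K] (f : MultiquadraticFrame K m n) (hm : m ≠ 0) (hn : n ≠ 0)
    {S : Subfield K} (hi : f.i ∈ S) (ha : f.a ∈ S) (hb : f.b ∈ S) : S = ⊤ := by
  have hi0 : f.i ≠ 0 := fun h ↦ by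
    have := f.i_sq
    rw [h] at this
    norm_num at this
  have ha0 : f.a ≠ 0 := fun h ↦ by
    have := f.a_sq
    rw [h, zero_pow two_ne_zero] at this
    exact hm (by exact_mod_cast this.symm)
  have hb0 : f.b ≠ 0 := fun h ↦ by
    have := f.b_sq
    rw [h, zero_pow two_ne_zero] at this
    exact hn (by exact_mod_cast this.symm)
  have split : ∀ {x y e : K}, e ≠ 0 → e ∈ S → x + y ∈ S → (x - y) / e ∈ S → x ∈ S := by
    intro x y e he heS h1 h2
    have h3 : x = ((x + y) + (x - y) / e * e) / 2 := by
      field_simp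
      ring
    rw [h3]
    exact S.div_mem (S.add_mem h1 (S.mul_mem h2 heS)) (ofNat_mem S 2)
  have step1 : ∀ x, f.c x = x → f.τ x = x → x ∈ S := by
    intro x hc ht
    have key : ∀ z, f.c z = z → f.τ z = z → f.σ z = z → z ∈ S := by
      intro z h1 h2 h3
      obtain ⟨r, rfl⟩ := f.fixed z h3 h2 h1
      exact SubfieldClass.ratCast_mem S r
    refine split ha0 ha (y := f.σ x) (key _ ?_ ?_ ?_) (key _ ?_ ?_ ?_) <;>
      simp only [map_add, map_sub, map_div₀, f.σ_σ, ← f.σ_c, ← f.σ_τ, hc, ht, f.c_a, f.τ_a, f.σ_a,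
        add_comm]
    rw [div_neg, ← neg_div, neg_sub]
  have step2 : ∀ x, f.c x = x → x ∈ S := by
    intro x hc
    refine split hb0 hb (y := f.τ x) (step1 _ ?_ ?_) (step1 _ ?_ ?_) <;>
      simp only [map_add, map_sub, map_div₀, f.τ_τ, ← f.τ_c, hc, f.c_b, f.τ_b, add_comm]
    rw [div_neg, ← neg_div, neg_sub]
  rw [eq_top_iff]
  intro x _
  refine split hi0 hi (y := f.c x) (step2 _ ?_) (step2 _ ?_) <;>
    simp only [map_add, map_sub, map_div₀, f.c_c, f.c_i, add_comm]
  rw [div_neg, ← neg_div, neg_sub]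

theorem conj_eq_self_of_sq_eq_natCast {z : ℂ} {m : ℕ} (h : z ^ 2 = m) :
    (starRingEnd ℂ) z = z := by
  have h1 : z ^ 2 = ((Real.sqrt m : ℝ) : ℂ) ^ 2 := by
    rw [h, ← Complex.ofReal_pow, Real.sq_sqrt m.cast_nonneg, Complex.ofReal_natCast]
  rcases sq_eq_sq_iff_eq_or_eq_neg.mp h1 with rfl | rfl
  · exact Complex.conj_ofReal _
  · rw [map_neg, Complex.conj_ofReal]

/-- The automorphism `c` is complex conjugation. -/
theorem map_c_eq_conj [CharZero K] (f : MultiquadraticFrame K m n) (hm : m ≠ 0) (hn : n ≠ 0)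
    (φ : K →+* ℂ) (x : K) : φ (f.c x) = (starRingEnd ℂ) (φ x) := by
  have hi : (starRingEnd ℂ) (φ f.i) = -φ f.i := by
    have h1 : φ f.i ^ 2 = Complex.I ^ 2 := by
      rw [← map_pow, f.i_sq, map_neg, map_one, Complex.I_sq]
    rcases sq_eq_sq_iff_eq_or_eq_neg.mp h1 with h | h <;> rw [h] <;> simp
  have ha : (starRingEnd ℂ) (φ f.a) = φ f.a :=
    conj_eq_self_of_sq_eq_natCast (m := m) (by rw [← map_pow, f.a_sq, map_natCast])
  have hb : (starRingEnd ℂ) (φ f.b) = φ f.b :=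
    conj_eq_self_of_sq_eq_natCast (m := n) (by rw [← map_pow, f.b_sq, map_natCast])
  have h := f.eq_top_of_mem hm hn (S := RingHom.eqLocusField (φ.comp f.c) ((starRingEnd ℂ).comp φ))
    (show φ (f.c f.i) = (starRingEnd ℂ) (φ f.i) by rw [f.c_i, map_neg, hi])
    (show φ (f.c f.a) = (starRingEnd ℂ) (φ f.a) by rw [f.c_a, ha])
    (show φ (f.c f.b) = (starRingEnd ℂ) (φ f.b) by rw [f.c_b, hb])
  exact (h ▸ Subfield.mem_top x : x ∈ RingHom.eqLocusField (φ.comp f.c) ((starRingEnd ℂ).comp φ))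

theorem isIntegral_map {K : Type*} [Field K] (g : K →+* K) {x : K} (hx : IsIntegral ℤ x) :
    IsIntegral ℤ (g x) :=
  hx.map (g.toIntAlgHom)

/-- The quotient of a unit by its complex conjugate is a root of unity. -/
theorem exists_pow_div_eq_one [NumberField K] (f : MultiquadraticFrame K m n) (hm : m ≠ 0)
    (hn : n ≠ 0) {u : K} (hu : IsIntegral ℤ u) (hui : IsIntegral ℤ u⁻¹) (hu0 : u ≠ 0) :
    ∃ N : ℕ, N ≠ 0 ∧ (f.c u / u) ^ N = 1 := by
  have hint : IsIntegral ℤ (f.c u / u) := by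
    rw [div_eq_mul_inv]
    exact (isIntegral_map f.c hu).mul hui
  -- Kronecker's theorem: because c is complex conjugation in every embedding, the quotient has
  -- absolute value 1 everywhere.
  obtain ⟨N, hN, h⟩ := NumberField.Embeddings.pow_eq_one_of_norm_eq_one K ℂ hint (fun φ ↦ by
    rw [map_div₀, f.map_c_eq_conj hm hn, norm_div, RCLike.norm_conj, div_self]
    rw [norm_ne_zero_iff]
    exact (map_ne_zero φ).mpr hu0)
  exact ⟨N, hN.ne', h⟩

/-- Rational squares of K are, up to rational squares, products of -1, m and n, which have even
valuation at 2. This excludes eighth roots of unity, since ζ + ζ⁻¹ would be a square root of 2. -/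
theorem sq_ne_two [CharZero K] (f : MultiquadraticFrame K m n) (hmn : Odd (m * n)) (x : K) :
    x ^ 2 ≠ 2 := by
  intro hx
  have hm : m ≠ 0 := by rintro rfl; simp at hmn
  have hn : n ≠ 0 := by rintro rfl; simp at hmn
  obtain ⟨ε, α, β, r, h⟩ := f.exists_of_sq_eq_ratCast hm hn (x := x) (t := 2) (by
    rw [hx]; norm_num)
  have hr : r ≠ 0 := by
    rintro rfl
    norm_num at h
  have : Fact (Nat.Prime 2) := ⟨Nat.prime_two⟩
  have h1 := congrArg (padicValRat 2) h
  have hodd : ∀ a : ℕ, Odd a → padicValRat 2 (a : ℚ) = 0 := by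
    intro a ha
    rw [padicValRat.of_nat, padicValNat.eq_zero_of_not_dvd]
    · rfl
    · rw [← even_iff_two_dvd, Nat.not_even_iff_odd]
      exact ha
  have hmQ : (m : ℚ) ≠ 0 := by exact_mod_cast hm
  have hnQ : (n : ℚ) ≠ 0 := by exact_mod_cast hn
  have hneg : padicValRat 2 (-1 : ℚ) = 0 := by rw [padicValRat.neg, padicValRat.one]
  have h2 : padicValRat 2 (2 : ℚ) = 1 := by
    have := padicValRat.self (p := 2) one_lt_two
    simpa using this
  rw [padicValRat.mul (by positivity) (by positivity),
    padicValRat.mul (by simp [hmQ]) (by positivity), padicValRat.mul (by simp) (by positivity),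
    padicValRat.pow, padicValRat.pow, padicValRat.pow, padicValRat.pow, hneg,
    hodd m (Nat.odd_mul.mp hmn).1,
    hodd n (Nat.odd_mul.mp hmn).2, h2] at h1
  simp only [mul_zero, zero_add, Nat.cast_ofNat] at h1
  omega

/-- Roots of unity of `2`-power order are fourth roots of unity. -/
theorem pow_four_eq_one [CharZero K] (f : MultiquadraticFrame K m n) (hmn : Odd (m * n)) {w : K}
    (l : ℕ) (h : w ^ 2 ^ l = 1) : w ^ 4 = 1 := by
  induction l with
  | zero => rw [pow_zero, pow_one] at h; rw [h, one_pow]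
  | succ l ih =>
    rw [pow_succ, pow_mul] at h
    rcases mul_self_eq_one_iff.mp ((sq _).symm.trans h) with h1 | h1
    · exact ih h1
    rcases lt_or_ge l 2 with hl | hl
    · interval_cases l
      · rw [pow_zero, pow_one] at h1
        rw [h1]
        norm_num
      · rw [pow_one] at h1
        calc w ^ 4 = (w ^ 2) ^ 2 := by ring
          _ = 1 := by rw [h1]; norm_num
    · exfalso
      obtain ⟨l, rfl⟩ := Nat.exists_eq_add_of_le' hl
      have h4 : (w ^ 2 ^ l) ^ 4 = -1 := by
        rw [← pow_mul, ← h1]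
        congr 1
        ring
      set ζ := w ^ 2 ^ l
      have hζ : ζ ≠ 0 := by
        intro h0
        rw [h0] at h4
        norm_num at h4
      refine f.sq_ne_two hmn (ζ + ζ⁻¹) ?_
      field_simp
      linear_combination h4

/-- There are no units `u`, `u'` of norm `i` over the two fields fixed by `τ` and `σ τ` with the
same norm over the field fixed by `σ`, if no unit of the latter has norm `± i`. -/
theorem false_of_unit_pair [NumberField K] (f : MultiquadraticFrame K m n)
    (hsf : Squarefree (m * n)) (hodd : Odd (m * n)) (hm : m % 4 = 1) (hm1 : m ≠ 1) {u u' : K}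
    (hu : IsIntegral ℤ u) (hui : IsIntegral ℤ u⁻¹) (hu' : IsIntegral ℤ u')
    (hui' : IsIntegral ℤ u'⁻¹) (h1 : u * f.τ u = f.i) (h2 : u' * f.σ (f.τ u') = f.i)
    (h3 : u * f.σ u = u' * f.σ u')
    (hk : ∀ x, IsIntegral ℤ x → IsIntegral ℤ x⁻¹ → f.σ x = x →
      x * f.τ x ≠ f.i ∧ x * f.τ x ≠ -f.i) : False := by
  have hm0 : m ≠ 0 := by rintro rfl; simp at hodd
  have hn0 : n ≠ 0 := by rintro rfl; simp at hodd
  have hi0 : f.i ≠ 0 := fun h ↦ by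
    have := f.i_sq
    rw [h] at this
    norm_num at this
  have hu0 : u ≠ 0 := by rintro rfl; rw [zero_mul] at h1; exact hi0 h1.symm
  have hu0' : u' ≠ 0 := by rintro rfl; rw [zero_mul] at h2; exact hi0 h2.symm
  obtain ⟨N, hN0, hN⟩ := f.exists_pow_div_eq_one hm0 hn0 hu hui hu0
  obtain ⟨N', hN0', hN'⟩ := f.exists_pow_div_eq_one hm0 hn0 hu' hui' hu0'
  -- Raising u and u' to a suitable odd power kills the odd part of the roots of unity c(u)/u and
  -- c(u')/u'. The exponent is M² rather than M because an odd square is 1 mod 4, so i is left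
  -- unchanged.
  obtain ⟨l, M, hM, hNM⟩ := Nat.exists_eq_two_pow_mul_odd (mul_ne_zero hN0 hN0')
  have hroot : ∀ v : K, v ^ (N * N') = 1 → (v ^ (M ^ 2)) ^ 4 = 1 := by
    intro v hv
    refine f.pow_four_eq_one hodd l ?_
    rw [← pow_mul, show M ^ 2 * 2 ^ l = 2 ^ l * M * M by ring, ← hNM, pow_mul, hv, one_pow]
  have hiM : f.i ^ (M ^ 2) = f.i := by
    obtain ⟨a, rfl⟩ := hM
    rw [show (2 * a + 1) ^ 2 = 2 * (2 * (a ^ 2 + a)) + 1 by ring, pow_succ, pow_mul, f.i_sq,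
      pow_mul]
    norm_num
  refine f.no_unit_pair hsf hm hm1 (u := u ^ M ^ 2) (u' := u' ^ M ^ 2)
    (ρ := (f.c u / u) ^ M ^ 2) (ρ' := (f.c u' / u') ^ M ^ 2) (hu.pow _) ?_ (hu'.pow _)
    (hroot _ (by rw [pow_mul, hN, one_pow])) ?_
    (hroot _ (by rw [mul_comm, pow_mul, hN', one_pow])) ?_ ?_ ?_ ?_ hk
  · rw [← inv_pow]
    exact hui.pow _
  · rw [map_pow, ← mul_pow, div_mul_cancel₀ _ hu0]
  · rw [map_pow, ← mul_pow, div_mul_cancel₀ _ hu0']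
  · rw [map_pow, ← mul_pow, h1, hiM]
  · rw [map_pow, map_pow, ← mul_pow, h2, hiM]
  · rw [map_pow, map_pow, ← mul_pow, ← mul_pow, h3]

end MultiquadraticFrame

/-! ### The ring of integers of `ℚ(i)` -/

section GaussianIntegers

variable {F : Type*} [Field F] [NumberField F]

theorem exists_intCast_of_isIntegral_of_rat {K : Type*} [Field K] [CharZero K] {x : K}
    (hx : IsIntegral ℤ x) {r : ℚ} (hr : algebraMap ℚ K r = x) : ∃ a : ℤ, x = a := by
  have h1 : IsIntegral ℤ r := by
    refine (isIntegral_algebraMap_iff (algebraMap ℚ K).injective).mp ?_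
    rwa [hr]
  obtain ⟨a, ha⟩ := IsIntegrallyClosed.isIntegral_iff.mp h1
  exact ⟨a, by rw [← hr, ← ha]; simp⟩

/-- With trace A, norm N and B = (c x - x)j, one has 2x = A + Bj and A² + B² = 4N, which forces A
and B to be even. -/
theorem exists_eq_add_mul_of_sq_eq_neg_one [IsGalois ℚ F] (hF : Module.finrank ℚ F = 2)
    {j : 𝓞 F} (hj : j ^ 2 = -1) (x : 𝓞 F) : ∃ a b : ℤ, x = a + b * j := by
  have hj' : (j : F) ^ 2 = -1 := congrArg RingOfIntegers.val hj
  obtain ⟨c, hc, hcj⟩ := exists_gal_apply_eq_neg hF hj'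
  have hcc : ∀ y, c (c y) = y := fun y ↦
    DFunLike.congr_fun (sq_eq_one_of_finrank_eq_two hF c) y
  have hx : IsIntegral ℤ (x : F) := RingOfIntegers.isIntegral_coe x
  have hcx : IsIntegral ℤ (c (x : F)) := RingOfIntegers.isIntegral_coe (c • x)
  have hji : IsIntegral ℤ (j : F) := RingOfIntegers.isIntegral_coe j
  obtain ⟨A, hA⟩ : ∃ A : ℤ, (x : F) + c x = A := by
    obtain ⟨r, hr⟩ := mem_range_of_fixed hF hc (x := (x : F) + c x) (by
      rw [map_add, hcc, add_comm])
    exact exists_intCast_of_isIntegral_of_rat (hx.add hcx) hr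
  obtain ⟨B, hB⟩ : ∃ B : ℤ, ((c (x : F)) - x) * j = B := by
    obtain ⟨r, hr⟩ := mem_range_of_fixed hF hc (x := ((c (x : F)) - x) * j) (by
      rw [map_mul, map_sub, hcc, hcj]; ring)
    exact exists_intCast_of_isIntegral_of_rat ((hcx.sub hx).mul hji) hr
  obtain ⟨N, hN⟩ : ∃ N : ℤ, (x : F) * c x = N := by
    obtain ⟨r, hr⟩ := mem_range_of_fixed hF hc (x := (x : F) * c x) (by
      rw [map_mul, hcc, mul_comm])
    exact exists_intCast_of_isIntegral_of_rat (hx.mul hcx) hr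
  have hABN : A ^ 2 + B ^ 2 = 4 * N := by
    have : ((A ^ 2 + B ^ 2 : ℤ) : F) = ((4 * N : ℤ) : F) := by
      push_cast
      rw [← hA, ← hB, ← hN]
      linear_combination (c (x : F) - x) ^ 2 * hj'
    exact_mod_cast this
  have h2x : 2 * (x : F) = A + B * j := by
    rw [← hA, ← hB]
    linear_combination (x - c (x : F)) * hj'
  have hmod : A % 2 = 0 ∧ B % 2 = 0 := by
    have h1 : (A ^ 2 + B ^ 2) % 4 = 0 := by omega
    rcases Int.even_or_odd' A with ⟨a, rfl | rfl⟩ <;>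
      rcases Int.even_or_odd' B with ⟨b, rfl | rfl⟩ <;>
      ring_nf at h1 <;> omega
  obtain ⟨a, rfl⟩ : (2 : ℤ) ∣ A := Int.dvd_of_emod_eq_zero hmod.1
  obtain ⟨b, rfl⟩ : (2 : ℤ) ∣ B := Int.dvd_of_emod_eq_zero hmod.2
  refine ⟨a, b, ?_⟩
  apply RingOfIntegers.coe_injective
  push_cast at h2x ⊢
  simp only [map_intCast]
  apply mul_left_cancel₀ (two_ne_zero (α := F))
  linear_combination h2x

/-- The ring of integers of `ℚ(i)` is the ring of Gaussian integers. -/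
theorem exists_gaussianInt_equiv [IsGalois ℚ F] (hF : Module.finrank ℚ F = 2)
    {j : 𝓞 F} (hj : j ^ 2 = -1) :
    ∃ e : GaussianInt ≃+* 𝓞 F, ∀ z, e z = z.re + z.im * j := by
  let φ : GaussianInt →+* 𝓞 F := Zsqrtd.lift ⟨j, by rw [← sq, hj]; simp⟩
  have hφ : ∀ z, φ z = z.re + z.im * j := fun z ↦ rfl
  have hinj : Function.Injective φ := by
    refine Zsqrtd.lift_injective _ fun n ↦ ?_
    nlinarith [mul_self_nonneg n]
  have hsurj : Function.Surjective φ := by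
    intro x
    obtain ⟨a, b, h⟩ := exists_eq_add_mul_of_sq_eq_neg_one hF hj x
    exact ⟨⟨a, b⟩, by rw [hφ, h]⟩
  exact ⟨RingEquiv.ofBijective φ ⟨hinj, hsurj⟩, hφ⟩

theorem isPrincipalIdealRing_of_sq_eq_neg_one [IsGalois ℚ F] (hF : Module.finrank ℚ F = 2)
    {j : 𝓞 F} (hj : j ^ 2 = -1) : IsPrincipalIdealRing (𝓞 F) := by
  obtain ⟨e, -⟩ := exists_gaussianInt_equiv hF hj
  exact IsPrincipalIdealRing.of_surjective e e.surjective

theorem eq_of_isUnit_of_sq_eq_neg_one [IsGalois ℚ F] (hF : Module.finrank ℚ F = 2)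
    {j : 𝓞 F} (hj : j ^ 2 = -1) {x : 𝓞 F} (hx : IsUnit x) :
    x = 1 ∨ x = -1 ∨ x = j ∨ x = -j := by
  obtain ⟨e, he⟩ := exists_gaussianInt_equiv hF hj
  obtain ⟨⟨a, b⟩, rfl⟩ := e.surjective x
  have h1 : IsUnit (⟨a, b⟩ : GaussianInt) := (MulEquiv.isUnit_map e).mp hx
  rw [← Zsqrtd.norm_eq_one_iff, Zsqrtd.norm_def] at h1
  have h2 : a * a + b * b = 1 := by
    have h3 : 0 ≤ a * a + b * b := add_nonneg (mul_self_nonneg a) (mul_self_nonneg b)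
    have h4 : a * a - -1 * b * b = a * a + b * b := by ring
    simp only at h1
    rw [h4] at h1
    omega
  rw [he]
  simp only
  have ha : -1 ≤ a ∧ a ≤ 1 := ⟨by nlinarith [mul_self_nonneg b], by nlinarith [mul_self_nonneg b]⟩
  have hb : -1 ≤ b ∧ b ≤ 1 := ⟨by nlinarith [mul_self_nonneg a], by nlinarith [mul_self_nonneg a]⟩
  obtain ⟨ha1, ha2⟩ := ha
  obtain ⟨hb1, hb2⟩ := hb
  interval_cases a <;> interval_cases b <;> simp_all

end GaussianIntegers

/-! ### Capitulating classes are strongly ambiguous -/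

section StronglyAmbiguous

variable {F k : Type*} [Field F] [Field k] [Algebra F k]

theorem smul_span_mul (τ : Gal(k/F)) (x : 𝓞 k) (I : Ideal (𝓞 k)) :
    τ • (Ideal.span {x} * I) = Ideal.span {τ • x} * τ • I := by
  rw [Ideal.pointwise_smul_def, Ideal.map_mul, Ideal.map_span, Set.image_singleton]
  rfl

/-- Hilbert 90 for y/x: the element z = (x + y)τx equals (τx + τy)y, while τz = (τx + τy)x, so (z)I
is invariant. If x + y = 0, the ideal I is itself invariant. -/
theorem isStronglyAmbiguous_of_mul_smul_eq [NumberField F] [NumberField k] [IsGalois F k]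
    (hk : Module.finrank F k = 2)
    {τ : Gal(k/F)} (hτ : τ ≠ 1) (I : (Ideal (𝓞 k))⁰) {x y : 𝓞 k} (hx : x ≠ 0)
    (hxy : Ideal.span {x} * τ • (I : Ideal (𝓞 k)) = Ideal.span {y} * I)
    (hnorm : y * τ • y = x * τ • x) : IsStronglyAmbiguous F k (ClassGroup.mk0 I) := by
  suffices H : ∃ J : (Ideal (𝓞 k))⁰, τ • (J : Ideal (𝓞 k)) = J ∧
      ClassGroup.mk0 J = ClassGroup.mk0 I by
    obtain ⟨J, hJ, hJI⟩ := H
    refine ⟨J, fun g ↦ ?_, hJI⟩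
    rw [← Ideal.smul_eq_map_mapRingEquiv]
    rcases eq_one_or_eq_of_finrank_eq_two hk hτ g with rfl | rfl
    · exact one_smul _ _
    · exact hJ
  have hττ : ∀ z : 𝓞 k, τ • τ • z = z := fun z ↦ by
    rw [smul_smul, sq_eq_one_of_finrank_eq_two hk, one_smul]
  have hspan : ∀ {z : 𝓞 k}, z ≠ 0 → Ideal.span {z} ≠ ⊥ := fun hz h ↦
    hz (Ideal.span_singleton_eq_bot.mp h)
  by_cases h0 : x + y = 0
  · refine ⟨I, ?_, rfl⟩
    have hyx : y = -x := by linear_combination h0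
    rw [hyx, Ideal.span_singleton_neg] at hxy
    exact mul_left_cancel₀ (hspan hx) hxy
  · have hτx : τ • x ≠ 0 := (smul_ne_zero_iff_ne τ).mpr hx
    set z := (x + y) * τ • x with hz
    have hz0 : z ≠ 0 := mul_ne_zero h0 hτx
    refine ⟨⟨Ideal.span {z} * I, mul_mem (mem_nonZeroDivisors_of_ne_zero (hspan hz0)) I.2⟩, ?_, ?_⟩
    · change τ • (Ideal.span {z} * (I : Ideal (𝓞 k))) = Ideal.span {z} * (I : Ideal (𝓞 k))
      rw [smul_span_mul]
      have h1 : τ • z = (τ • x + τ • y) * x := by rw [hz, smul_mul', hττ, smul_add]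
      have h2 : z = (τ • x + τ • y) * y := by
        rw [hz]
        linear_combination -hnorm
      rw [h1, h2, ← Ideal.span_singleton_mul_span_singleton,
        ← Ideal.span_singleton_mul_span_singleton, mul_assoc, hxy, mul_assoc]
    · rw [ClassGroup.mk0_eq_mk0_iff]
      exact ⟨1, z, one_ne_zero, hz0, by rw [Ideal.span_singleton_one, Ideal.top_mul]⟩

end StronglyAmbiguous

section StronglyAmbiguous

/-- A class annihilated by two is proportional to its conjugate, if the base field has class number
one. -/
theorem exists_span_mul_smul_eq {F k : Type*} [Field F] [NumberField F] [Field k] [NumberField k]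
    [Algebra F k] [IsPrincipalIdealRing (𝓞 F)] [IsGalois F k] (hk : Module.finrank F k = 2)
    {τ : Gal(k/F)} (hτ : τ ≠ 1) (I : (Ideal (𝓞 k))⁰) (hI : ClassGroup.mk0 I ^ 2 = 1) :
    ∃ x y : 𝓞 k, x ≠ 0 ∧ y ≠ 0 ∧ Ideal.span {x} * τ • (I : Ideal (𝓞 k)) = Ideal.span {y} * I ∧
      ∃ e : (𝓞 F)ˣ, y * τ • y = algebraMap (𝓞 F) (𝓞 k) e * (x * τ • x) := by
  have hI0 : (I : Ideal (𝓞 k)) ≠ 0 := nonZeroDivisors.coe_ne_zero I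
  have hττ : ∀ z : 𝓞 k, τ • τ • z = z := fun z ↦ by
    rw [smul_smul, sq_eq_one_of_finrank_eq_two hk, one_smul]
  -- `I ^ 2` and `I * τ I` are principal
  obtain ⟨ν, hν⟩ := IsPrincipalIdealRing.principal (Ideal.relNorm (𝓞 F) (I : Ideal (𝓞 k)))
  have h1 := map_relNorm_eq_mul_smul hk hτ (I : Ideal (𝓞 k))
  rw [hν, Ideal.submodule_span_eq, Ideal.map_span, Set.image_singleton] at h1
  set y := algebraMap (𝓞 F) (𝓞 k) ν
  rw [← map_pow, ClassGroup.mk0_eq_one_iff] at hI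
  obtain ⟨x, hx⟩ := hI
  rw [Ideal.submodule_span_eq, SubmonoidClass.coe_pow] at hx
  have hτI0 : τ • (I : Ideal (𝓞 k)) ≠ 0 := by
    intro h
    apply hI0
    rw [← inv_smul_smul τ (I : Ideal (𝓞 k)), h, smul_zero]
  have hx0 : x ≠ 0 := by
    rintro rfl
    rw [Ideal.span_singleton_eq_bot.mpr rfl] at hx
    exact pow_ne_zero 2 hI0 hx
  have hy0 : y ≠ 0 := by
    intro h
    rw [h, Ideal.span_singleton_eq_bot.mpr rfl] at h1
    exact mul_ne_zero hI0 hτI0 h1.symm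
  refine ⟨x, y, hx0, hy0, by rw [← hx, h1]; ring, ?_⟩
  have hτy : τ • y = y := RingOfIntegers.coe_injective (τ.commutes _)
  have h2 : Ideal.span {x * τ • x} = Ideal.span {y * τ • y} := by
    have h3 : Ideal.span {τ • x} = (τ • (I : Ideal (𝓞 k))) ^ 2 := by
      have := congrArg (τ • ·) hx
      simp only [smul_pow'] at this
      rw [this, Ideal.pointwise_smul_def, Ideal.map_span, Set.image_singleton]
      rfl
    rw [hτy, ← Ideal.span_singleton_mul_span_singleton, ← Ideal.span_singleton_mul_span_singleton,
      h1, h3, ← hx]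
    ring
  obtain ⟨e, he⟩ := Ideal.span_singleton_eq_span_singleton.mp h2
  have hxx : x * τ • x ≠ 0 := mul_ne_zero hx0 ((smul_ne_zero_iff_ne τ).mpr hx0)
  have hfix : τ • (e : 𝓞 k) = e := by
    have h4 := congrArg (τ • ·) he
    simp only [smul_mul', hττ, hτy] at h4
    apply mul_left_cancel₀ hxx
    rw [he, hτy]
    linear_combination h4
  have hfix' : τ • ((e⁻¹ : (𝓞 k)ˣ) : 𝓞 k) = (e⁻¹ : (𝓞 k)ˣ) := by
    have h4 := congrArg (τ • ·) (Units.mul_inv e)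
    simp only [smul_mul', hfix, smul_one] at h4
    apply mul_left_cancel₀ e.ne_zero
    rw [h4, Units.mul_inv]
  obtain ⟨e₁, he₁⟩ := mem_range_integers_of_fixed hk hτ hfix
  obtain ⟨e₂, he₂⟩ := mem_range_integers_of_fixed hk hτ hfix'
  have h12 : e₁ * e₂ = 1 := by
    apply FaithfulSMul.algebraMap_injective (𝓞 F) (𝓞 k)
    rw [map_mul, he₁, he₂, map_one, Units.mul_inv]
  refine ⟨Units.mkOfMulEqOne e₁ e₂ h12, ?_⟩
  change _ = algebraMap (𝓞 F) (𝓞 k) e₁ * _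
  rw [he₁, ← he]
  ring

variable {F k K : Type*} [Field F] [Field k] [Algebra F k] [Field K] [Algebra k K]

/-- The unit attached to a generator of a capitulating ideal and an extension of an automorphism. -/
theorem exists_unit_of_span_mul_smul_eq {τ : Gal(k/F)} {I : Ideal (𝓞 k)} {x y : 𝓞 k} (hx : x ≠ 0)
    (hxy : Ideal.span {x} * τ • I = Ideal.span {y} * I) {γ : 𝓞 K} (hγ0 : γ ≠ 0)
    (hγ : I.map (algebraMap (𝓞 k) (𝓞 K)) = Ideal.span {γ}) (g : K →+* K)
    (hg : ∀ z : k, g (algebraMap k K z) = algebraMap k K (τ z)) :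
    IsIntegral ℤ (algebraMap k K y * γ / (algebraMap k K x * g γ)) ∧
      IsIntegral ℤ (algebraMap k K y * γ / (algebraMap k K x * g γ))⁻¹ := by
  let g' : 𝓞 K →+* 𝓞 K := RingOfIntegers.mapRingHom g
  have h1 : (τ • I).map (algebraMap (𝓞 k) (𝓞 K)) = Ideal.span {g' γ} := by
    rw [← Set.image_singleton, ← Ideal.map_span, ← hγ, Ideal.map_map, Ideal.pointwise_smul_def,
      Ideal.map_map]
    congr 1
    ext z
    exact (hg z).symm
  have h2 := congrArg (Ideal.map (algebraMap (𝓞 k) (𝓞 K))) hxy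
  rw [Ideal.map_mul, Ideal.map_mul, h1, hγ, Ideal.map_span, Ideal.map_span, Set.image_singleton,
    Set.image_singleton, Ideal.span_singleton_mul_span_singleton,
    Ideal.span_singleton_mul_span_singleton, Ideal.span_singleton_eq_span_singleton] at h2
  obtain ⟨u, hu⟩ := h2
  have hu' : algebraMap k K x * g γ * ((u : 𝓞 K) : K) = algebraMap k K y * γ := by
    have := congrArg (algebraMap (𝓞 K) K) hu
    rw [map_mul, map_mul, map_mul] at this
    exact this
  have hx0 : algebraMap k K x * g γ ≠ 0 := by
    refine mul_ne_zero ?_ ?_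
    · rw [map_ne_zero, RingOfIntegers.coe_ne_zero_iff]
      exact hx
    · rw [map_ne_zero, RingOfIntegers.coe_ne_zero_iff]
      exact hγ0
  have h3 : algebraMap k K y * γ / (algebraMap k K x * g γ) = ((u : 𝓞 K) : K) := by
    rw [← hu', mul_div_cancel_left₀ _ hx0]
  have h4 : (((u : 𝓞 K) : K))⁻¹ = (((u⁻¹ : (𝓞 K)ˣ) : 𝓞 K) : K) := by
    refine inv_eq_of_mul_eq_one_right ?_
    rw [← map_mul, Units.mul_inv, map_one]
  rw [h3, h4]
  exact ⟨RingOfIntegers.isIntegral_coe _, RingOfIntegers.isIntegral_coe _⟩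

/-- Classes capitulating in an unramified quadratic extension of `ℚ(√(p₁p₂q), i)` which is abelian
over `ℚ` are strongly ambiguous. -/
theorem capitulationKernel_le_stronglyAmbiguousClasses [NumberField F] [NumberField k]
    [NumberField K] [Algebra F K] [IsScalarTower F k K] [IsAbelianGalois ℚ K] [IsGalois ℚ F]
    [IsGalois F k] [IsGalois F K] [IsGalois k K] (hF : Module.finrank ℚ F = 2)
    (hk : Module.finrank F k = 2) (hK : Module.finrank k K = 2) {i : F} (hi : i ^ 2 = -1)
    {p₁ p₂ q : ℕ} (hp₁ : p₁.Prime) (hp₂ : p₂.Prime) (hq : q.Prime) (h₁ : p₁ % 4 = 1)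
    (h₂ : p₂ % 4 = 1) (h₃ : q % 4 = 3) (hd : Squarefree (p₁ * p₂ * q)) {s : k}
    (hs : s ^ 2 = (p₁ * p₂ * q : ℕ))
    (hunr : ∀ 𝔭 : Ideal (𝓞 k), 𝔭.IsPrime → Algebra.IsUnramifiedIn (𝓞 K) 𝔭) :
    capitulationKernel k K ≤ stronglyAmbiguousClasses F k := by
  have hint : IsIntegral ℤ i :=
    IsIntegral.of_pow (n := 2) two_pos (by rw [hi]; exact isIntegral_one.neg)
  let j : 𝓞 F := ⟨i, hint⟩
  have hj : j ^ 2 = -1 := RingOfIntegers.coe_injective hi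
  have hpid := isPrincipalIdealRing_of_sq_eq_neg_one hF hj
  obtain ⟨σ, hσ⟩ := exists_nontrivial_gal hK
  obtain ⟨τ, hτ⟩ := exists_nontrivial_gal hk
  obtain ⟨m, n, hmn, hm4, hm1, f, hfi, hfσ, hfτ⟩ :=
    exists_multiquadraticFrame hF hk hK hi hp₁ hp₂ hq h₁ h₂ h₃ hd hs hunr hσ hτ
  intro c hc
  obtain ⟨I, rfl⟩ := ClassGroup.mk0_surjective c
  apply Subgroup.subset_closure
  change IsStronglyAmbiguous F k (ClassGroup.mk0 I)
  have hI2 : ClassGroup.mk0 I ^ 2 = 1 := by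
    rw [← hK]
    exact pow_finrank_eq_one_of_mem_capitulationKernel hc
  obtain ⟨γ, hγ0, hγ⟩ := (mk0_mem_capitulationKernel_iff I).mp hc
  obtain ⟨x, y, hx0, hy0, hxy, e, he⟩ := exists_span_mul_smul_eq hk hτ I hI2
  set J := algebraMap (𝓞 F) (𝓞 k) j with hJdef
  have hJ2 : J ^ 2 = -1 := by rw [hJdef, ← map_pow, hj, map_neg, map_one]
  have hτJ : τ • J = J := RingOfIntegers.coe_injective (τ.commutes _)
  have hunit : ∀ {v y : 𝓞 k}, IsUnit v →
      Ideal.span {x} * τ • (I : Ideal (𝓞 k)) = Ideal.span {y} * I →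
      Ideal.span {x} * τ • (I : Ideal (𝓞 k)) = Ideal.span {v * y} * I := by
    intro v y hv hxy
    rw [hxy, Ideal.span_singleton_mul_left_unit hv]
  have hJu : IsUnit J := IsUnit.of_mul_eq_one (-J) (by linear_combination -hJ2)
  -- the norm of the ratio can be taken to be `1` or `i`
  have hsign : ∀ y : 𝓞 k, Ideal.span {x} * τ • (I : Ideal (𝓞 k)) = Ideal.span {y} * I →
      y * τ • y = x * τ • x ∨ y * τ • y = -(x * τ • x) →
      IsStronglyAmbiguous F k (ClassGroup.mk0 I) := by
    rintro y hxy (h | h)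
    · exact isStronglyAmbiguous_of_mul_smul_eq hk hτ I hx0 hxy h
    · refine isStronglyAmbiguous_of_mul_smul_eq hk hτ I hx0 (hunit hJu hxy) ?_
      rw [smul_mul', hτJ]
      linear_combination J ^ 2 * h - (x * τ • x) * hJ2
  by_contra hnot
  obtain ⟨y, hxy, hy⟩ : ∃ y : 𝓞 k, Ideal.span {x} * τ • (I : Ideal (𝓞 k)) = Ideal.span {y} * I ∧
      y * τ • y = J * (x * τ • x) := by
    rcases eq_of_isUnit_of_sq_eq_neg_one hF hj e.isUnit with h | h | h | h <;>
      rw [h] at he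
    · exact absurd (hsign y hxy (Or.inl (by simpa using he))) hnot
    · exact absurd (hsign y hxy (Or.inr (by simpa using he))) hnot
    · exact ⟨y, hxy, he⟩
    · refine ⟨J * y, hunit hJu hxy, ?_⟩
      rw [smul_mul', hτJ]
      rw [map_neg, ← hJdef] at he
      linear_combination J ^ 2 * he - J * (x * τ • x) * hJ2
  -- pass to the two units of `K`
  have hgτ : ∀ z : k, (f.σ.comp f.τ) (algebraMap k K z) = algebraMap k K (τ z) := fun z ↦ by
    rw [RingHom.comp_apply, hfτ, hfσ, σ.commutes]
  obtain ⟨hu, hui⟩ := exists_unit_of_span_mul_smul_eq hx0 hxy hγ0 hγ f.τ hfτ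
  obtain ⟨hu', hui'⟩ := exists_unit_of_span_mul_smul_eq hx0 hxy hγ0 hγ (f.σ.comp f.τ) hgτ
  have hJK : algebraMap k K (J : k) = f.i := by
    rw [hfi, IsScalarTower.algebraMap_apply F k K]
    rfl
  have hyK : algebraMap k K y * algebraMap k K (τ y) =
      f.i * (algebraMap k K x * algebraMap k K (τ x)) := by
    rw [← hJK, ← map_mul, ← map_mul, ← map_mul]
    exact congrArg (algebraMap k K) (congrArg (algebraMap (𝓞 k) k) hy)
  have hX0 : algebraMap k K x ≠ 0 := by
    rw [map_ne_zero, RingOfIntegers.coe_ne_zero_iff]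
    exact hx0
  have hX0' : algebraMap k K (τ x) ≠ 0 := by
    rw [map_ne_zero, map_ne_zero, RingOfIntegers.coe_ne_zero_iff]
    exact hx0
  have hγK : (γ : K) ≠ 0 := by
    rw [RingOfIntegers.coe_ne_zero_iff]
    exact hγ0
  have hτγ : f.τ γ ≠ 0 := (map_ne_zero f.τ).mpr hγK
  have hσγ : f.σ γ ≠ 0 := (map_ne_zero f.σ).mpr hγK
  have hστγ : f.σ (f.τ γ) ≠ 0 := (map_ne_zero f.σ).mpr hτγ
  have hfσk : ∀ z : k, f.σ (algebraMap k K z) = algebraMap k K z := fun z ↦ by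
    rw [hfσ, σ.commutes]
  have hodd : Odd (m * n) := by
    rw [hmn, Nat.odd_iff, Nat.mul_mod, Nat.mul_mod p₁]
    have e1 : p₁ % 2 = 1 := by omega
    have e2 : p₂ % 2 = 1 := by omega
    have e3 : q % 2 = 1 := by omega
    rw [e1, e2, e3]
  refine f.false_of_unit_pair (hmn ▸ hd) hodd hm4 hm1 hu hui hu' hui' ?_ ?_ ?_ ?_
  · simp only [map_div₀, map_mul, hfτ, f.τ_τ]
    field_simp
    linear_combination hyK
  · simp only [RingHom.comp_apply, map_div₀, map_mul, hfτ, hfσk, ← f.σ_τ, f.σ_σ, f.τ_τ]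
    field_simp
    linear_combination hyK
  · simp only [RingHom.comp_apply, map_div₀, map_mul, hfσk, f.σ_σ]
    field_simp
  -- A unit V of k with norm ±i could replace y by V y. The norm of the ratio would become ±1, the
  -- case already settled by `hsign`.
  · intro z hz hzi hσz
    rw [hfσ] at hσz
    obtain ⟨v, rfl⟩ := mem_range_of_fixed hK hσ hσz
    have hv : IsIntegral ℤ v := (isIntegral_algebraMap_iff (algebraMap k K).injective).mp hz
    have hvi : IsIntegral ℤ v⁻¹ := (isIntegral_algebraMap_iff (algebraMap k K).injective).mp (by
      rwa [map_inv₀])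
    let V : 𝓞 k := ⟨v, hv⟩
    have key : ∀ ε : 𝓞 k, algebraMap k K v * f.τ (algebraMap k K v) = algebraMap k K ε →
        V * τ • V = ε := by
      intro ε h
      rw [hfτ, ← map_mul] at h
      exact RingOfIntegers.coe_injective ((algebraMap k K).injective h)
    have hVu : v ≠ 0 → IsUnit V := fun hv0 ↦ IsUnit.of_mul_eq_one ⟨v⁻¹, hvi⟩
      (RingOfIntegers.coe_injective (mul_inv_cancel₀ hv0))
    have hv0 : ∀ ε : 𝓞 k, ε ≠ 0 → V * τ • V = ε → v ≠ 0 := by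
      rintro ε hε h rfl
      apply hε
      have hV : V = 0 := RingOfIntegers.coe_injective (map_zero (algebraMap (𝓞 k) k)).symm
      rw [← h, hV, zero_mul]
    constructor
    · intro h
      have h1 := key J (h.trans hJK.symm)
      refine hnot (hsign (V * y) (hunit (hVu (hv0 J hJu.ne_zero h1)) hxy) (Or.inr ?_))
      rw [smul_mul']
      linear_combination (y * τ • y) * h1 + J * hy + (x * τ • x) * hJ2
    · intro h
      have h1 := key (-J) (by rw [h, ← hJK, ← map_neg]; rfl)
      refine hnot (hsign (V * y) (hunit (hVu (hv0 (-J) (neg_ne_zero.mpr hJu.ne_zero) h1)) hxy)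
        (Or.inl ?_))
      rw [smul_mul']
      linear_combination (y * τ • y) * h1 - J * hy - (x * τ • x) * hJ2

end StronglyAmbiguous

/-! ### The negative Pell equation and Gaussian primes -/

theorem Int.emod_four_sq (a : ℤ) : a ^ 2 % 4 = 0 ∧ a % 2 = 0 ∨ a ^ 2 % 4 = 1 ∧ a % 2 = 1 := by
  rcases Int.even_or_odd' a with ⟨b, rfl | rfl⟩
  · left
    constructor
    · rw [show (2 * b) ^ 2 = 4 * b ^ 2 by ring]
      omega
    · omega
  · right
    constructor
    · rw [show (2 * b + 1) ^ 2 = 4 * (b ^ 2 + b) + 1 by ring]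
      omega
    · omega

theorem Int.exists_sq_of_mul_eq_sq {a b c : ℤ} (ha : 0 ≤ a) (h : IsCoprime a b)
    (hab : a * b = c ^ 2) : ∃ r : ℤ, 0 ≤ r ∧ a = r ^ 2 := by
  obtain ⟨r, hr⟩ := Int.sq_of_isCoprime h hab
  rcases hr with hr | hr
  · exact ⟨|r|, abs_nonneg r, by rw [sq_abs, hr]⟩
  · refine ⟨0, le_rfl, ?_⟩
    nlinarith [sq_nonneg r]

/-- The negative Pell equation is solvable for primes congruent to one modulo four. -/
theorem exists_sq_add_one_eq_mul_sq {p : ℕ} (hp : p.Prime) (hp4 : p % 4 = 1) :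
    ∃ X Y : ℤ, X ^ 2 + 1 = p * Y ^ 2 := by
  have hpZ : Prime (p : ℤ) := Nat.prime_iff_prime_int.mp hp
  have hp0 : (0 : ℤ) < p := by exact_mod_cast hp.pos
  have hsol : ∃ y : ℕ, 0 < y ∧ ∃ x : ℤ, 0 < x ∧ x ^ 2 - p * (y : ℤ) ^ 2 = 1 := by
    obtain ⟨x, y, hxy, hy⟩ := Pell.exists_of_not_isSquare hp0 (by
      rintro ⟨r, hr⟩
      exact hpZ.irreducible.not_isSquare ⟨r, hr⟩)
    refine ⟨y.natAbs, Int.natAbs_pos.mpr hy, |x|, ?_, ?_⟩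
    · rw [abs_pos]
      rintro rfl
      nlinarith [sq_nonneg y]
    · rw [sq_abs, Int.natCast_natAbs, sq_abs, hxy]
  classical
  obtain ⟨hy0, x, hx0, hxy⟩ := Nat.find_spec hsol
  have hmin := fun {z : ℕ} ↦ Nat.find_min (m := z) hsol
  set y := Nat.find hsol
  have hp4' : (p : ℤ) % 4 = 1 := by omega
  -- `x` is odd and `y` is even
  obtain ⟨u, hu⟩ : ∃ u : ℤ, x = 2 * u + 1 := by
    rcases Int.emod_four_sq x with ⟨h1, h2⟩ | ⟨h1, h2⟩
    · exfalso
      have h3 : (x ^ 2 - p * (y : ℤ) ^ 2) % 4 = 1 := by rw [hxy]; rfl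
      rw [Int.sub_emod, Int.mul_emod, hp4', h1] at h3
      rcases Int.emod_four_sq y with ⟨h4, -⟩ | ⟨h4, -⟩ <;> rw [h4] at h3 <;> norm_num at h3
    · exact ⟨x / 2, by omega⟩
  obtain ⟨v, hv⟩ : ∃ v : ℤ, (y : ℤ) = 2 * v := by
    rcases Int.emod_four_sq y with ⟨h1, h2⟩ | ⟨h1, h2⟩
    · exact ⟨y / 2, by omega⟩
    · exfalso
      have h3 : (p * (y : ℤ) ^ 2) % 4 = 1 := by rw [Int.mul_emod, hp4', h1]; rfl
      have h4 : p * (y : ℤ) ^ 2 = 4 * (u ^ 2 + u) := by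
        rw [hu] at hxy
        linear_combination -hxy
      omega
  -- Of these coprime factors one is a square and the other p times a square. If p divides u, this
  -- gives a Pell solution with smaller y; otherwise u = a² and u + 1 = p b².
  have huv : u * (u + 1) = p * v ^ 2 := by
    rw [hu, hv] at hxy
    linarith
  have hcop : IsCoprime u (u + 1) := ⟨-1, 1, by ring⟩
  have hv0 : 0 < v := by omega
  have hu0 : 0 < u := by
    have : 0 ≤ u := by omega
    refine lt_of_le_of_ne this fun h ↦ ?_
    rw [← h, zero_mul] at huv
    exact (mul_pos hp0 (pow_pos hv0 2)).ne huv
  rcases hpZ.dvd_or_dvd (⟨_, huv⟩ : (p : ℤ) ∣ u * (u + 1)) with ⟨w, hw⟩ | ⟨w, hw⟩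
  · -- this contradicts minimality
    exfalso
    have h1 : w * (u + 1) = v ^ 2 := by
      apply mul_left_cancel₀ hp0.ne'
      rw [← huv, hw]
      ring
    have hw0 : 0 < w := by
      rw [hw] at hu0
      exact (mul_pos_iff_of_pos_left hp0).mp hu0
    have hc : IsCoprime w (u + 1) := hcop.of_isCoprime_of_dvd_left ⟨p, by rw [hw]; ring⟩
    obtain ⟨a, ha, haw⟩ := Int.exists_sq_of_mul_eq_sq hw0.le hc h1
    obtain ⟨b, hb, hbu⟩ := Int.exists_sq_of_mul_eq_sq (by omega) hc.symm ((mul_comm _ _).trans h1)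
    have ha0 : 0 < a := by
      refine lt_of_le_of_ne ha fun h ↦ ?_
      rw [haw, ← h] at hw0
      norm_num at hw0
    have hb0 : 0 < b := by
      refine lt_of_le_of_ne hb fun h ↦ ?_
      rw [← h] at hbu
      norm_num at hbu
      omega
    have hab : v = a * b := by
      have h2 : v ^ 2 = (a * b) ^ 2 := by rw [← h1, haw, hbu]; ring
      exact (pow_left_inj₀ hv0.le (mul_nonneg ha hb) two_ne_zero).mp h2
    refine hmin (z := a.toNat) ?_ ⟨by omega, b, hb0, ?_⟩
    · have h3 : a < y := by
        rw [hv, hab]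
        nlinarith
      omega
    · rw [Int.toNat_of_nonneg ha]
      rw [haw] at hw
      linear_combination hw - hbu
  · have h1 : u * w = v ^ 2 := by
      apply mul_left_cancel₀ hp0.ne'
      rw [← huv, hw]
      ring
    have hw0 : 0 ≤ w := by
      have : 0 < (p : ℤ) * w := by omega
      exact ((mul_pos_iff_of_pos_left hp0).mp this).le
    have hc : IsCoprime u w := hcop.of_isCoprime_of_dvd_right ⟨p, by rw [hw]; ring⟩
    obtain ⟨a, ha, hau⟩ := Int.exists_sq_of_mul_eq_sq hu0.le hc h1
    obtain ⟨b, hb, hbw⟩ := Int.exists_sq_of_mul_eq_sq hw0 hc.symm ((mul_comm _ _).trans h1)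
    refine ⟨a, b, ?_⟩
    rw [← hau, ← hbw, hw]

/-- A Gaussian prime dividing `p`, where `X ^ 2 + 1 = p * Y ^ 2`, is a divisor of `X + i` or `X - i`
with square cofactor. -/
theorem GaussianInt.exists_eq_mul_sq_of_prime_dvd {p : ℕ} (hp : p.Prime) (hp4 : p % 4 = 1) {X Y : ℤ}
    (hXY : X ^ 2 + 1 = p * Y ^ 2) {π : GaussianInt} (hπ : Prime π) (hπp : π ∣ p) :
    ∃ (ε : ℤ) (v w : GaussianInt), (ε = 1 ∨ ε = -1) ∧ IsUnit v ∧
      (⟨X, ε⟩ : GaussianInt) = π * (v * w ^ 2) := by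
  have hp0 : (0 : ℤ) < p := by exact_mod_cast hp.pos
  have hXeven : X % 2 = 0 := by
    rcases Int.emod_four_sq X with ⟨h1, h2⟩ | ⟨h1, h2⟩
    · exact h2
    · exfalso
      have hp4' : (p : ℤ) % 4 = 1 := by omega
      have h3 : (p * Y ^ 2) % 4 = 2 := by omega
      rw [Int.mul_emod, hp4'] at h3
      rcases Int.emod_four_sq Y with ⟨h4, -⟩ | ⟨h4, -⟩ <;> rw [h4] at h3 <;> norm_num at h3
  have hfac : ∀ ε : ℤ, ε = 1 ∨ ε = -1 →
      (⟨X, ε⟩ : GaussianInt) * star (⟨X, ε⟩ : GaussianInt) = p * Y ^ 2 := by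
    intro ε hε
    have hε2 : ε * ε = 1 := by rcases hε with rfl | rfl <;> rfl
    rw [← Zsqrtd.norm_eq_mul_conj, Zsqrtd.norm_def]
    have h : X * X - -1 * ε * ε = p * Y ^ 2 := by linear_combination hXY + hε2
    simp only
    rw [h]
    push_cast
    ring
  obtain ⟨ε, hε, z, hz⟩ : ∃ ε : ℤ, (ε = 1 ∨ ε = -1) ∧ π ∣ (⟨X, ε⟩ : GaussianInt) := by
    have h1 : π ∣ (⟨X, 1⟩ : GaussianInt) * star (⟨X, 1⟩ : GaussianInt) := by
      rw [hfac 1 (Or.inl rfl)]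
      exact hπp.mul_right _
    rcases hπ.dvd_or_dvd h1 with h | h
    · exact ⟨1, Or.inl rfl, h⟩
    · exact ⟨-1, Or.inr rfl, h⟩
  -- the norm of `π` is `p`
  have hnorm : π * star π = p := by
    obtain ⟨ω, hω⟩ := hπp
    have h1 : π.norm.natAbs ∣ p ^ 2 := by
      refine ⟨ω.norm.natAbs, ?_⟩
      rw [← Int.natAbs_mul, ← Zsqrtd.norm_mul, ← hω, Zsqrtd.norm_natCast, Int.natAbs_mul,
        Int.natAbs_natCast, sq]
    obtain ⟨l, hl, hlp⟩ := (Nat.dvd_prime_pow hp).mp h1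
    have hl0 : l ≠ 0 := by
      rintro rfl
      exact hπ.not_isUnit (Zsqrtd.norm_eq_one_iff.mp (by rw [hlp, pow_zero]))
    -- Norm p² would make π associated to p, but p does not divide X ± i.
    have hl2 : l ≠ 2 := by
      rintro rfl
      have h2 : ω.norm.natAbs = 1 := by
        have h3 : π.norm.natAbs * ω.norm.natAbs = p ^ 2 := by
          rw [← Int.natAbs_mul, ← Zsqrtd.norm_mul, ← hω, Zsqrtd.norm_natCast, Int.natAbs_mul,
            Int.natAbs_natCast, sq]
        rw [hlp] at h3
        exact Nat.eq_of_mul_eq_mul_left (pow_pos hp.pos 2) (h3.trans (mul_one _).symm)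
      have h4 : (p : GaussianInt) ∣ ⟨X, ε⟩ := by
        obtain ⟨ω', hω'⟩ := (Zsqrtd.norm_eq_one_iff.mp h2).exists_right_inv
        refine ⟨ω' * z, ?_⟩
        rw [hz, hω]
        linear_combination (-(π * z)) * hω'
      have h5 : ((p : ℤ) : GaussianInt) ∣ ⟨X, ε⟩ := by exact_mod_cast h4
      rw [Zsqrtd.intCast_dvd] at h5
      have h6 : (p : ℤ) ∣ 1 := by
        rcases hε with rfl | rfl
        · exact h5.2
        · exact (dvd_neg (b := (1 : ℤ))).mp h5.2
      exact (Nat.prime_iff_prime_int.mp hp).not_isUnit (isUnit_of_dvd_one h6)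
    have hl1 : l = 1 := by omega
    rw [← Zsqrtd.norm_eq_mul_conj]
    have h3 : π.norm = p := by
      rw [hl1, pow_one] at hlp
      rw [← hlp, Int.natCast_natAbs, abs_of_nonneg (GaussianInt.norm_nonneg π)]
    rw [h3]
    rfl
  have hzz : z * star z = (Y : GaussianInt) ^ 2 := by
    have h1 := hfac ε hε
    rw [hz, star_mul'] at h1
    have hp0' : (p : GaussianInt) ≠ 0 := by exact_mod_cast hp.ne_zero
    apply mul_left_cancel₀ hp0'
    rw [← h1, ← hnorm]
    ring
  have hcop : IsCoprime z (star z) := by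
    have h1 : IsCoprime (⟨X, ε⟩ : GaussianInt) (star (⟨X, ε⟩ : GaussianInt)) := by
      obtain ⟨x, rfl⟩ : (2 : ℤ) ∣ X := Int.dvd_of_emod_eq_zero hXeven
      -- Bézout: the norm is 4x² + 1, and 2x²εi times the difference 2εi of the conjugates is -4x².
      -- Evenness of X is essential here.
      refine ⟨⟨2 * x, -ε⟩ + ⟨0, 2 * x ^ 2 * ε⟩, -⟨0, 2 * x ^ 2 * ε⟩, ?_⟩
      have hε2 : ε * ε = 1 := by rcases hε with rfl | rfl <;> rfl
      ext
      · simp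
        linear_combination (1 - 4 * x ^ 2) * hε2
      · simp
        ring
    refine (h1.of_isCoprime_of_dvd_left ⟨π, by rw [hz]; ring⟩).of_isCoprime_of_dvd_right
      ⟨star π, by rw [hz, star_mul']; ring⟩
  -- The cofactor z and its conjugate are coprime with product Y², so z is a square up to a unit.
  obtain ⟨w, v, hvw⟩ := exists_associated_pow_of_mul_eq_pow' hcop hzz
  exact ⟨ε, v, w, hε, v.isUnit, by rw [hz, ← hvw]; ring⟩

/-! ### Elements which are squares up to units -/

/-- An element is a square up to a unit. -/
def IsAssociatedToSquare {R : Type*} [CommMonoid R] (a : R) : Prop :=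
  ∃ γ : R, Associated (γ ^ 2) a

namespace IsAssociatedToSquare

theorem of_isUnit {R : Type*} [CommMonoid R] {a : R} (ha : IsUnit a) : IsAssociatedToSquare a :=
  ⟨1, by rw [one_pow]; exact (associated_one_iff_isUnit.mpr ha).symm⟩

theorem sq {R : Type*} [CommMonoid R] (a : R) : IsAssociatedToSquare (a ^ 2) :=
  ⟨a, Associated.refl _⟩

theorem mul {R : Type*} [CommMonoid R] {a b : R} (ha : IsAssociatedToSquare a)
    (hb : IsAssociatedToSquare b) : IsAssociatedToSquare (a * b) := by
  obtain ⟨γ, hγ⟩ := ha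
  obtain ⟨δ, hδ⟩ := hb
  exact ⟨γ * δ, by rw [mul_pow]; exact hγ.mul_mul hδ⟩

theorem of_associated {R : Type*} [CommMonoid R] {a b : R} (ha : IsAssociatedToSquare a)
    (hab : Associated a b) : IsAssociatedToSquare b := by
  obtain ⟨γ, hγ⟩ := ha
  exact ⟨γ, hγ.trans hab⟩

/-- Divisibility of squares implies divisibility of their roots in an integrally closed domain;
unique factorization is not needed. -/
theorem of_mul {R : Type*} [CommRing R] [IsDomain R] [IsIntegrallyClosed R] {a b : R}
    (hab : IsAssociatedToSquare (a * b)) (hb : IsAssociatedToSquare b) (hb0 : b ≠ 0) :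
    IsAssociatedToSquare a := by
  obtain ⟨γ, u, hγ⟩ := hab
  obtain ⟨δ, v, hδ⟩ := hb
  have hδ0 : δ ≠ 0 := by
    rintro rfl
    rw [zero_pow two_ne_zero, zero_mul] at hδ
    exact hb0 hδ.symm
  have hdvd : δ ^ 2 ∣ γ ^ 2 := by
    have h1 : δ ^ 2 ∣ γ ^ 2 * u := ⟨a * v, by rw [hγ, ← hδ]; ring⟩
    exact (Units.dvd_mul_right).mp h1
  obtain ⟨η, rfl⟩ := (IsIntegrallyClosed.pow_dvd_pow_iff two_ne_zero).mp hdvd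
  refine ⟨η, u * v⁻¹, ?_⟩
  apply mul_left_cancel₀ (mul_ne_zero (pow_ne_zero 2 hδ0) v.ne_zero)
  have hvv : (v : R) * (v⁻¹ : Rˣ) = 1 := Units.mul_inv v
  rw [Units.val_mul]
  linear_combination (δ ^ 2 * η ^ 2 * u) * hvv + hγ - a * hδ

end IsAssociatedToSquare

/-! ### Gaussian primes that become squares up to units -/

section

variable {F M : Type*} [Field F] [NumberField F] [Field M] [NumberField M] [Algebra F M]

/-- The Pell solution gives a unit E = X + Y√p of norm -1, so E² = 2XE + 1. Then (E ± i)² is (1 +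
i)² times -iE(X ± i), and dividing by 1 + i exhibits X ± i as a square up to a unit. -/
theorem isAssociatedToSquare_add_of_pell {j r : 𝓞 M} (hj : j ^ 2 = -1) {p : ℕ} (hr : r ^ 2 = p)
    {X Y ε : ℤ} (hXY : X ^ 2 + 1 = p * Y ^ 2) (hε : ε = 1 ∨ ε = -1) :
    IsAssociatedToSquare (X + ε * j) := by
  have hXY' : (X : 𝓞 M) ^ 2 + 1 = p * Y ^ 2 := by exact_mod_cast hXY
  have hε2 : (ε : 𝓞 M) ^ 2 = 1 := by rcases hε with rfl | rfl <;> simp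
  set E : 𝓞 M := X + Y * r with hE
  have hEu : E * (Y * r - X) = 1 := by
    rw [hE]
    linear_combination Y ^ 2 * hr - hXY'
  have hE2 : E ^ 2 = 2 * X * E + 1 := by
    rw [hE]
    linear_combination Y ^ 2 * hr - hXY'
  have h1 : (E + ε * j) ^ 2 = (1 + j) ^ 2 * (-j * E * (X + ε * j)) := by
    linear_combination hE2 + j ^ 2 * hε2 + hj +
      (2 * E * (X + ε * j)) * hj + (j * E * (X + ε * j)) * hj
  have h2 : (1 + j) ∣ (E + ε * j) :=
    (IsIntegrallyClosed.pow_dvd_pow_iff two_ne_zero).mp ⟨_, h1⟩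
  obtain ⟨g, hg⟩ := h2
  have h10 : (1 + j) ^ 2 ≠ 0 := by
    intro h
    have h3 : (2 : 𝓞 M) * j = 0 := by linear_combination h - hj
    have h4 : (2 : 𝓞 M) = 0 := by linear_combination (-j) * h3 + 2 * hj
    exact two_ne_zero h4
  have h5 : g ^ 2 = -j * E * (X + ε * j) := by
    apply mul_left_cancel₀ h10
    rw [← h1, hg]
    ring
  refine ⟨g, Units.mkOfMulEqOne (j * (Y * r - X)) (-j * E) ?_, ?_⟩
  · linear_combination (-j ^ 2) * hEu - hj
  · change g ^ 2 * (j * (Y * r - X)) = _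
    rw [h5]
    linear_combination (-j ^ 2 * (X + ε * j)) * hEu - (X + ε * j) * hj

theorem isAssociatedToSquare_of_prime_dvd_of_mod_four_eq_one [IsGalois ℚ F]
    (hF : Module.finrank ℚ F = 2) {j : 𝓞 F} (hj : j ^ 2 = -1) {p : ℕ} (hp : p.Prime)
    (hp4 : p % 4 = 1) {r : 𝓞 M} (hr : r ^ 2 = p) {π : 𝓞 F} (hπ : Prime π) (hπp : π ∣ p) :
    IsAssociatedToSquare (algebraMap (𝓞 F) (𝓞 M) π) := by
  obtain ⟨e, he⟩ := exists_gaussianInt_equiv hF hj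
  obtain ⟨X, Y, hXY⟩ := exists_sq_add_one_eq_mul_sq hp hp4
  have h1 : Prime (e.symm π) := (MulEquiv.prime_iff e.symm).mpr hπ
  have h2 : e.symm π ∣ (p : GaussianInt) := by
    rw [← map_natCast e.symm]
    exact map_dvd e.symm hπp
  obtain ⟨ε, v, w, hε, hv, h3⟩ := GaussianInt.exists_eq_mul_sq_of_prime_dvd hp hp4 hXY h1 h2
  have h4 := congrArg e h3
  rw [map_mul, map_mul, map_pow, e.apply_symm_apply, he] at h4
  simp only at h4
  have h5 := congrArg (algebraMap (𝓞 F) (𝓞 M)) h4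
  rw [map_add, map_mul, map_mul, map_mul, map_pow, map_intCast, map_intCast] at h5
  have hj' : algebraMap (𝓞 F) (𝓞 M) j ^ 2 = -1 := by rw [← map_pow, hj, map_neg, map_one]
  have h6 := isAssociatedToSquare_add_of_pell hj' hr hXY hε
  rw [h5] at h6
  have h7 : IsUnit (algebraMap (𝓞 F) (𝓞 M) (e v)) := (hv.map e).map _
  refine h6.of_mul (IsAssociatedToSquare.mul (.of_isUnit h7) (.sq _)) ?_
  refine mul_ne_zero h7.ne_zero (pow_ne_zero 2 ?_)
  rw [Ne, FaithfulSMul.algebraMap_eq_zero_iff, EmbeddingLike.map_eq_zero_iff]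
  rintro rfl
  rw [zero_pow two_ne_zero, mul_zero, mul_zero] at h3
  have := congrArg Zsqrtd.im h3
  rcases hε with rfl | rfl <;> simp at this

/-- The prime q stays prime in ℤ[i], so π is associated to q = r². -/
theorem isAssociatedToSquare_of_prime_dvd_of_mod_four_eq_three [IsGalois ℚ F]
    (hF : Module.finrank ℚ F = 2) {j : 𝓞 F} (hj : j ^ 2 = -1) {q : ℕ} (hq : q.Prime)
    (hq4 : q % 4 = 3) {r : 𝓞 M} (hr : r ^ 2 = q) {π : 𝓞 F} (hπ : Prime π) (hπq : π ∣ q) :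
    IsAssociatedToSquare (algebraMap (𝓞 F) (𝓞 M) π) := by
  obtain ⟨e, he⟩ := exists_gaussianInt_equiv hF hj
  have : Fact q.Prime := ⟨hq⟩
  have h1 : Prime (q : GaussianInt) := GaussianInt.prime_of_nat_prime_of_mod_four_eq_three q hq4
  have h2 : Prime (q : 𝓞 F) := by
    rw [← map_natCast e]
    exact (MulEquiv.prime_iff e).mpr h1
  have h3 : Associated (q : 𝓞 F) π := (hπ.associated_of_dvd h2 hπq).symm
  have h4 := h3.map (algebraMap (𝓞 F) (𝓞 M))
  rw [map_natCast, ← hr] at h4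
  exact (IsAssociatedToSquare.sq r).of_associated h4

end

/-! ### Capitulation of the strongly ambiguous classes -/

section

variable {F k : Type*} [Field F] [NumberField F] [Field k] [NumberField k] [Algebra F k]

theorem isRadical_span_of_prime_of_not_dvd [IsGalois ℚ F] (hF : Module.finrank ℚ F = 2)
    (hk : Module.finrank F k = 2) {i : F} (hi : i ^ 2 = -1) {d : ℕ} (hd : Squarefree d)
    (hd4 : d % 4 = 3) {s : k} (hs : s ^ 2 = d) {π : 𝓞 F} (hπ : Prime π) (hπd : ¬ π ∣ (d : 𝓞 F)) :
    (Ideal.span {algebraMap (𝓞 F) (𝓞 k) π}).IsRadical := by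
  have hπ0 : Ideal.span {π} ≠ ⊥ := by
    rw [Ne, Ideal.span_singleton_eq_bot]
    exact hπ.ne_zero
  have hprime : (Ideal.span {π}).IsPrime := (Ideal.span_singleton_prime hπ.ne_zero).mpr hπ
  have hmax : (Ideal.span {π}).IsMaximal := hprime.isMaximal hπ0
  have h1 : Ideal.span {algebraMap (𝓞 F) (𝓞 k) π} =
      (Ideal.span {π}).map (algebraMap (𝓞 F) (𝓞 k)) := by
    rw [Ideal.map_span, Set.image_singleton]
  rw [h1]
  refine Ideal.isRadical_map_of_isUnramifiedIn (Ideal.map_ne_bot_of_ne_bot hπ0) ?_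
  intro P hP hPπ
  refine isUnramifiedAt_of_natCast_notMem hF hk hi hd hd4 hs P fun hdP ↦ hπd ?_
  rw [← Ideal.mem_span_singleton, hPπ.over, Ideal.under_def, Ideal.mem_comap, map_natCast]
  exact hdP

/-- If `α D` generates the square of an ideal of `k`, where every prime factor of `D` ramifies in
`k`, and if the ramified primes become squares up to units in `M`, then so does `α`. -/
theorem isAssociatedToSquare_of_sq_eq_span [IsGalois ℚ F] (hF : Module.finrank ℚ F = 2)
    (hk : Module.finrank F k = 2) {i : F} (hi : i ^ 2 = -1) [IsPrincipalIdealRing (𝓞 F)] {d : ℕ}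
    (hd : Squarefree d) (hd4 : d % 4 = 3) {s : k} (hs : s ^ 2 = d)
    {R : Type*} [CommRing R] [Algebra (𝓞 F) R]
    (hR : ∀ π : 𝓞 F, Prime π → π ∣ d → IsAssociatedToSquare (algebraMap (𝓞 F) R π))
    (α : 𝓞 F) (hα : α ≠ 0) (D : 𝓞 F) (N : ℕ) (hD : D ∣ (d : 𝓞 F) ^ N) (I : Ideal (𝓞 k))
    (hI : I ^ 2 = Ideal.span {algebraMap (𝓞 F) (𝓞 k) (α * D)}) :
    IsAssociatedToSquare (algebraMap (𝓞 F) R α) := by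
  induction α using IsWellFounded.induction (α := 𝓞 F) DvdNotUnit generalizing D N I with
  | _ α ih =>
  by_cases hu : IsUnit α
  · exact .of_isUnit (hu.map _)
  obtain ⟨π, hπ, α', rfl⟩ := WfDvdMonoid.exists_irreducible_factor hu hα
  replace hπ := hπ.prime
  have hα' : α' ≠ 0 := right_ne_zero_of_mul hα
  -- A ramified prime is a square up to a unit by hypothesis and moves into D. An unramified one has
  -- radical extension to k, so it divides I, and its square can be removed from α and I² together.
  by_cases hπd : π ∣ (d : 𝓞 F)
  · rw [map_mul]
    refine (hR π hπ hπd).mul ?_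
    refine ih α' ⟨hα', π, hπ.not_isUnit, mul_comm _ _⟩ hα' (π * D) (1 + N) ?_ I ?_
    · rw [pow_add, pow_one]
      exact mul_dvd_mul hπd hD
    · rw [hI]
      congr 3
      ring
  have hrad := isRadical_span_of_prime_of_not_dvd hF hk hi hd hd4 hs hπ hπd
  set ϖ := algebraMap (𝓞 F) (𝓞 k) π with hϖ
  have hϖ0 : Ideal.span {ϖ} ≠ 0 := by
    rw [Ne, Ideal.zero_eq_bot, Ideal.span_singleton_eq_bot, hϖ,
      FaithfulSMul.algebraMap_eq_zero_iff]
    exact hπ.ne_zero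
  have hle : I ≤ Ideal.span {ϖ} := fun x hx ↦ hrad ⟨2, by
    have h1 : x ^ 2 ∈ I ^ 2 := Ideal.pow_mem_pow hx 2
    rw [hI, mul_assoc, map_mul] at h1
    exact Ideal.span_singleton_le_span_singleton.mpr (dvd_mul_right _ _) h1⟩
  obtain ⟨J, rfl⟩ := Ideal.dvd_iff_le.mpr hle
  rw [mul_assoc, map_mul, ← Ideal.span_singleton_mul_span_singleton, mul_pow, sq, mul_assoc] at hI
  replace hI := mul_left_cancel₀ hϖ0 hI
  have hdvd : π ∣ α' * D := by
    rw [← Ideal.mem_span_singleton, ← Ideal.comap_map_eq_self_of_faithfullyFlat (B := 𝓞 k)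
      (Ideal.span {π}), Ideal.mem_comap, Ideal.map_span, Set.image_singleton,
      ← Ideal.span_singleton_le_iff_mem, ← hI]
    exact Ideal.mul_le_left
  obtain ⟨β, rfl⟩ := (hπ.dvd_or_dvd hdvd).resolve_right
    fun h ↦ hπd (hπ.dvd_of_dvd_pow (h.trans hD))
  rw [mul_assoc, map_mul, ← Ideal.span_singleton_mul_span_singleton] at hI
  replace hI := mul_left_cancel₀ hϖ0 hI
  have hβ : β ≠ 0 := right_ne_zero_of_mul hα'
  rw [← mul_assoc, ← sq, map_mul, map_pow]
  refine (IsAssociatedToSquare.sq _).mul (ih β ⟨hβ, π * π, ?_, by ring⟩ hβ D N hD J hI)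
  exact fun h ↦ hπ.not_isUnit (isUnit_of_mul_isUnit_left h)

variable {M : Type*} [Field M] [NumberField M] [Algebra F M] [Algebra k M] [IsScalarTower F k M]

/-- For invariant I, the ideal I² = I · τI is generated by a generator ν of the norm of I. If ν is a
unit times γ² upstairs, unique factorization of ideals gives I = (γ) there. -/
theorem exists_map_eq_span_of_smul_eq [IsGalois ℚ F] [IsGalois F k]
    (hF : Module.finrank ℚ F = 2) (hk : Module.finrank F k = 2) {i : F} (hi : i ^ 2 = -1)
    [IsPrincipalIdealRing (𝓞 F)] {d : ℕ} (hd : Squarefree d) (hd4 : d % 4 = 3) {s : k}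
    (hs : s ^ 2 = d)
    (hM : ∀ π : 𝓞 F, Prime π → π ∣ d → IsAssociatedToSquare (algebraMap (𝓞 F) (𝓞 M) π))
    {I : Ideal (𝓞 k)} (hI0 : I ≠ ⊥) (hI : ∀ τ : Gal(k/F), τ • I = I) :
    ∃ γ : 𝓞 M, I.map (algebraMap (𝓞 k) (𝓞 M)) = Ideal.span {γ} := by
  obtain ⟨τ, hτ⟩ := exists_nontrivial_gal hk
  obtain ⟨ν, hν⟩ := IsPrincipalIdealRing.principal (Ideal.relNorm (𝓞 F) I)
  have h1 := map_relNorm_eq_mul_smul hk hτ I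
  rw [hν, Ideal.submodule_span_eq, Ideal.map_span, Set.image_singleton, hI, ← sq] at h1
  have hν0 : ν ≠ 0 := by
    rintro rfl
    rw [map_zero, Ideal.span_singleton_eq_bot.mpr rfl] at h1
    exact hI0 (pow_eq_zero_iff two_ne_zero |>.mp h1.symm)
  obtain ⟨γ, hγ⟩ := isAssociatedToSquare_of_sq_eq_span hF hk hi hd hd4 hs hM ν hν0 1 0
    (one_dvd _) I (by rw [mul_one, h1])
  refine ⟨γ, ?_⟩
  have h2 : I.map (algebraMap (𝓞 k) (𝓞 M)) ^ 2 = Ideal.span {γ} ^ 2 := by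
    rw [← Ideal.map_pow, ← h1, Ideal.map_span, Set.image_singleton, Ideal.span_singleton_pow,
      Ideal.span_singleton_eq_span_singleton.mpr hγ, ← IsScalarTower.algebraMap_apply]
  refine le_antisymm ?_ ?_
  · rw [← Ideal.dvd_iff_le, ← UniqueFactorizationMonoid.pow_dvd_pow_iff_dvd two_ne_zero, h2]
  · rw [← Ideal.dvd_iff_le, ← UniqueFactorizationMonoid.pow_dvd_pow_iff_dvd two_ne_zero, h2]

end

/-! ### Square roots in the genus field -/

open Polynomial in
theorem finrank_adjoin_eq_two_of_sq_eq {K L : Type*} [Field K] [Field L] [Algebra K L] {x : L}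
    {c : K} (hx : x ^ 2 = algebraMap K L c) (hc : ∀ b : K, b ^ 2 ≠ c) :
    Module.finrank K (IntermediateField.adjoin K {x}) = 2 := by
  have hirr : Irreducible (X ^ 2 - C c) := X_pow_sub_C_irreducible_of_prime Nat.prime_two hc
  have hmon : (X ^ 2 - C c).Monic := monic_X_pow_sub_C c two_ne_zero
  have heval : aeval x (X ^ 2 - C c) = 0 := by simp [hx]
  rw [IntermediateField.adjoin.finrank ⟨_, hmon, heval⟩,
    ← minpoly.eq_of_irreducible_of_monic hirr heval hmon, natDegree_X_pow_sub_C]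

theorem not_sq_eq_natCast_of_squarefree {d : ℕ} (hd : Squarefree d) (hd1 : d ≠ 1) (b : ℚ) :
    b ^ 2 ≠ d := by
  intro h
  have h1 : IsSquare (d : ℚ) := ⟨b, by rw [← h, sq]⟩
  rw [Rat.isSquare_natCast_iff] at h1
  obtain ⟨c, rfl⟩ := h1
  have := Nat.isUnit_iff.mp (hd c dvd_rfl)
  simp [this] at hd1

theorem NumberField.RingOfIntegers.exists_sq_eq_natCast {K : Type*} [Field K] {t : K} {n : ℕ}
    (ht : t ^ 2 = n) : ∃ r : 𝓞 K, r ^ 2 = n := by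
  have hint : IsIntegral ℤ t :=
    IsIntegral.of_pow (n := 2) two_pos (by rw [ht]; exact isIntegral_natCast n)
  let r : 𝓞 K := ⟨t, hint⟩
  exact ⟨r, RingOfIntegers.coe_injective (by rw [map_pow, map_natCast]; exact ht)⟩

theorem InfinitePlace.isComplex_of_sq_eq_neg_one {k : Type*} [Field k] {j : k} (hj : j ^ 2 = -1)
    (v : InfinitePlace k) :
    v.IsComplex := by
  rw [← InfinitePlace.not_isReal_iff_isComplex]
  intro hv
  have h1 := congrArg (InfinitePlace.embedding_of_isReal hv) hj
  rw [map_pow, map_neg, map_one] at h1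
  have := sq_nonneg (InfinitePlace.embedding_of_isReal hv j)
  linarith

section

variable {k L : Type*} [Field k] [NumberField k] [Field L] [NumberField L] [Algebra k L]

open Polynomial in
-- The generator (1 + y)/2 is a root of X² - X - (c - 1)/4, whose derivative there is y, and y² = c.
theorem isUnramifiedAt_of_sq_eq_intCast {y : L} (hy : Algebra.adjoin k {y} = ⊤) {c : ℤ}
    (hc : c % 4 = 1) (hyc : y ^ 2 = c) (P : Ideal (𝓞 L)) [P.IsPrime] (hP : (c : 𝓞 L) ∉ P) :
    Algebra.IsUnramifiedAt (𝓞 k) P := by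
  obtain ⟨e, he⟩ : ∃ e : ℤ, c = 4 * e + 1 := ⟨c / 4, by omega⟩
  have hx2 : ((1 + y) / 2) ^ 2 = (1 + y) / 2 + e := by
    have : (c : L) = 4 * e + 1 := by rw [he]; push_cast; ring
    rw [this] at hyc
    linear_combination hyc / 4
  have hint : IsIntegral ℤ ((1 + y) / 2) := by
    refine ⟨X ^ 2 - X - C e, by monicity!, ?_⟩
    rw [eval₂_sub, eval₂_sub, eval₂_X_pow, eval₂_X, eval₂_C, hx2, eq_intCast]
    ring
  have hyint : IsIntegral ℤ y :=
    IsIntegral.of_pow two_pos (by rw [hyc]; exact isIntegral_algebraMap (x := c))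
  let x : 𝓞 L := ⟨(1 + y) / 2, hint⟩
  let z : 𝓞 L := ⟨y, hyint⟩
  have hz : z ^ 2 = c := RingOfIntegers.coe_injective (by rwa [map_pow, map_intCast])
  have hxz : 2 * x - 1 = z := RingOfIntegers.coe_injective (by
    simp only [map_sub, map_mul, map_ofNat, map_one]
    change 2 * ((1 + y) / 2) - 1 = y
    ring)
  have hx : Algebra.adjoin k {algebraMap (𝓞 L) L x} = ⊤ := by
    rw [← top_le_iff, ← hy, Algebra.adjoin_le_iff, Set.singleton_subset_iff]
    have h1 : y = 2 * algebraMap (𝓞 L) L x - 1 := by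
      change y = 2 * ((1 + y) / 2) - 1
      ring
    rw [h1]
    exact sub_mem (mul_mem (ofNat_mem _ 2) (Algebra.self_mem_adjoin_singleton k _)) (one_mem _)
  refine isUnramifiedAt_of_aeval_derivative_notMem k L hx (f := X ^ 2 - X - C (e : 𝓞 k)) ?_ P ?_
  · have : x ^ 2 = x + e := RingOfIntegers.coe_injective (by
      rwa [map_pow, map_add, map_intCast])
    simp [this]
  · have : aeval x (derivative (X ^ 2 - X - C (e : 𝓞 k))) = z := by
      rw [← hxz]
      rw [derivative_sub, derivative_sub, derivative_C, derivative_X, derivative_X_pow]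
      simp only [aeval_sub, aeval_mul, aeval_one, Nat.cast_ofNat, map_ofNat, sub_zero]
      simp
    rw [this]
    intro h
    apply hP
    rw [← hz]
    exact Ideal.pow_mem_of_mem P h 2 two_pos

/-- The extension is generated by √p and equally by √(-m) = i√(pm)/√p. Both radicands are 1 mod 4
and they are coprime, so at each prime one generator shows unramifiedness. The infinite places are
complex because i lies in k. -/
theorem isUnramifiedExtension_of_sq_eq {j s : k} (hj : j ^ 2 = -1) {p m : ℕ}
    (hs : s ^ 2 = (p * m : ℕ)) (hp : p % 4 = 1) (hm : m % 4 = 3) (hpm : p.Coprime m) {r : L}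
    (hr : r ^ 2 = p) (hL : Algebra.adjoin k {r} = ⊤) : IsUnramifiedExtension k L := by
  refine ⟨fun 𝔭 _ P hP _ ↦ ?_, ⟨fun w ↦ ?_⟩⟩
  · by_cases hpP : (p : 𝓞 L) ∈ P
    swap
    · exact isUnramifiedAt_of_sq_eq_intCast hL (c := p) (by omega) (by simpa using hr) P
        (by simpa using hpP)
    have hp0 : (p : L) ≠ 0 := Nat.cast_ne_zero.mpr (by omega)
    have hm0 : (m : L) ≠ 0 := Nat.cast_ne_zero.mpr (by omega)
    have hr0 : r ≠ 0 := by
      rintro rfl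
      rw [zero_pow two_ne_zero] at hr
      exact hp0 hr.symm
    have hj' : algebraMap k L j ^ 2 = -1 := by rw [← map_pow, hj, map_neg, map_one]
    have hs' : algebraMap k L s ^ 2 = p * m := by
      rw [← map_pow, hs, map_natCast, Nat.cast_mul]
    set y : L := algebraMap k L j * algebraMap k L s / r with hy
    have hy2 : y ^ 2 = -m := by
      rw [hy, div_pow, mul_pow, hj', hs', hr]
      field_simp
    have hry : r = algebraMap k L (-(j * s / m)) * y := by
      rw [map_neg, map_div₀, map_mul, map_natCast, hy]
      field_simp
      linear_combination (m : L) * hr + (algebraMap k L s) ^ 2 * hj' - hs'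
    refine isUnramifiedAt_of_sq_eq_intCast (y := y) (c := -m) ?_ (by omega)
      (by simpa using hy2) P ?_
    · rw [← top_le_iff, ← hL, Algebra.adjoin_le_iff, Set.singleton_subset_iff]
      nth_rewrite 1 [hry]
      exact mul_mem (Subalgebra.algebraMap_mem _ _) (Algebra.self_mem_adjoin_singleton k _)
    · intro hmP
      apply hP.ne_top
      rw [Ideal.eq_top_iff_one]
      have h1 : (p : ℤ) * p.gcdA m + m * p.gcdB m = 1 := by
        rw [← Nat.gcd_eq_gcd_ab, hpm.gcd_eq_one, Nat.cast_one]
      have h2 := congrArg (Int.cast : ℤ → 𝓞 L) h1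
      push_cast at h2 hmP
      rw [← h2]
      exact add_mem (P.mul_mem_right _ hpP) (P.mul_mem_right _ (neg_mem_iff.mp hmP))
  · rw [InfinitePlace.isUnramified_iff]
    exact .inr (InfinitePlace.isComplex_of_sq_eq_neg_one hj _)

end

section

variable {k : Type*} [Field k] [NumberField k]

theorem mem_genusField_of_sq_eq {j s : k} (hj : j ^ 2 = -1) {p m : ℕ}
    (hs : s ^ 2 = (p * m : ℕ)) (hp : p % 4 = 1) (hm : m % 4 = 3) (hpm : p.Coprime m)
    (hpsq : Squarefree p) (hp1 : p ≠ 1) {r : AlgebraicClosure k} (hr : r ^ 2 = p) :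
    r ∈ genusField k := by
  have hle : IntermediateField.adjoin k {r} ≤ genusField k := by
    refine le_sSup ?_
    have hint : IsIntegral k r := Algebra.IsIntegral.isIntegral r
    have hfin : FiniteDimensional k (IntermediateField.adjoin k {r}) :=
      IntermediateField.adjoin.finiteDimensional hint
    have hnf : NumberField (IntermediateField.adjoin k {r}) :=
      NumberField.of_module_finite k _
    refine ⟨hfin, ?_, IntermediateField.adjoin ℚ {r}, ?_, ?_⟩
    · refine isUnramifiedExtension_of_sq_eq hj hs hp hm hpm
        (r := IntermediateField.AdjoinSimple.gen k r) ?_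
        (IntermediateField.adjoin.powerBasis hint).adjoin_gen_eq_top
      exact Subtype.ext (by simpa using hr)
    · have : Algebra.IsQuadraticExtension ℚ (IntermediateField.adjoin ℚ {r}) :=
        { finrank_eq_two' := finrank_adjoin_eq_two_of_sq_eq (c := (p : ℚ))
            (by rw [hr, map_natCast]) (not_sq_eq_natCast_of_squarefree hpsq hp1) }
      exact { }
    · refine le_antisymm ?_ ?_
      · refine IntermediateField.adjoin.mono k _ _ ?_
        exact IntermediateField.subset_adjoin ℚ {r}
      · rw [IntermediateField.adjoin_le_iff]
        have : IntermediateField.adjoin ℚ {r} ≤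
            (IntermediateField.adjoin k {r}).restrictScalars ℚ := by
          rw [IntermediateField.adjoin_le_iff]
          exact IntermediateField.subset_adjoin k {r}
        exact this
  exact hle (IntermediateField.mem_adjoin_simple_self k r)

/-- No finiteness of L over k is assumed, so this applies directly to the genus field, a compositum.
-/
theorem mk0_mem_capitulationKernel_of_map_eq_span {L : Type*} [Field L] [Algebra k L]
    (I : (Ideal (𝓞 k))⁰) {γ : 𝓞 L}
    (hγ : (I : Ideal (𝓞 k)).map (algebraMap (𝓞 k) (𝓞 L)) = Ideal.span {γ}) :
    ClassGroup.mk0 I ∈ capitulationKernel k L := by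
  rw [capitulationKernel, MonoidHom.mem_ker, ClassGroup.extendedHom_mk0', ClassGroup.mk_eq_one_iff]
  refine ⟨algebraMap (𝓞 L) (FractionRing (𝓞 L)) γ, ?_⟩
  rw [Units.coe_map]
  have h1 : (FractionalIdeal.extendedHom (FractionRing (𝓞 L)) (𝓞 L)
      ((I : Ideal (𝓞 k)) : FractionalIdeal (𝓞 k)⁰ (FractionRing (𝓞 k)))) =
      FractionalIdeal.spanSingleton (𝓞 L)⁰ (algebraMap (𝓞 L) (FractionRing (𝓞 L)) γ) := by
    rw [FractionalIdeal.extendedHom_coeIdeal_eq_map, hγ, FractionalIdeal.coeIdeal_span_singleton]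
  rw [← FractionalIdeal.coe_spanSingleton (𝓞 L)⁰, ← h1]
  rfl

/-- The strongly ambiguous classes capitulate in the genus field. -/
theorem stronglyAmbiguousClasses_le_capitulationKernel_genusField {F : Type*} [Field F]
    [NumberField F] [Algebra F k] [IsGalois ℚ F] [IsGalois F k] (hF : Module.finrank ℚ F = 2)
    (hk : Module.finrank F k = 2) {i : F} (hi : i ^ 2 = -1) {p₁ p₂ q : ℕ} (hp₁ : p₁.Prime)
    (hp₂ : p₂.Prime) (hq : q.Prime) (h₁ : p₁ % 4 = 1) (h₂ : p₂ % 4 = 1) (h₃ : q % 4 = 3)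
    (hd : Squarefree (p₁ * p₂ * q)) {s : k} (hs : s ^ 2 = (p₁ * p₂ * q : ℕ)) :
    stronglyAmbiguousClasses F k ≤ capitulationKernel k (genusField k) := by
  have hd4 : p₁ * p₂ * q % 4 = 3 := by simp [Nat.mul_mod, h₁, h₂, h₃]
  have hint : IsIntegral ℤ i :=
    IsIntegral.of_pow (n := 2) two_pos (by rw [hi]; exact isIntegral_one.neg)
  let j : 𝓞 F := ⟨i, hint⟩
  have hj : j ^ 2 = -1 := RingOfIntegers.coe_injective hi
  have := isPrincipalIdealRing_of_sq_eq_neg_one hF hj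
  have hjk : algebraMap F k i ^ 2 = -1 := by rw [← map_pow, hi, map_neg, map_one]
  obtain ⟨r₁, hr₁⟩ := IsAlgClosed.exists_pow_nat_eq (p₁ : AlgebraicClosure k) two_pos
  obtain ⟨r₂, hr₂⟩ := IsAlgClosed.exists_pow_nat_eq (p₂ : AlgebraicClosure k) two_pos
  have hr₁mem : r₁ ∈ genusField k := by
    have he : p₁ * p₂ * q = p₁ * (p₂ * q) := by ring
    refine mem_genusField_of_sq_eq hjk (he ▸ hs) h₁ (by simp [Nat.mul_mod, h₂, h₃])
      (Nat.coprime_of_squarefree_mul (he ▸ hd)) hp₁.squarefree hp₁.ne_one hr₁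
  have hr₂mem : r₂ ∈ genusField k := by
    have he : p₁ * p₂ * q = p₂ * (p₁ * q) := by ring
    refine mem_genusField_of_sq_eq hjk (he ▸ hs) h₂ (by simp [Nat.mul_mod, h₁, h₃])
      (Nat.coprime_of_squarefree_mul (he ▸ hd)) hp₂.squarefree hp₂.ne_one hr₂
  -- The ideal arithmetic takes place in the number field k(√p₁, √p₂), which also contains √q; the
  -- generator found there is then carried into the genus field.
  set M := IntermediateField.adjoin k {r₁, r₂} with hM
  have hMle : M ≤ genusField k := by
    rw [hM, IntermediateField.adjoin_le_iff]
    rintro x (rfl | rfl)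
    · exact hr₁mem
    · exact hr₂mem
  have hfin : FiniteDimensional k M :=
    IntermediateField.finiteDimensional_adjoin fun x _ ↦ Algebra.IsIntegral.isIntegral x
  have hnf : NumberField M := NumberField.of_module_finite k M
  let t₁ : M := ⟨r₁, IntermediateField.subset_adjoin k _ (by simp)⟩
  let t₂ : M := ⟨r₂, IntermediateField.subset_adjoin k _ (by simp)⟩
  have ht₁ : t₁ ^ 2 = p₁ := Subtype.ext (by simpa [t₁] using hr₁)
  have ht₂ : t₂ ^ 2 = p₂ := Subtype.ext (by simpa [t₂] using hr₂)
  have ht₃ : (algebraMap k M s / (t₁ * t₂)) ^ 2 = q := by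
    have h1 : (p₁ : M) ≠ 0 := Nat.cast_ne_zero.mpr hp₁.ne_zero
    have h2 : (p₂ : M) ≠ 0 := Nat.cast_ne_zero.mpr hp₂.ne_zero
    rw [div_pow, mul_pow, ht₁, ht₂, ← map_pow, hs, map_natCast]
    push_cast
    field_simp
  obtain ⟨u₁, hu₁⟩ := RingOfIntegers.exists_sq_eq_natCast ht₁
  obtain ⟨u₂, hu₂⟩ := RingOfIntegers.exists_sq_eq_natCast ht₂
  obtain ⟨u₃, hu₃⟩ := RingOfIntegers.exists_sq_eq_natCast ht₃
  have hsq : ∀ π : 𝓞 F, Prime π → π ∣ (p₁ * p₂ * q : ℕ) →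
      IsAssociatedToSquare (algebraMap (𝓞 F) (𝓞 M) π) := by
    intro π hπ hdvd
    rw [Nat.cast_mul, Nat.cast_mul] at hdvd
    rcases hπ.dvd_or_dvd hdvd with hdvd | hdvd
    · rcases hπ.dvd_or_dvd hdvd with hdvd | hdvd
      · exact isAssociatedToSquare_of_prime_dvd_of_mod_four_eq_one hF hj hp₁ h₁ hu₁ hπ hdvd
      · exact isAssociatedToSquare_of_prime_dvd_of_mod_four_eq_one hF hj hp₂ h₂ hu₂ hπ hdvd
    · exact isAssociatedToSquare_of_prime_dvd_of_mod_four_eq_three hF hj hq h₃ hu₃ hπ hdvd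
  rw [stronglyAmbiguousClasses, Subgroup.closure_le]
  rintro _ ⟨I, hI, rfl⟩
  obtain ⟨γ, hγ⟩ := exists_map_eq_span_of_smul_eq hF hk hi hd hd4 hs hsq
    (nonZeroDivisors.coe_ne_zero I) hI
  let φ : 𝓞 M →+* 𝓞 (genusField k) :=
    RingOfIntegers.mapRingHom (IntermediateField.inclusion hMle).toRingHom
  refine mk0_mem_capitulationKernel_of_map_eq_span I (γ := φ γ) ?_
  rw [← Set.image_singleton, ← Ideal.map_span, ← hγ, Ideal.map_map]
  rfl

end

/-! ### The field `ℚ(√d, i)` -/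

/-- A field containing i is totally complex, so it has n + 1 infinite places; Dirichlet's theorem
gives the ranks 1 and 3 in degrees 4 and 8. -/
theorem rank_eq_of_sq_eq_neg_one {k : Type*} [Field k] [NumberField k] {j : k} (hj : j ^ 2 = -1)
    {n : ℕ} (hn : Module.finrank ℚ k = 2 * (n + 1)) : Units.rank k = n := by
  have : IsTotallyComplex k := ⟨InfinitePlace.isComplex_of_sq_eq_neg_one hj⟩
  have h1 := IsTotallyComplex.finrank k
  have h2 := InfinitePlace.card_eq_nrRealPlaces_add_nrComplexPlaces k
  rw [IsTotallyComplex.nrRealPlaces_eq_zero k] at h2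
  rw [Units.rank]
  omega

theorem imagUnit_sq (d : ℕ) : imagUnit d ^ 2 = -1 :=
  Subtype.ext Complex.I_sq

/-- The element `√d` of `ℚ(√d, i)`. -/
noncomputable def sqrtElement (d : ℕ) : biquadraticField d :=
  ⟨((Real.sqrt d : ℝ) : ℂ), IntermediateField.subset_adjoin _ _ (by simp)⟩

theorem sqrtElement_sq (d : ℕ) : sqrtElement d ^ 2 = d := Subtype.ext (by
  change ((Real.sqrt d : ℝ) : ℂ) ^ 2 = ((d : biquadraticField d) : ℂ)
  rw [← Complex.ofReal_pow, Real.sq_sqrt d.cast_nonneg, Complex.ofReal_natCast]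
  rfl)

theorem finrank_gaussianField (d : ℕ) : Module.finrank ℚ (gaussianField d) = 2 :=
  finrank_adjoin_eq_two_of_sq_eq (c := -1) (by rw [imagUnit_sq, map_neg, map_one]) fun b hb ↦ by
    linarith [sq_nonneg b]

/-- The element `i` of `ℚ(i)`. -/
noncomputable def gaussianUnit (d : ℕ) : gaussianField d :=
  IntermediateField.AdjoinSimple.gen ℚ (imagUnit d)

theorem gaussianUnit_sq (d : ℕ) : gaussianUnit d ^ 2 = -1 :=
  Subtype.ext (imagUnit_sq d)

theorem adjoin_sqrtElement (d : ℕ) :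
    IntermediateField.adjoin (gaussianField d) {sqrtElement d} = ⊤ := by
  rw [eq_top_iff]
  rintro ⟨z, hz⟩ -
  induction hz using IntermediateField.adjoin_induction with
  | mem x hx =>
    rcases hx with rfl | rfl
    · exact IntermediateField.mem_adjoin_simple_self _ (sqrtElement d)
    · exact IntermediateField.algebraMap_mem _ (gaussianUnit d)
  | algebraMap x =>
    exact IntermediateField.algebraMap_mem _ (algebraMap ℚ (gaussianField d) x)
  | add x y hx hy ihx ihy => exact add_mem ihx ihy
  | mul x y hx hy ihx ihy => exact mul_mem ihx ihy
  | inv x hx ih => exact inv_mem ih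

theorem finrank_biquadraticField {d : ℕ} (hd : Squarefree d) (hd1 : d ≠ 1) :
    Module.finrank (gaussianField d) (biquadraticField d) = 2 := by
  have : IsGalois ℚ (gaussianField d) := by
    have : Algebra.IsQuadraticExtension ℚ (gaussianField d) := ⟨finrank_gaussianField d⟩
    infer_instance
  rw [← IntermediateField.finrank_top', ← adjoin_sqrtElement]
  exact finrank_adjoin_eq_two_of_sq_eq (c := (d : gaussianField d))
    (by rw [sqrtElement_sq, map_natCast])
    (not_gaussian_of_sq_eq (finrank_gaussianField d) (gaussianUnit_sq d) hd hd1)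

theorem mainTheorem1 (p₁ p₂ q : ℕ) (hp₁ : p₁.Prime) (hp₂ : p₂.Prime) (hq : q.Prime)
    (hne : p₁ ≠ p₂) (h₁ : p₁ ≡ 1 [MOD 4]) (h₂ : p₂ ≡ 1 [MOD 4]) (h₃ : -(q : ℤ) ≡ 1 [ZMOD 4])
    (K : Type*) [Field K] [NumberField K] [Algebra (biquadraticField (p₁ * p₂ * q)) K]
    (hdeg : Module.finrank (biquadraticField (p₁ * p₂ * q)) K = 2)
    (hunr : IsUnramifiedExtension (biquadraticField (p₁ * p₂ * q)) K)
    (hab : IsAbelianGalois ℚ K) :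
    (Nat.card (capitulationKernel (biquadraticField (p₁ * p₂ * q)) K) = 2 ∨
      Nat.card (capitulationKernel (biquadraticField (p₁ * p₂ * q)) K) = 4 ∨
      Nat.card (capitulationKernel (biquadraticField (p₁ * p₂ * q)) K) = 8) ∧
    capitulationKernel (biquadraticField (p₁ * p₂ * q)) K ≤
      stronglyAmbiguousClasses (gaussianField (p₁ * p₂ * q)) (biquadraticField (p₁ * p₂ * q)) ∧
    stronglyAmbiguousClasses (gaussianField (p₁ * p₂ * q)) (biquadraticField (p₁ * p₂ * q)) ≤
      capitulationKernel (biquadraticField (p₁ * p₂ * q))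
        (genusField (biquadraticField (p₁ * p₂ * q))) := by
  have h₁' : p₁ % 4 = 1 := h₁
  have h₂' : p₂ % 4 = 1 := h₂
  have h₃' : q % 4 = 3 := by
    have : -(q : ℤ) % 4 = 1 := h₃
    omega
  have hsq : Squarefree (p₁ * p₂ * q) := by
    have c12 : p₁.Coprime p₂ := (Nat.coprime_primes hp₁ hp₂).mpr hne
    have c13 : p₁.Coprime q := (Nat.coprime_primes hp₁ hq).mpr (by rintro rfl; omega)
    have c23 : p₂.Coprime q := (Nat.coprime_primes hp₂ hq).mpr (by rintro rfl; omega)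
    rw [Nat.squarefree_mul (Nat.Coprime.mul_left c13 c23), Nat.squarefree_mul c12]
    exact ⟨⟨hp₁.squarefree, hp₂.squarefree⟩, hq.squarefree⟩
  have hd1 : p₁ * p₂ * q ≠ 1 := by
    have : p₁ * p₂ * q % 4 = 3 := by simp [Nat.mul_mod, h₁', h₂', h₃']
    omega
  have hF := finrank_gaussianField (p₁ * p₂ * q)
  have hk := finrank_biquadraticField hsq hd1
  have : IsScalarTower (gaussianField (p₁ * p₂ * q)) (biquadraticField (p₁ * p₂ * q)) K :=
    inferInstance
  have : Algebra.IsQuadraticExtension ℚ (gaussianField (p₁ * p₂ * q)) := ⟨hF⟩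
  have : Algebra.IsQuadraticExtension (gaussianField (p₁ * p₂ * q))
    (biquadraticField (p₁ * p₂ * q)) := ⟨hk⟩
  have : Algebra.IsQuadraticExtension (biquadraticField (p₁ * p₂ * q)) K := ⟨hdeg⟩
  have : IsGalois (gaussianField (p₁ * p₂ * q)) K := IsGalois.tower_top_of_isGalois ℚ _ K
  have hi := gaussianUnit_sq (p₁ * p₂ * q)
  have hs := sqrtElement_sq (p₁ * p₂ * q)
  have hk4 : Module.finrank ℚ (biquadraticField (p₁ * p₂ * q)) = 4 := by
    rw [← Module.finrank_mul_finrank ℚ (gaussianField (p₁ * p₂ * q)), hF, hk]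
  have hK8 : Module.finrank ℚ K = 8 := by
    rw [← Module.finrank_mul_finrank ℚ (biquadraticField (p₁ * p₂ * q)), hk4, hdeg]
  refine ⟨?_, ?_, ?_⟩
  · refine card_capitulationKernel_of_rank hdeg hunr.1
      (rank_eq_of_sq_eq_neg_one (imagUnit_sq (p₁ * p₂ * q)) (by omega))
      (rank_eq_of_sq_eq_neg_one
        (j := algebraMap (biquadraticField (p₁ * p₂ * q)) K (imagUnit (p₁ * p₂ * q))) ?_ (by omega))
    rw [← map_pow, imagUnit_sq, map_neg, map_one]
  · exact capitulationKernel_le_stronglyAmbiguousClasses hF hk hdeg hi hp₁ hp₂ hq h₁' h₂' h₃' hsq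
      hs hunr.1
  · exact stronglyAmbiguousClasses_le_capitulationKernel_genusField hF hk hi hp₁ hp₂ hq h₁' h₂' h₃'
      hsq hs
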